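/- All notions are those for Arveson systems of noises. A noise is a standard probability space $(\Omega,\mathcal F,P)$ with sub-$\sigma$-fields $\mathcal F_{s,t}$ ($s<t$) and a measurable measure-preserving action $(T_h)_{h\in\mathbb R}$ such that (modulo null sets) $\mathcal F_{r,s}$ and $\mathcal F_{s,t}$ are independent and generate $\mathcal F_{r,t}$ for $r<s<t$; $T_h$ sends $\mathcal F_{s,t}$ to $\mathcal F_{s+h,t+h}$ (via $X\mapsto X\circ T_h$); and all $\mathcal F_{s,t}$ generate $\mathcal F$. Its Arveson system is $H_t=L_2(\Omega,\mathcal F_{0,t},P)$, $t>0$ (complex), with the product $XY=X\cdot(Y\circ T_s)\in H_{s+t}$ for $X\in H_s$, $Y\in H_t$. A unit is a Borel family of non-zero $u_t\in H_t$ with $u_su_t=u_{s+t}$; it is normalized if $\|u_t\|=1$ for all $t$. An isomorphism of such systems (or subsystems) is a family of unitary operators $\Theta_t$ with $\Theta_{s+t}(XY)=(\Theta_sX)(\Theta_tY)$ such that $t\mapsto\langle\Theta_tX_t,Y_t\rangle$ is Borel for all Borel $X_t,Y_t$; an automorphism is an isomorphism of a system to itself. The noise extends the white noise if random variables $B_t$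 ($t\in\mathbb R$) are given with $B_0=0$, with $B_t-B_s$ being $\mathcal F_{s,t}$-measurable and $N(0,t-s)$-distributed for $s<t$, and with $(B_t-B_s)\circ T_h=B_{t+h}-B_{s+h}$. Then $H_t^{\mathrm{white}}\subset H_t$ denotes the space of square integrable functionals of $B|_{[0,t]}$; $(H_t^{\mathrm{white}})_t$ is the Arveson system of type $I_1$. Two such extensions, $(H_t)$ with $B$ and $(H'_t)$ with $B'$, are isomorphic as extensions if there is an isomorphism $\Theta_t:H_t\to H'_t$ with $\Theta_t(X(B|_{[0,t]}))=X(B'|_{[0,t]})$ for all $t$ and all $X(B|_{[0,t]})\in H_t^{\mathrm{white}}$. The extension obtained by the drift $c\in\mathbb R$ is the noise with the same $(\Omega,\mathcal F)$, $(\mathcal F_{s,t})$, $(T_h)$ and a new probability measure $P'$, equivalent to $P$ on each $\mathcal F_{s,t}$, with density $\exp(cB_t-\tfrac12c^2t)$ on $\mathcal F_{0,t}$ for each $t>0$, taken with the Brownian motion $B'_t=B_t-ct$. (Here equalities modulo null sets between the common objects, that is the relations between the $\sigma$-fields and the adaptedness and stationarity of $B$, are understood modulo sets that are null for both $P$ and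 $P'$.) The equivalence classes of normalized units of $(H^{\mathrm{white}}_t)_t$ up to factors $e^{ict}$, $c\in\mathbb R$, are parametrized by $z\in\mathbb C$ via $u_t=\exp(zB_t-(\operatorname{Re}z)^2t)$, and automorphisms of $(H_t^{\mathrm{white}})_t$ act on this plane $\mathbb C$ by motions (orientation preserving isometries). For $\lambda\in\mathbb R$ the imaginary shift $\Theta^{\mathrm{shift}(i\lambda)}$, which induces $z\mapsto z+i\lambda$, is multiplication by $e^{i\lambda B_t}$, and the real shift $\Theta^{\mathrm{shift}(\lambda)}$, which induces $z\mapsto z+\lambda$, is $X(B|_{[0,t]})\mapsto e^{\lambda B_t-\lambda^2t}X\bigl((B_s-2\lambda s)_{s\in[0,t]}\bigr)$; both are automorphisms of $(H_t^{\mathrm{white}})_t$. Corollary. Let a noise extending the white noise be drift sensitive: for every $c\in\mathbb R\setminus\{0\}$ the extension obtained by the drift $c$ exists and is not isomorphic, as an extension, to the original one. Then: (1) for no $\lambda\in\mathbb R\setminus\{0\}$ does $\Theta^{\mathrm{shift}(\lambda)}$ extend to an automorphism of $(H_t)_t$, and for every $\lambda\in\mathbb R$ the automorphism $\Theta^{\mathrm{shift}(i\lambda)}$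 does; (2) let $G$ be the set (a group) of all motions of $\mathbb C$ that are induced by automorphisms of $(H_t^{\mathrm{white}})_t$ extendable to $(H_t)_t$. Then $G$ does not contain $z\mapsto z+\lambda$ for real $\lambda\ne0$, contains $z\mapsto z+i\lambda$ for every real $\lambda$, and is not transitive on $\mathbb C$; (3) if moreover the white noise is the classical part of the noise, in the sense that $(H_t)_t$ has no units other than those of $(H_t^{\mathrm{white}})_t$, then the Arveson system $(H_t)_t$ is of type $II_1$ (it is not generated by its units, and the subsystem generated by its units is isomorphic to the type $I_1$ system), and the action of its group of automorphisms on the set of its normalized units is not transitive. -/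

import Mathlib

open MeasureTheory ProbabilityTheory Set
open scoped ENNReal

/-- Positive times. -/
abbrev PosTime : Type := {t : ℝ // 0 < t}

/-- The positive time `t / (m + 1)`. -/
noncomputable def PosTime.part (t : PosTime) (m : ℕ) : PosTime :=
  ⟨(t : ℝ) / (m + 1), div_pos t.2 (by positivity)⟩

/-- Two σ-fields coincide modulo `μ`-null sets. -/
def EqModZero {Ω : Type*} [MeasurableSpace Ω] (μ : Measure Ω) (m₁ m₂ : MeasurableSpace Ω) : Prop :=
  (∀ A, MeasurableSet[m₁] A → ∃ A', MeasurableSet[m₂] A' ∧ A =ᵐ[μ] A') ∧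
    (∀ A, MeasurableSet[m₂] A → ∃ A', MeasurableSet[m₁] A' ∧ A =ᵐ[μ] A')

/-- A noise on a standard Borel space `Ω`: a probability measure `P`, sub-σ-fields `F s t`
(only `s < t` is relevant), and a measurable measure-preserving action `T` of `ℝ`. All relations
between σ-fields are understood modulo null sets. A random variable `X` is moved by `T h` to
`X ∘ T h`, and this sends `F s t`-measurable variables to `F (s + h) (t + h)`-measurable ones. -/
structure Noise (Ω : Type*) [m : MeasurableSpace Ω] [StandardBorelSpace Ω] where
  P : Measure Ω
  isProb : IsProbabilityMeasure P
  F : ℝ → ℝ → MeasurableSpace Ω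
  F_le : ∀ s t, s < t → F s t ≤ m
  T : ℝ → Ω → Ω
  measurable_T : Measurable fun p : ℝ × Ω => T p.1 p.2
  T_zero : ∀ ω, T 0 ω = ω
  T_add : ∀ h k ω, T (h + k) ω = T h (T k ω)
  T_preserving : ∀ h, MeasurePreserving (T h) P P
  indep : ∀ r s t, r < s → s < t → Indep (F r s) (F s t) P
  sup_eq : ∀ r s t, r < s → s < t → EqModZero P (F r s ⊔ F s t) (F r t)
  shift : ∀ s t h, s < t → EqModZero P ((F s t).comap (T h)) (F (s + h) (t + h))
  generates : EqModZero P (⨆ (s : ℝ) (t : ℝ) (_ : s < t), F s t) m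

namespace Noise

section Basic

variable {Ω : Type*} [MeasurableSpace Ω] [StandardBorelSpace Ω]

/-- The Hilbert space `H_t = L₂(Ω, F_{0,t}, P)`, as a closed subspace of `L₂(Ω, P)`. -/
noncomputable def H (N : Noise Ω) (t : PosTime) : Submodule ℂ (Lp ℂ 2 N.P) :=
  lpMeas ℂ ℂ (N.F 0 t) 2 N.P

/-- `Z` is the product `X Y`, the image of `X ⊗ Y` under `H_s ⊗ H_t → H_{s+t}`: the random
variable `ω ↦ X(ω) Y(T_s ω)`. (For `X ∈ H_s` and `Y ∈ H_t` the two factors are independent, hence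
the product is square integrable and such `Z ∈ H_{s+t}` exists and is unique.) -/
def IsProd (N : Noise Ω) (s : PosTime) (X Y Z : Lp ℂ 2 N.P) : Prop :=
  (Z : Ω → ℂ) =ᵐ[N.P] fun ω => X ω * Y (N.T s ω)

/-- Borel measurability of a map from `(0,∞)` to `L₂`. -/
def BorelMap (N : Noise Ω) (X : PosTime → Lp ℂ 2 N.P) : Prop :=
  @Measurable PosTime (Lp ℂ 2 N.P) _ (borel _) X

/-- A unit of the Arveson system `(H_t)`. -/
structure IsUnit (N : Noise Ω) (u : PosTime → Lp ℂ 2 N.P) : Prop where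
  mem : ∀ t, u t ∈ N.H t
  ne_zero : ∀ t, u t ≠ 0
  borel : N.BorelMap u
  mul : ∀ s t : PosTime, N.IsProd s (u s) (u t) (u (s + t))

/-- A normalized unit. -/
def IsNormalizedUnit (N : Noise Ω) (u : PosTime → Lp ℂ 2 N.P) : Prop :=
  N.IsUnit u ∧ ∀ t, ‖u t‖ = 1

/-- `z` is the product `(u_0)_{t/n} (u_1)_{t/n} ⋯ (u_{n-1})_{t/n}` of units, with `n = m + 1`. -/
def IsUnitProduct (N : Noise Ω) (t : PosTime) (z : Lp ℂ 2 N.P) : Prop :=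
  ∃ (m : ℕ) (u : Fin (m + 1) → PosTime → Lp ℂ 2 N.P), (∀ k, N.IsUnit (u k)) ∧
    (z : Ω → ℂ) =ᵐ[N.P] fun ω =>
      ∏ k : Fin (m + 1), (u k (t.part m) : Ω → ℂ) (N.T ((k : ℕ) * (t.part m : ℝ)) ω)

/-- The subsystem generated by the units of `(H_t)`: the closed linear span of their products. -/
noncomputable def unitSpan (N : Noise Ω) (t : PosTime) : Submodule ℂ (Lp ℂ 2 N.P) :=
  (Submodule.span ℂ {z | N.IsUnitProduct t z}).topologicalClosure

/-- Type `I`: the system is generated by its units. -/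
def IsTypeI (N : Noise Ω) : Prop := ∀ t, N.unitSpan t = N.H t

/-- A Brownian motion adapted to the noise, making the noise an extension of the white noise. -/
structure IsAdaptedBM (N : Noise Ω) (B : ℝ → Ω → ℝ) : Prop where
  measurable : ∀ t, Measurable (B t)
  adapted : ∀ s t, s < t → AEStronglyMeasurable[N.F s t] (fun ω => B t ω - B s ω) N.P
  law : ∀ s t, s < t → N.P.map (fun ω => B t ω - B s ω) = gaussianReal 0 (t - s).toNNReal
  zero : ∀ᵐ ω ∂N.P, B 0 ω = 0
  stationary : ∀ s t h, s < t →
    ∀ᵐ ω ∂N.P, B t (N.T h ω) - B s (N.T h ω) = B (t + h) ω - B (s + h) ω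

/-- The σ-field generated by `B_u - B_s`, `u ∈ (s,t)`. -/
@[reducible] def whiteField (B : ℝ → Ω → ℝ) (s t : ℝ) : MeasurableSpace Ω :=
  ⨆ u ∈ Ioo s t, MeasurableSpace.comap (fun ω => B u ω - B s ω) (borel ℝ)

/-- `H_t^white`, the `L₂` space over the white noise generated by `B`. -/
noncomputable def Hwhite (N : Noise Ω) (B : ℝ → Ω → ℝ) (t : PosTime) : Submodule ℂ (Lp ℂ 2 N.P) :=
  lpMeas ℂ ℂ (whiteField B 0 t) 2 N.P

/-- The restriction of the path of `B` to `[0,t]`, an element of the path space `ℝ^[0,t]` with its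
product σ-field. -/
def path (B : ℝ → Ω → ℝ) (t : PosTime) (ω : Ω) : Icc (0 : ℝ) (t : ℝ) → ℝ := fun s => B s ω

end Basic

/-- An isomorphism `(Θ_t)` between two systems of subspaces `E_t ⊂ L₂(Ω,P)`,
`E'_t ⊂ L₂(Ω',P')` (with the products of the two noises). -/
structure SystemIso {Ω Ω' : Type*} [MeasurableSpace Ω] [StandardBorelSpace Ω]
    [MeasurableSpace Ω'] [StandardBorelSpace Ω'] (N : Noise Ω)
    (E : PosTime → Submodule ℂ (Lp ℂ 2 N.P)) (N' : Noise Ω')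
    (E' : PosTime → Submodule ℂ (Lp ℂ 2 N'.P)) where
  op : ∀ t, E t ≃ₗᵢ[ℂ] E' t
  map_mul : ∀ (s t : PosTime) (X : E s) (Y : E t) (Z : E (s + t)),
    N.IsProd s X Y Z → N'.IsProd s (op s X) (op t Y) (op (s + t) Z)
  measurable : ∀ (X : ∀ t, E t) (Y : ∀ t, E' t),
    N.BorelMap (fun t => (X t : Lp ℂ 2 N.P)) → N'.BorelMap (fun t => (Y t : Lp ℂ 2 N'.P)) →
      Measurable fun t : PosTime => inner ℂ (op t (X t)) (Y t)

section Systems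

variable {Ω : Type*} [MeasurableSpace Ω] [StandardBorelSpace Ω]

/-- Automorphisms of the Arveson system `(H_t)` of the noise. -/
abbrev Aut (N : Noise Ω) := SystemIso N N.H N N.H

/-- Automorphisms of the type `I₁` system `(H_t^white)`. -/
abbrev WhiteAut (N : Noise Ω) (B : ℝ → Ω → ℝ) := SystemIso N (N.Hwhite B) N (N.Hwhite B)

/-- The automorphisms act transitively on the normalized units. -/
def UnitTransitive (N : Noise Ω) : Prop :=
  ∀ u v, N.IsNormalizedUnit u → N.IsNormalizedUnit v →
    ∃ Θ : N.Aut, ∀ (t : PosTime) (x : N.H t), (x : Lp ℂ 2 N.P) = u t →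
      ((Θ.op t x : N.H t) : Lp ℂ 2 N.P) = v t

/-- An automorphism `Θw` of `(H_t^white)` is the restriction of some automorphism of `(H_t)`. -/
def Extendable (N : Noise Ω) (B : ℝ → Ω → ℝ) (Θw : N.WhiteAut B) : Prop :=
  ∃ Θ : N.Aut, ∀ (t : PosTime) (ψ : N.Hwhite B t) (x : N.H t), (x : Lp ℂ 2 N.P) = ψ →
    ((Θ.op t x : N.H t) : Lp ℂ 2 N.P) = Θw.op t ψ

/-- `Θ^{shift(lam)}`, the real shift: `(Θ_t X)(b) = exp (lam b(t) - lam² t) X(θ b)`,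
where `(θ b)(s) = b(s) - 2 lam s`. -/
def IsRealShift (N : Noise Ω) (B : ℝ → Ω → ℝ) (lam : ℝ) (Θw : N.WhiteAut B) : Prop :=
  ∀ (t : PosTime) (X : (Icc (0 : ℝ) (t : ℝ) → ℝ) → ℂ) (ψ : N.Hwhite B t), Measurable X →
    ((ψ : Lp ℂ 2 N.P) : Ω → ℂ) =ᵐ[N.P] (fun ω => X (path B t ω)) →
    ((Θw.op t ψ : Lp ℂ 2 N.P) : Ω → ℂ) =ᵐ[N.P] fun ω =>
      (Real.exp (lam * B t ω - lam ^ 2 * t) : ℂ) * X (fun s => path B t ω s - 2 * lam * s)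

/-- `Θ^{shift(i lam)}`, the imaginary shift: multiplication by `exp (i lam B_t)`. -/
def IsImagShift (N : Noise Ω) (B : ℝ → Ω → ℝ) (lam : ℝ) (Θw : N.WhiteAut B) : Prop :=
  ∀ (t : PosTime) (ψ : N.Hwhite B t),
    ((Θw.op t ψ : Lp ℂ 2 N.P) : Ω → ℂ) =ᵐ[N.P] fun ω =>
      Complex.exp (Complex.I * lam * B t ω) * (ψ : Lp ℂ 2 N.P) ω

/-- The normalized unit `exp (z B_t - (Re z)² t)` of `(H_t^white)`, as a random variable. -/
noncomputable def stdUnit (B : ℝ → Ω → ℝ) (z : ℂ) (t : PosTime) (ω : Ω) : ℂ :=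
  Complex.exp (z * B t ω - (z.re : ℂ) ^ 2 * (t : ℝ))

/-- `Θw` acts on the plane of equivalence classes of normalized units of `(H_t^white)` (units up
to factors `exp (i c t)`, parametrized by `z ∈ ℂ`) by the motion `g`. The motions, i.e. the
orientation preserving isometries of the plane, are the complex affine isometries of `ℂ`. -/
def Induces (N : Noise Ω) (B : ℝ → Ω → ℝ) (Θw : N.WhiteAut B) (g : ℂ ≃ᵃⁱ[ℂ] ℂ) : Prop :=
  ∀ z : ℂ, ∃ c : ℝ, ∀ (t : PosTime) (ψ : N.Hwhite B t),
    ((ψ : Lp ℂ 2 N.P) : Ω → ℂ) =ᵐ[N.P] stdUnit B z t →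
    ((Θw.op t ψ : Lp ℂ 2 N.P) : Ω → ℂ) =ᵐ[N.P] fun ω =>
      Complex.exp (Complex.I * c * (t : ℝ)) * stdUnit B (g z) t ω

/-- The motions of the plane that correspond to extendable automorphisms of `(H_t^white)`. -/
def extendableMotions (N : Noise Ω) (B : ℝ → Ω → ℝ) : Set (ℂ ≃ᵃⁱ[ℂ] ℂ) :=
  {g | ∃ Θw : N.WhiteAut B, N.Extendable B Θw ∧ N.Induces B Θw g}

/-- `(H_t)` has no units other than those of `(H_t^white)`. -/
def NoOtherUnits (N : Noise Ω) (B : ℝ → Ω → ℝ) : Prop :=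
  ∀ u, N.IsUnit u → ∀ t, u t ∈ N.Hwhite B t

end Systems

/-- Type `II₁`: not of type `I`, and the subsystem generated by units is of type `I₁`, that is,
isomorphic to the system `(H_t^white)` of a one-dimensional white noise. -/
def IsTypeIIOne.{u} {Ω : Type u} [MeasurableSpace Ω] [StandardBorelSpace Ω] (N : Noise Ω) : Prop :=
  ¬ N.IsTypeI ∧
    ∃ (Ω₀ : Type u) (_ : MeasurableSpace Ω₀) (_ : StandardBorelSpace Ω₀) (N₀ : Noise Ω₀)
      (B₀ : ℝ → Ω₀ → ℝ), N₀.IsAdaptedBM B₀ ∧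
        Nonempty (SystemIso N N.unitSpan N₀ (N₀.Hwhite B₀))

/-- Two extensions of the white noise, given by `B` and `B'`, are isomorphic on the level of
Arveson systems: there is an isomorphism `(H_t) → (H'_t)` that extends the natural isomorphism
`X(B|[0,t]) ↦ X(B'|[0,t])` between the two subsystems `(H_t^white)`. -/
def ExtensionsIsomorphic {Ω Ω' : Type*} [MeasurableSpace Ω] [StandardBorelSpace Ω]
    [MeasurableSpace Ω'] [StandardBorelSpace Ω'] (N : Noise Ω) (B : ℝ → Ω → ℝ)
    (N' : Noise Ω') (B' : ℝ → Ω' → ℝ) : Prop :=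
  ∃ Θ : SystemIso N N.H N' N'.H,
    ∀ (t : PosTime) (X : (Icc (0 : ℝ) (t : ℝ) → ℝ) → ℂ) (ψ : N.H t), Measurable X →
      ((ψ : Lp ℂ 2 N.P) : Ω → ℂ) =ᵐ[N.P] (fun ω => X (path B t ω)) →
      ((Θ.op t ψ : Lp ℂ 2 N'.P) : Ω' → ℂ) =ᵐ[N'.P] fun ω => X (path B' t ω)

/-- The path `B` with the drift `c` subtracted. -/
def subDrift {Ω : Type*} (B : ℝ → Ω → ℝ) (c : ℝ) : ℝ → Ω → ℝ := fun t ω => B t ω - c * t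

/-- The noise `N'` (with the Brownian motion `B_t - c t`) results from the noise `N` (with the
Brownian motion `B`) by the drift `c`: only the probability measure is changed, the restrictions
of `P` and `P'` to every `F s t` are equivalent, and on `F 0 t` the density is
`exp (c B_t - c² t / 2)`. Everything common to the two noises is understood modulo null sets of
`(P + P') / 2`, equivalently of `P + P'`. -/
structure IsDriftOf {Ω : Type*} [m : MeasurableSpace Ω] [StandardBorelSpace Ω]
    (N' N : Noise Ω) (B : ℝ → Ω → ℝ) (c : ℝ) : Prop where
  F_eq : N'.F = N.F
  T_eq : N'.T = N.T
  sup_eq : ∀ r s t, r < s → s < t → EqModZero (N.P + N'.P) (N.F r s ⊔ N.F s t) (N.F r t)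
  shift : ∀ s t h, s < t →
    EqModZero (N.P + N'.P) ((N.F s t).comap (N.T h)) (N.F (s + h) (t + h))
  generates : EqModZero (N.P + N'.P) (⨆ (s : ℝ) (t : ℝ) (_ : s < t), N.F s t) m
  equivalent : ∀ s t, s < t → ∀ A, MeasurableSet[N.F s t] A → (N.P A = 0 ↔ N'.P A = 0)
  adapted : ∀ s t, s < t →
    AEStronglyMeasurable[N.F s t] (fun ω => B t ω - B s ω) (N.P + N'.P)
  zero : ∀ᵐ ω ∂(N.P + N'.P), B 0 ω = 0
  stationary : ∀ s t h, s < t →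
    ∀ᵐ ω ∂(N.P + N'.P), B t (N.T h ω) - B s (N.T h ω) = B (t + h) ω - B (s + h) ω
  density : ∀ t : ℝ, 0 < t → ∀ A, MeasurableSet[N.F 0 t] A →
    N'.P A = ∫⁻ ω in A, ENNReal.ofReal (Real.exp (c * B t ω - c ^ 2 / 2 * t)) ∂N.P

/-- A drift sensitive extension of the white noise: for every `c ≠ 0` the extension obtained by
the drift `c` is not isomorphic to the original one on the level of Arveson systems. (`N'` is
essentially unique: its measure is determined on the σ-field generated by all `F s t`.) -/
def DriftSensitive {Ω : Type*} [MeasurableSpace Ω] [StandardBorelSpace Ω]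
    (N : Noise Ω) (B : ℝ → Ω → ℝ) : Prop :=
  ∀ c : ℝ, c ≠ 0 → ∃ N' : Noise Ω, N'.IsDriftOf N B c ∧
    ¬ ExtensionsIsomorphic N B N' (subDrift B c)

end Noise

/-!
The drift `c = 2 lam` changes the measure on `F 0 t` by the density `exp (2 lam B_t - 2 lam² t)`.
Multiplication by its square root `exp (lam B_t - lam² t)` is an isomorphism from the system of the
drifted noise onto the original one (`Noise.IsDriftOf.iso`), and it sends the functionals of
`B_s - 2 lam s` onto the functionals of `B` (`Noise.IsDriftOf.op_mem_Hwhite_iff`). Preceded by the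
natural isomorphism `X(B) ↦ X(B')` of the white noise parts (`Noise.whiteIso`), it is the real shift
by `lam` (`Noise.IsDriftOf.isRealShift`).

The point is that no automorphism `Θ` of `(H_t)` acts on the plane of units as a real translation by
`lam ≠ 0` (`Noise.DriftSensitive.not_acts`). As `Θ` preserves inner products, its phases on the
units are those of the real shift up to a common factor `exp (i c t)`. After removing this factor
and dividing by the square root of the density, `Θ` becomes an isomorphism onto the system of the
drifted noise that sends `exp (i y B_t)` to `exp (i y B'_t)`. Products of these units are the step
exponentials, which are total in `H_t^white` (`Noise.Hwhite_le_of_stepExp`), hence it extends the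
natural isomorphism of the white noise parts (`Noise.SystemIso.op_eq_whiteOp`). This contradicts
drift sensitivity.

Imaginary shifts are multiplications by `exp (i lam B_t)` and visibly act on all of `(H_t)`. A
motion `z ↦ a z + b` induced by an automorphism conjugates them to translations by multiples of
`i a`, which must be imaginary; thus `a = 1` or `a = -1`. If some automorphisms sent `0` to `1` and
to `2`, then in both cases `a = -1`, as `a = 1` gives a real translation; but the composition of the
two point reflections `z ↦ 1 - z` and `z ↦ 2 - z` is a real translation
(`Noise.DriftSensitive.not_acts_of_acts`).

If all units belong to the white noise part, the subsystem generated by units is the white noise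
part (`Noise.NoOtherUnits.unitSpan_eq`), and it is not the whole system since real shifts do not
extend. Every normalized unit is then `exp (z B_t - (Re z)² t)` up to a factor `exp (i c t)`
(`Noise.IsNormalizedUnit.exists_eq`): its inner products with the units `exp (i y B_t)` are
exponential functions of `t`, and their exponents are quadratic in `y`, because covariances of units
for small `t` are conditionally positive (`Noise.exponent_eq`). So every automorphism acts on the
plane of units, and the preceding argument excludes transitivity.

Equalities between σ-fields hold modulo null sets only; `nullExtension` carries this bookkeeping.
-/

open Filter Topology

/-! ### Measurability modulo null sets -/

section NullExtension

variable {Ω β : Type*} {m : MeasurableSpace Ω}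

/-- The σ-field of all sets that coincide with a `G`-measurable set modulo `μ`-null sets. -/
abbrev nullExtension (G : MeasurableSpace Ω) (μ : Measure[m] Ω) : MeasurableSpace Ω :=
  eventuallyMeasurableSpace G (ae μ)

theorem EqModZero.le_nullExtension {μ : Measure[m] Ω} {m₁ m₂ : MeasurableSpace Ω}
    (h : @EqModZero Ω m μ m₁ m₂) : m₁ ≤ nullExtension m₂ μ :=
  fun A hA => h.1 A hA

theorem measurable_nullExtension_of_aesm [TopologicalSpace β]
    [TopologicalSpace.PseudoMetrizableSpace β] [MeasurableSpace β] [BorelSpace β]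
    {G : MeasurableSpace Ω} {μ : Measure[m] Ω} {f : Ω → β}
    (hf : AEStronglyMeasurable[G] f μ) : Measurable[nullExtension G μ] f := by
  intro s hs
  refine ⟨hf.mk f ⁻¹' s, hf.stronglyMeasurable_mk.measurable hs, ?_⟩
  filter_upwards [hf.ae_eq_mk] with ω hω
  exact propext (by change f ω ∈ s ↔ _ ∈ s; rw [hω])

/-- A measurable map can be corrected on a null set, by approximation with simple maps. -/
theorem aesm_of_measurable_nullExtension [Nonempty β] [TopologicalSpace β]
    [TopologicalSpace.IsCompletelyMetrizableSpace β] [SecondCountableTopology β]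
    [MeasurableSpace β] [BorelSpace β] {G : MeasurableSpace Ω} {μ : Measure[m] Ω} {f : Ω → β}
    (hf : Measurable[nullExtension G μ] f) : AEStronglyMeasurable[G] f μ := by
  classical
  have hf' : StronglyMeasurable[nullExtension G μ] f := hf.stronglyMeasurable
  induction f, hf' using StronglyMeasurable.induction' with
  | const z => exact aestronglyMeasurable_const
  | @pcw g₁ g₂ s hg₁ hg₂ hs h₁ h₂ =>
    obtain ⟨t, ht, hst⟩ := hs
    obtain ⟨f₁, m₁, e₁⟩ := h₁ hg₁.measurable
    obtain ⟨f₂, m₂, e₂⟩ := h₂ hg₂.measurable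
    refine ⟨t.piecewise f₁ f₂, m₁.piecewise ht m₂, ?_⟩
    filter_upwards [e₁, e₂, hst.mem_iff] with ω a b c
    by_cases hω : ω ∈ s
    · rw [Set.piecewise_eq_of_mem _ _ _ hω, Set.piecewise_eq_of_mem _ _ _ (c.1 hω), a]
    · rw [Set.piecewise_eq_of_notMem _ _ _ hω, Set.piecewise_eq_of_notMem _ _ _ (mt c.2 hω), b]
  | @lim g i hg hi h₁ h₂ =>
    choose k mk ek using fun n => h₁ n (hg n).measurable
    refine ⟨fun ω => limUnder Filter.atTop fun n => k n ω, StronglyMeasurable.limUnder mk, ?_⟩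
    filter_upwards [ae_all_iff.2 ek] with ω hω
    rw [Filter.Tendsto.limUnder_eq]
    simpa only [← hω] using h₂ ω

/-- Passing to a σ-field that is larger modulo null sets. -/
theorem MeasureTheory.AEStronglyMeasurable.of_le_nullExtension [Nonempty β] [TopologicalSpace β]
    [TopologicalSpace.IsCompletelyMetrizableSpace β] [SecondCountableTopology β]
    {G G' : MeasurableSpace Ω} {μ : Measure[m] Ω} {f : Ω → β}
    (hf : AEStronglyMeasurable[G] f μ) (h : G ≤ nullExtension G' μ) :
    AEStronglyMeasurable[G'] f μ := by
  borelize β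
  obtain ⟨g, hg, e⟩ := hf
  exact (aesm_of_measurable_nullExtension (hg.measurable.mono h le_rfl)).congr e.symm

/-- A measurable functional of a path, possibly with uncountable index set, does not change
almost surely if each single coordinate of the path does not change almost surely. -/
theorem ae_eq_comp_of_coord [MeasurableSpace β] [MeasurableSpace.CountablySeparated β]
    {I : Type*} {μ : Measure[m] Ω}
    {Z Z' : Ω → I → ℝ} (h : ∀ i, (fun ω => Z ω i) =ᵐ[μ] fun ω => Z' ω i)
    {y : (I → ℝ) → β} (hy : Measurable y) :
    (fun ω => y (Z ω)) =ᵐ[μ] fun ω => y (Z' ω) := by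
  have key : ∀ S : Set (I → ℝ), MeasurableSet S → ∀ᵐ ω ∂μ, Z ω ∈ S ↔ Z' ω ∈ S := by
    intro S hS
    let 𝒮 : MeasurableSpace (I → ℝ) :=
      { MeasurableSet' := fun S => ∀ᵐ ω ∂μ, Z ω ∈ S ↔ Z' ω ∈ S
        measurableSet_empty := by simp
        measurableSet_compl := fun t ih => by filter_upwards [ih] with ω hω; simp [hω]
        measurableSet_iUnion := fun s ih => by
          filter_upwards [ae_all_iff.2 ih] with ω hω; simp [hω] }
    have hle : (MeasurableSpace.pi : MeasurableSpace (I → ℝ)) ≤ 𝒮 := by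
      refine iSup_le fun i => ?_
      rintro _ ⟨t, -, rfl⟩
      change ∀ᵐ ω ∂μ, _
      filter_upwards [h i] with ω hω
      simp [hω]
    exact hle S hS
  exact Filter.EventuallyEq.of_forall_separating_mem_iff MeasurableSet
    fun U hU => key _ (hy hU)

end NullExtension

/-! ### Borel maps into a separable Hilbert space -/

section Pettis

variable {α E : Type*} [MeasurableSpace α] [NormedAddCommGroup E] [InnerProductSpace ℂ E]
  [CompleteSpace E] [SecondCountableTopology E] [MeasurableSpace E] [BorelSpace E]

/-- Weakly measurable maps into a separable Hilbert space are Borel. -/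
theorem measurable_of_inner {f : α → E} (hf : ∀ e, Measurable fun a => inner ℂ e (f a)) :
    Measurable f := by
  obtain ⟨w, b, hb⟩ := exists_hilbertBasis ℂ E
  have : Countable w := by
    have ho : Orthonormal ℂ ((↑) : w → E) := hb ▸ b.orthonormal
    have hd : ∀ x y : w, x ≠ y → 1 ≤ dist x y := by
      intro x y hxy
      have h2 := norm_sub_sq (𝕜 := ℂ) (x : E) (y : E)
      rw [ho.1 x, ho.1 y, ho.2 hxy] at h2
      simp only [map_zero] at h2
      rw [Subtype.dist_eq, dist_eq_norm]
      nlinarith [norm_nonneg ((x : E) - y)]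
    have : DiscreteTopology w := DiscreteTopology.of_forall_le_dist one_pos hd
    exact countable_of_Lindelof_of_discrete
  have h : ∀ s : Finset w, Measurable fun a => ∑ i ∈ s, b.repr (f a) i • b i := by
    intro s
    refine Finset.measurable_sum _ fun i _ => ?_
    simp_rw [b.repr_apply_apply]
    exact (hf _).smul_const _
  exact measurable_of_tendsto_metrizable' Filter.atTop h
    (tendsto_pi_nhds.2 fun a => b.hasSum_repr (f a))

/-- The projections onto an increasing family of closed subspaces depend measurably on time:
their quadratic forms are monotone. -/
theorem measurable_starProjection {K : {t : ℝ // 0 < t} → Submodule ℂ E}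
    [∀ t, (K t).HasOrthogonalProjection] (hK : Monotone K) (ξ : E) :
    Measurable fun t => (K t).starProjection ξ := by
  have h1 : ∀ x, Measurable fun t => inner ℂ ((K t).starProjection x) x := by
    intro x
    have h : ∀ t, inner ℂ ((K t).starProjection x) x =
        ((‖(K t).starProjection x‖ ^ 2 : ℝ) : ℂ) := by
      intro t
      have h := inner_self_eq_norm_sq_to_K (𝕜 := ℂ) ((K t).starProjection x)
      rw [Submodule.inner_starProjection_left_eq_right,
        (Submodule.starProjection_eq_self_iff).2 (Submodule.starProjection_apply_mem _ _),
        ← Submodule.inner_starProjection_left_eq_right] at h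
      simpa using h
    simp_rw [h]
    refine Complex.measurable_ofReal.comp (Measurable.pow_const ?_ 2)
    have hm : Monotone fun t => ‖(K t).starProjection x‖ := by
      intro s t hst
      have h := Submodule.starProjection_comp_starProjection_of_le (hK hst)
      change ‖(K s).starProjection x‖ ≤ ‖(K t).starProjection x‖
      rw [← h]
      exact Submodule.norm_starProjection_apply_le _ _
    have : OrderTopology {t : ℝ // 0 < t} := inferInstanceAs (OrderTopology (Ioi (0 : ℝ)))
    exact hm.measurable
  refine measurable_of_inner fun e => ?_
  have h2 : ∀ t, inner ℂ e ((K t).starProjection ξ) = inner ℂ ((K t).starProjection e) ξ := by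
    intro t
    rw [Submodule.inner_starProjection_left_eq_right]
  simp_rw [h2]
  have h3 := fun t => inner_map_polarization ((K t).starProjection : E →ₗ[ℂ] E) ξ e
  simp only [ContinuousLinearMap.coe_coe] at h3
  simp_rw [h3]
  have := h1 (ξ + e)
  have := h1 (ξ - e)
  have := h1 (ξ + Complex.I • e)
  have := h1 (ξ - Complex.I • e)
  fun_prop

end Pettis

namespace Noise

/-! ### Noises and their products -/

attribute [instance] Noise.isProb

section Products

variable {Ω : Type*} [m : MeasurableSpace Ω] [StandardBorelSpace Ω] (N : Noise Ω)

theorem F_le_nullExtension_left {r s t : ℝ} (hrs : r < s) (hst : s ≤ t) :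
    N.F r s ≤ nullExtension (N.F r t) N.P := by
  rcases hst.eq_or_lt with rfl | hst
  · exact le_eventuallyMeasurableSpace
  · exact le_sup_left.trans (N.sup_eq r s t hrs hst).le_nullExtension

theorem F_le_nullExtension_right {r s t : ℝ} (hrs : r ≤ s) (hst : s < t) :
    N.F s t ≤ nullExtension (N.F r t) N.P := by
  rcases hrs.eq_or_lt with rfl | hrs
  · exact le_eventuallyMeasurableSpace
  · exact le_sup_right.trans (N.sup_eq r s t hrs hst).le_nullExtension

theorem quasi_T (h : ℝ) : Measure.QuasiMeasurePreserving (N.T h) N.P N.P :=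
  (N.T_preserving h).quasiMeasurePreserving

theorem aesm_comp_T {f : Ω → ℂ} {s t : ℝ} (hst : s < t) (h : ℝ)
    (hf : AEStronglyMeasurable[N.F s t] f N.P) :
    AEStronglyMeasurable[N.F (s + h) (t + h)] (fun ω => f (N.T h ω)) N.P := by
  obtain ⟨g, hg, e⟩ := hf
  have h1 : AEStronglyMeasurable[(N.F s t).comap (N.T h)] (fun ω => g (N.T h ω)) N.P :=
    (hg.comp_measurable (comap_measurable _)).aestronglyMeasurable
  exact (h1.of_le_nullExtension (N.shift s t h hst).le_nullExtension).congr
    ((N.quasi_T h).ae_eq_comp e).symm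

theorem integral_comp_T {f : Ω → ℂ} (h : ℝ) (hf : AEStronglyMeasurable f N.P) :
    ∫ ω, f (N.T h ω) ∂N.P = ∫ ω, f ω ∂N.P := by
  have := (N.T_preserving h).map_eq
  conv_rhs => rw [← this]
  rw [integral_map (N.T_preserving h).measurable.aemeasurable (by rwa [this])]

theorem indepFun {β γ : Type*} [TopologicalSpace β] [TopologicalSpace.PseudoMetrizableSpace β]
    [MeasurableSpace β] [BorelSpace β] [TopologicalSpace γ]
    [TopologicalSpace.PseudoMetrizableSpace γ] [MeasurableSpace γ] [BorelSpace γ]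
    {r s t : ℝ} (hrs : r < s) (hst : s < t) {f : Ω → β}
    {g : Ω → γ} (hf : AEStronglyMeasurable[N.F r s] f N.P)
    (hg : AEStronglyMeasurable[N.F s t] g N.P) : IndepFun f g N.P := by
  have : IndepFun (hf.mk f) (hg.mk g) N.P :=
    indep_of_indep_of_le_left (indep_of_indep_of_le_right (N.indep r s t hrs hst)
      hg.stronglyMeasurable_mk.measurable.comap_le) hf.stronglyMeasurable_mk.measurable.comap_le
  exact this.congr hf.ae_eq_mk.symm hg.ae_eq_mk.symm

theorem mem_H {t : PosTime} {X : Lp ℂ 2 N.P} :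
    X ∈ N.H t ↔ AEStronglyMeasurable[N.F 0 t] X N.P :=
  mem_lpMeas_iff_aestronglyMeasurable

variable {N}

theorem mem_H_congr {t : PosTime} {X : Lp ℂ 2 N.P} {f : Ω → ℂ} (h : X =ᵐ[N.P] f)
    (hf : AEStronglyMeasurable[N.F 0 t] f N.P) : X ∈ N.H t :=
  N.mem_H.2 (hf.congr h.symm)

theorem aesm_shifted {s t : PosTime} {Y : Lp ℂ 2 N.P} (hY : Y ∈ N.H t) :
    AEStronglyMeasurable[N.F s (s + t : PosTime)] (fun ω => Y (N.T s ω)) N.P := by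
  have h := N.aesm_comp_T t.2 s (N.mem_H.1 hY)
  rwa [zero_add, add_comm] at h

theorem lt_add_posTime (s t : PosTime) : (s : ℝ) < (s + t : PosTime) := by
  simpa using t.2

theorem indepFun_shifted {s t : PosTime} {X Y : Lp ℂ 2 N.P} (hX : X ∈ N.H s) (hY : Y ∈ N.H t) :
    IndepFun X (fun ω => Y (N.T s ω)) N.P :=
  N.indepFun s.2 (lt_add_posTime s t) (N.mem_H.1 hX) (aesm_shifted hY)

theorem memLp_shifted (s : ℝ) (Y : Lp ℂ 2 N.P) : MemLp (fun ω => Y (N.T s ω)) 2 N.P :=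
  (Lp.memLp Y).comp_measurePreserving (N.T_preserving s)

theorem memLp_mul_shifted {s t : PosTime} {X Y : Lp ℂ 2 N.P} (hX : X ∈ N.H s) (hY : Y ∈ N.H t) :
    MemLp (fun ω => X ω * Y (N.T s ω)) 2 N.P := by
  have hi := indepFun_shifted hX hY
  have hm : Measurable fun z : ℂ => ‖z‖ ^ 2 := by fun_prop
  have h1 := (hi.comp hm hm).integrable_mul
    ((memLp_two_iff_integrable_sq_norm (Lp.aestronglyMeasurable X)).1 (Lp.memLp X))
    ((memLp_two_iff_integrable_sq_norm (memLp_shifted s Y).1).1 (memLp_shifted (N := N) s Y))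
  refine (memLp_two_iff_integrable_sq_norm
    ((Lp.aestronglyMeasurable X).mul (memLp_shifted s Y).1)).2 (h1.congr ?_)
  filter_upwards with ω
  simp [mul_pow]

theorem aesm_mul_shifted {s t : PosTime} {X Y : Lp ℂ 2 N.P} (hX : X ∈ N.H s) (hY : Y ∈ N.H t) :
    AEStronglyMeasurable[N.F 0 (s + t : PosTime)] (fun ω => X ω * Y (N.T s ω)) N.P :=
  ((N.mem_H.1 hX).of_le_nullExtension
      (N.F_le_nullExtension_left s.2 (lt_add_posTime s t).le)).mul
    ((aesm_shifted hY).of_le_nullExtension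
      (N.F_le_nullExtension_right s.2.le (lt_add_posTime s t)))

/-- Independence makes the product of `X` and the shifted `Y` square integrable. -/
theorem exists_isProd {s t : PosTime} {X Y : Lp ℂ 2 N.P} (hX : X ∈ N.H s) (hY : Y ∈ N.H t) :
    ∃ Z ∈ N.H (s + t), N.IsProd s X Y Z :=
  have h := memLp_mul_shifted hX hY
  ⟨h.toLp _, mem_H_congr h.coeFn_toLp (aesm_mul_shifted hX hY), h.coeFn_toLp⟩

theorem IsProd.unique {s : PosTime} {X Y Z Z' : Lp ℂ 2 N.P} (h : N.IsProd s X Y Z)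
    (h' : N.IsProd s X Y Z') : Z = Z' :=
  Lp.ext (h.trans h'.symm)

/-- The product is a tensor product: inner products multiply, by independence. -/
theorem inner_isProd {s t : PosTime} {X Y Z X' Y' Z' : Lp ℂ 2 N.P}
    (hX : X ∈ N.H s) (hY : Y ∈ N.H t) (hX' : X' ∈ N.H s) (hY' : Y' ∈ N.H t)
    (hZ : N.IsProd s X Y Z) (hZ' : N.IsProd s X' Y' Z') :
    inner ℂ Z Z' = inner ℂ X X' * inner ℂ Y Y' := by
  have hi : IndepFun (fun ω => inner ℂ (X ω) (X' ω))
      (fun ω => inner ℂ (Y (N.T s ω)) (Y' (N.T s ω))) N.P :=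
    N.indepFun s.2 (lt_add_posTime s t) ((N.mem_H.1 hX).inner (N.mem_H.1 hX'))
      ((aesm_shifted hY).inner (aesm_shifted hY'))
  have h2 : inner ℂ Y Y' = ∫ ω, inner ℂ (Y (N.T s ω)) (Y' (N.T s ω)) ∂N.P := by
    rw [L2.inner_def]
    exact (N.integral_comp_T s ((Lp.aestronglyMeasurable Y).inner
      (Lp.aestronglyMeasurable Y'))).symm
  rw [h2, L2.inner_def, L2.inner_def]
  have h3 := hi.integral_mul_eq_mul_integral
    ((Lp.aestronglyMeasurable X).inner (Lp.aestronglyMeasurable X'))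
    ((memLp_shifted s Y).1.inner (memLp_shifted s Y').1)
  rw [← h3]
  refine integral_congr_ae ?_
  filter_upwards [hZ, hZ'] with ω h h'
  simp only [h, h', RCLike.inner_apply, map_mul, Pi.mul_apply]
  ring

theorem monotone_H : Monotone N.H := by
  intro s t hst X hX
  exact N.mem_H.2 ((N.mem_H.1 hX).of_le_nullExtension (N.F_le_nullExtension_left s.2 hst))

end Products

theorem hasOrthogonalProjection_lpMeas {Ω : Type*} [m : MeasurableSpace Ω]
    (μ : Measure[m] Ω) {G : MeasurableSpace Ω} (hG : G ≤ m) :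
    (@lpMeas Ω ℂ ℂ _ _ _ G m 2 μ).HasOrthogonalProjection := by
  have : Fact (G ≤ m) := ⟨hG⟩
  infer_instance

instance instHasOrthogonalProjectionH {Ω : Type*} [MeasurableSpace Ω] [StandardBorelSpace Ω]
    (N : Noise Ω) (t : PosTime) :
    (N.H t).HasOrthogonalProjection :=
  hasOrthogonalProjection_lpMeas N.P (N.F_le 0 t t.2)

/-! ### Isomorphisms of systems -/

section MulPhase

variable {Ω : Type*} [MeasurableSpace Ω] (μ : Measure Ω)

theorem memLp_mulPhase {f : Ω → ℝ} (hf : Measurable f) (X : Lp ℂ 2 μ) :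
    MemLp (fun ω => Complex.exp (Complex.I * f ω) * X ω) 2 μ := by
  refine (Lp.memLp X).of_le ?_ (ae_of_all _ fun ω => ?_)
  · exact (Measurable.aestronglyMeasurable (by fun_prop)).mul (Lp.aestronglyMeasurable X)
  · rw [norm_mul, mul_comm Complex.I, Complex.norm_exp_ofReal_mul_I, one_mul]

/-- Multiplication by `exp (i f)` as a unitary operator on `L₂(μ)`. -/
noncomputable def mulPhase {f : Ω → ℝ} (hf : Measurable f) : Lp ℂ 2 μ ≃ₗᵢ[ℂ] Lp ℂ 2 μ where
  toFun X := (memLp_mulPhase μ hf X).toLp _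
  invFun X := (memLp_mulPhase μ hf.neg X).toLp _
  left_inv X := by
    refine Lp.ext ?_
    filter_upwards [(memLp_mulPhase μ hf X).coeFn_toLp, (memLp_mulPhase μ hf.neg
      ((memLp_mulPhase μ hf X).toLp _)).coeFn_toLp] with ω a b
    rw [b, a, ← mul_assoc, ← Complex.exp_add]
    simp
  right_inv X := by
    refine Lp.ext ?_
    filter_upwards [(memLp_mulPhase μ hf.neg X).coeFn_toLp, (memLp_mulPhase μ hf
      ((memLp_mulPhase μ hf.neg X).toLp _)).coeFn_toLp] with ω a b
    rw [b, a, ← mul_assoc, ← Complex.exp_add]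
    simp
  map_add' X Y := by
    refine Lp.ext ?_
    filter_upwards [(memLp_mulPhase μ hf X).coeFn_toLp, (memLp_mulPhase μ hf Y).coeFn_toLp,
      (memLp_mulPhase μ hf (X + Y)).coeFn_toLp, Lp.coeFn_add X Y,
      Lp.coeFn_add ((memLp_mulPhase μ hf X).toLp _) ((memLp_mulPhase μ hf Y).toLp _)]
      with ω a b c d e
    rw [e, Pi.add_apply, a, b, c, d, Pi.add_apply, mul_add]
  map_smul' k X := by
    refine Lp.ext ?_
    filter_upwards [(memLp_mulPhase μ hf X).coeFn_toLp, (memLp_mulPhase μ hf (k • X)).coeFn_toLp,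
      Lp.coeFn_smul k X, Lp.coeFn_smul k ((memLp_mulPhase μ hf X).toLp _)] with ω a b c d
    rw [b, c, RingHom.id_apply, d, Pi.smul_apply, Pi.smul_apply, a, smul_eq_mul, smul_eq_mul]
    ring
  norm_map' X := by
    change ‖(memLp_mulPhase μ hf X).toLp _‖ = ‖X‖
    rw [Lp.norm_toLp, Lp.norm_def]
    congr 1
    refine eLpNorm_congr_norm_ae (ae_of_all _ fun ω => ?_)
    rw [norm_mul, mul_comm Complex.I, Complex.norm_exp_ofReal_mul_I, one_mul]

theorem mulPhase_coeFn {f : Ω → ℝ} (hf : Measurable f) (X : Lp ℂ 2 μ) :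
    mulPhase μ hf X =ᵐ[μ] fun ω => Complex.exp (Complex.I * f ω) * X ω :=
  (memLp_mulPhase μ hf X).coeFn_toLp

end MulPhase

instance instSecondCountableTopologyLp {Ω : Type*} [MeasurableSpace Ω] [StandardBorelSpace Ω]
    (N : Noise Ω) :
    SecondCountableTopology (Lp ℂ 2 N.P) :=
  have : Fact ((2 : ℝ≥0∞) ≠ ∞) := ⟨ENNReal.ofNat_ne_top⟩
  inferInstance

section Borel

variable {Ω : Type*} [MeasurableSpace Ω] [StandardBorelSpace Ω] {N : Noise Ω}

theorem BorelMap.inner {X Y : PosTime → Lp ℂ 2 N.P} (hX : N.BorelMap X) (hY : N.BorelMap Y) :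
    Measurable fun t => inner ℂ (X t) (Y t) := by
  let _ : MeasurableSpace (Lp ℂ 2 N.P) := borel _
  have : BorelSpace (Lp ℂ 2 N.P) := ⟨rfl⟩
  exact Measurable.inner hX hY

theorem borelMap_of_inner {X : PosTime → Lp ℂ 2 N.P}
    (h : ∀ ξ : Lp ℂ 2 N.P, Measurable fun t => inner ℂ ξ (X t)) : N.BorelMap X := by
  let _ : MeasurableSpace (Lp ℂ 2 N.P) := borel _
  have : BorelSpace (Lp ℂ 2 N.P) := ⟨rfl⟩
  exact measurable_of_inner h

end Borel

namespace SystemIso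

variable {Ω Ω' Ω'' : Type*} [MeasurableSpace Ω] [StandardBorelSpace Ω]
  [MeasurableSpace Ω'] [StandardBorelSpace Ω'] [MeasurableSpace Ω''] [StandardBorelSpace Ω'']
  {N : Noise Ω} {N' : Noise Ω'} {N'' : Noise Ω''}
  {E : PosTime → Submodule ℂ (Lp ℂ 2 N.P)} {E' : PosTime → Submodule ℂ (Lp ℂ 2 N'.P)}
  {E'' : PosTime → Submodule ℂ (Lp ℂ 2 N''.P)}

/-- An isomorphism onto an increasing system of closed subspaces maps Borel families to Borel
families, although only weak measurability is part of the definition. -/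
theorem borelMap (Θ : SystemIso N E N' E') (hE' : Monotone E')
    [∀ t, (E' t).HasOrthogonalProjection] {X : ∀ t, E t}
    (hX : N.BorelMap fun t => (X t : Lp ℂ 2 N.P)) :
    N'.BorelMap fun t => (Θ.op t (X t) : Lp ℂ 2 N'.P) := by
  let _ : MeasurableSpace (Lp ℂ 2 N'.P) := borel _
  have : BorelSpace (Lp ℂ 2 N'.P) := ⟨rfl⟩
  refine borelMap_of_inner fun ξ => ?_
  have h := Θ.measurable X
    (fun t => ⟨(E' t).starProjection ξ, Submodule.starProjection_apply_mem _ _⟩)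
    hX (measurable_starProjection hE' ξ)
  have h' := (RCLike.continuous_conj (K := ℂ)).measurable.comp h
  convert h' using 1
  funext t
  simp only [Function.comp, Submodule.coe_inner, inner_conj_symm]
  rw [Submodule.inner_starProjection_left_eq_right,
    (Submodule.starProjection_eq_self_iff).2 (Θ.op t (X t)).2]

/-- The identity automorphism of a system. -/
noncomputable def refl (N : Noise Ω) (E : PosTime → Submodule ℂ (Lp ℂ 2 N.P)) :
    SystemIso N E N E where
  op _ := LinearIsometryEquiv.refl ℂ _
  map_mul _ _ _ _ _ h := h
  measurable _ _ hX hY := hX.inner hY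

/-- The inverse of an isomorphism between systems that contain the products of their elements. -/
noncomputable def symm (Θ : SystemIso N E N' E')
    (hE : ∀ (s t : PosTime) (X : E s) (Y : E t), ∃ Z : E (s + t), N.IsProd s X Y Z) :
    SystemIso N' E' N E where
  op t := (Θ.op t).symm
  map_mul s t X Y Z h := by
    obtain ⟨W, hW⟩ := hE s t ((Θ.op s).symm X) ((Θ.op t).symm Y)
    have h' := Θ.map_mul s t _ _ _ hW
    rw [LinearIsometryEquiv.apply_symm_apply, LinearIsometryEquiv.apply_symm_apply] at h'
    have : Θ.op (s + t) W = Z := Subtype.ext (h'.unique h)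
    rw [← this, LinearIsometryEquiv.symm_apply_apply]
    exact hW
  measurable X Y hX hY := by
    convert (RCLike.continuous_conj (K := ℂ)).measurable.comp (Θ.measurable Y X hY hX) using 1
    funext t
    change inner ℂ ((Θ.op t).symm (X t)) (Y t) =
      starRingEnd ℂ (inner ℂ (Θ.op t (Y t) : Lp ℂ 2 N'.P) (X t : Lp ℂ 2 N'.P))
    rw [inner_conj_symm, ← (Θ.op t).inner_map_map ((Θ.op t).symm (X t)),
      LinearIsometryEquiv.apply_symm_apply]
    rfl

/-- The composition of two isomorphisms. The intermediate system is increasing and closed, so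
that the first isomorphism maps Borel families to Borel families. -/
noncomputable def trans (Θ : SystemIso N E N' E') (Θ' : SystemIso N' E' N'' E'')
    (hE' : Monotone E') [∀ t, (E' t).HasOrthogonalProjection] : SystemIso N E N'' E'' where
  op t := (Θ.op t).trans (Θ'.op t)
  map_mul s t _ _ _ h := Θ'.map_mul s t _ _ _ (Θ.map_mul s t _ _ _ h)
  measurable X Y hX hY := Θ'.measurable (fun t => Θ.op t (X t)) Y (Θ.borelMap hE' hX) hY

/-- The restriction of an isomorphism to subsystems that it maps onto each other. -/
noncomputable def restrict (Θ : SystemIso N E N' E') {K : PosTime → Submodule ℂ (Lp ℂ 2 N.P)}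
    {K' : PosTime → Submodule ℂ (Lp ℂ 2 N'.P)} (hK : ∀ t, K t ≤ E t) (hK' : ∀ t, K' t ≤ E' t)
    (h : ∀ t (x : E t), (x : Lp ℂ 2 N.P) ∈ K t ↔ (Θ.op t x : Lp ℂ 2 N'.P) ∈ K' t) :
    SystemIso N K N' K' where
  op t :=
    { toFun := fun x => ⟨Θ.op t ⟨x, hK t x.2⟩, (h t _).1 x.2⟩
      invFun := fun y => ⟨(Θ.op t).symm ⟨y, hK' t y.2⟩, (h t _).2 (by simp)⟩
      left_inv := fun x => by simp
      right_inv := fun y => by simp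
      map_add' := fun x y => by
        have := (Θ.op t).map_add ⟨x, hK t x.2⟩ ⟨y, hK t y.2⟩
        simpa [Subtype.ext_iff] using this
      map_smul' := fun c x => by
        refine Subtype.ext ?_
        change (Θ.op t (c • ⟨x, hK t x.2⟩) : Lp ℂ 2 N'.P) = c • (Θ.op t ⟨x, hK t x.2⟩ : Lp ℂ 2 N'.P)
        rw [map_smul]
        rfl
      norm_map' := fun x => (Θ.op t).norm_map ⟨x, hK t x.2⟩ }
  map_mul s t X Y Z := Θ.map_mul s t ⟨X, hK s X.2⟩ ⟨Y, hK t Y.2⟩ ⟨Z, hK _ Z.2⟩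
  measurable X Y := Θ.measurable (fun t => ⟨X t, hK t (X t).2⟩) (fun t => ⟨Y t, hK' t (Y t).2⟩)

/-- Multiplication by `exp (i f_t)`, where the real variables `f_t` form an additive cocycle. -/
noncomputable def phase (N : Noise Ω) (E : PosTime → Submodule ℂ (Lp ℂ 2 N.P))
    (f : PosTime → Ω → ℝ) (hf : ∀ t, Measurable (f t))
    (hE : ∀ t X, X ∈ E t → mulPhase N.P (hf t) X ∈ E t)
    (hE' : ∀ t X, X ∈ E t → mulPhase N.P (hf t).neg X ∈ E t)
    (hadd : ∀ s t : PosTime, f (s + t) =ᵐ[N.P] fun ω => f s ω + f t (N.T s ω))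
    (hborel : ∀ X, N.BorelMap X → N.BorelMap fun t => mulPhase N.P (hf t) (X t)) :
    SystemIso N E N E where
  op t :=
    { toFun := fun x => ⟨mulPhase N.P (hf t) x, hE t x x.2⟩
      invFun := fun x => ⟨mulPhase N.P (hf t).neg x, hE' t x x.2⟩
      left_inv := fun x => Subtype.ext ((mulPhase N.P (hf t)).symm_apply_apply x)
      right_inv := fun x => Subtype.ext ((mulPhase N.P (hf t)).apply_symm_apply x)
      map_add' := fun x y => Subtype.ext (map_add (mulPhase N.P (hf t)) (x : Lp ℂ 2 N.P) y)
      map_smul' := fun c x => Subtype.ext (map_smul (mulPhase N.P (hf t)) c (x : Lp ℂ 2 N.P))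
      norm_map' := fun x => (mulPhase N.P (hf t)).norm_map x }
  map_mul s t X Y Z h := by
    change _ =ᵐ[N.P] _
    filter_upwards [mulPhase_coeFn N.P (hf s) X, mulPhase_coeFn N.P (hf (s + t)) Z,
      (N.quasi_T s).ae_eq_comp (mulPhase_coeFn N.P (hf t) Y), h, hadd s t] with ω a b c d e
    change (mulPhase N.P (hf (s + t)) Z : Ω → ℂ) ω =
      (mulPhase N.P (hf s) X : Ω → ℂ) ω * (mulPhase N.P (hf t) Y : Ω → ℂ) (N.T s ω)
    have c' : (mulPhase N.P (hf t) Y : Ω → ℂ) (N.T s ω) = _ := c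
    rw [a, b, c', d, e]
    simp only [Function.comp, Complex.ofReal_add, mul_add, Complex.exp_add]
    ring
  measurable _ _ hX hY := (hborel _ hX).inner hY

end SystemIso

end Noise

/-! ### Convergence in `L₂` -/

section L2

variable {Ω : Type*} [MeasurableSpace Ω] {μ : Measure Ω}

theorem norm_sq_eq_integral (f : Lp ℂ 2 μ) : ‖f‖ ^ 2 = ∫ ω, ‖f ω‖ ^ 2 ∂μ := by
  have h := inner_self_eq_norm_sq_to_K (𝕜 := ℂ) f
  rw [L2.inner_def] at h
  simp only [inner_self_eq_norm_sq_to_K] at h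
  have h2 : ∫ ω, ((‖f ω‖ : ℂ)) ^ 2 ∂μ = ((∫ ω, ‖f ω‖ ^ 2 ∂μ : ℝ) : ℂ) := by
    rw [← integral_complex_ofReal]; simp
  have h3 : ((∫ ω, ‖f ω‖ ^ 2 ∂μ : ℝ) : ℂ) = ((‖f‖ ^ 2 : ℝ) : ℂ) := by
    rw [← h2]; push_cast; exact h
  exact_mod_cast h3.symm

/-- Dominated convergence in `L₂`. -/
theorem tendsto_Lp_of_dominated {F : ℕ → Lp ℂ 2 μ} {F₀ : Lp ℂ 2 μ} {G : Ω → ℝ} (hG : MemLp G 2 μ)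
    (hF : ∀ n, ∀ᵐ ω ∂μ, ‖F n ω‖ ≤ G ω)
    (hlim : ∀ᵐ ω ∂μ, Tendsto (fun n => F n ω) atTop (𝓝 (F₀ ω))) :
    Tendsto F atTop (𝓝 F₀) := by
  rw [tendsto_iff_norm_sub_tendsto_zero]
  have h1 : Tendsto (fun n => ∫ ω, ‖F n ω - F₀ ω‖ ^ 2 ∂μ) atTop (𝓝 (∫ _, 0 ∂μ)) := by
    refine tendsto_integral_of_dominated_convergence (fun ω => (2 * G ω) ^ 2) ?_ ?_ ?_ ?_
    · intro n
      exact ((Lp.aestronglyMeasurable _).sub (Lp.aestronglyMeasurable _)).norm.pow 2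
    · exact (hG.const_mul 2).integrable_sq
    · intro n
      filter_upwards [ae_all_iff.2 hF, hlim] with ω a b
      have h0 : ‖F₀ ω‖ ≤ G ω := le_of_tendsto b.norm (Eventually.of_forall a)
      rw [Real.norm_of_nonneg (by positivity)]
      have := norm_sub_le (F n ω) (F₀ ω)
      exact pow_le_pow_left₀ (norm_nonneg _) (by linarith [a n]) 2
    · filter_upwards [hlim] with ω b
      have := ((b.sub_const (F₀ ω)).norm.pow 2)
      simpa using this
  have h2 : ∀ n, ∫ ω, ‖F n ω - F₀ ω‖ ^ 2 ∂μ = ‖F n - F₀‖ ^ 2 := by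
    intro n
    rw [norm_sq_eq_integral]
    refine integral_congr_ae ?_
    filter_upwards [Lp.coeFn_sub (F n) F₀] with ω h
    rw [h, Pi.sub_apply]
  simp_rw [h2, integral_zero] at h1
  have h3 := h1.sqrt
  simpa [Real.sqrt_sq] using h3

/-- For bounded continuous `φ`, the product `φ(Z) ξ` depends continuously on `Z`. -/
theorem tendsto_Lp_comp_mul {ι : Type*} {l : Filter ι} [l.IsCountablyGenerated]
    {Z : ι → Lp ℝ 2 μ} {Z₀ : Lp ℝ 2 μ} (hZ : Tendsto Z l (𝓝 Z₀)) {φ : ℝ → ℂ}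
    (hφ : Continuous φ) {C : ℝ} (hC : ∀ x, ‖φ x‖ ≤ C) {ξ : Lp ℂ 2 μ} {F : ι → Lp ℂ 2 μ}
    {F₀ : Lp ℂ 2 μ} (hF : ∀ i, F i =ᵐ[μ] fun ω => φ (Z i ω) * ξ ω)
    (hF₀ : F₀ =ᵐ[μ] fun ω => φ (Z₀ ω) * ξ ω) : Tendsto F l (𝓝 F₀) := by
  refine tendsto_of_subseq_tendsto fun u hu => ?_
  obtain ⟨v, -, hv⟩ := (tendstoInMeasure_of_tendsto_Lp (hZ.comp hu)).exists_seq_tendsto_ae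
  refine ⟨v, tendsto_Lp_of_dominated (G := fun ω => C * ‖ξ ω‖)
    ((Lp.memLp ξ).norm.const_mul C) ?_ ?_⟩
  · intro n
    filter_upwards [hF (u (v n))] with ω h
    rw [h, norm_mul]
    exact mul_le_mul_of_nonneg_right (hC _) (norm_nonneg _)
  · filter_upwards [hv, hF₀, ae_all_iff.2 fun n => hF (u (v n))] with ω a b h
    simp only [h, b]
    exact ((hφ.tendsto _).comp a).mul_const _

theorem memLp_bdd_mul {Z : Ω → ℝ} (hZ : AEStronglyMeasurable Z μ) {φ : ℝ → ℂ} (hφ : Continuous φ)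
    {C : ℝ} (hC : ∀ x, ‖φ x‖ ≤ C) (ξ : Lp ℂ 2 μ) : MemLp (fun ω => φ (Z ω) * ξ ω) 2 μ :=
  (Lp.memLp ξ).of_le_mul (c := C)
    ((hφ.comp_aestronglyMeasurable hZ).mul (Lp.aestronglyMeasurable ξ))
    (ae_of_all _ fun ω => by rw [norm_mul]; exact mul_le_mul_of_nonneg_right (hC _) (norm_nonneg _))

end L2

namespace Noise

section BorelMul

variable {Ω : Type*} [MeasurableSpace Ω] [StandardBorelSpace Ω] {N : Noise Ω}

/-- Multiplication by a bounded continuous function of an `L₂`-continuous process preserves Borel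
families: weakly, it can be moved to a fixed vector. -/
theorem BorelMap.bdd_mul {Z : PosTime → Lp ℝ 2 N.P} (hZ : Continuous Z) {φ : ℝ → ℂ}
    (hφ : Continuous φ) {C : ℝ} (hC : ∀ x, ‖φ x‖ ≤ C) {f g : PosTime → Lp ℂ 2 N.P}
    (hf : N.BorelMap f) (hg : ∀ t, g t =ᵐ[N.P] fun ω => φ (Z t ω) * f t ω) : N.BorelMap g := by
  refine borelMap_of_inner fun ξ => ?_
  have hψ : Continuous fun x => starRingEnd ℂ (φ x) := RCLike.continuous_conj.comp hφ
  have hψC : ∀ x, ‖starRingEnd ℂ (φ x)‖ ≤ C := fun x => by simpa using hC x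
  have hm := fun t => memLp_bdd_mul (Lp.aestronglyMeasurable (Z t)) hψ hψC ξ
  have hc : Continuous fun t => (hm t).toLp _ :=
    continuous_iff_continuousAt.2 fun t => tendsto_Lp_comp_mul (hZ.tendsto t) hψ hψC
      (fun t => (hm t).coeFn_toLp) (hm t).coeFn_toLp
  have hb : N.BorelMap fun t => (hm t).toLp _ := by
    let _ : MeasurableSpace (Lp ℂ 2 N.P) := borel _
    have : BorelSpace (Lp ℂ 2 N.P) := ⟨rfl⟩
    exact hc.measurable
  convert hb.inner hf using 2 with t
  rw [L2.inner_def, L2.inner_def]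
  refine integral_congr_ae ?_
  filter_upwards [(hm t).coeFn_toLp, hg t] with ω a b
  rw [a, b]
  simp only [RCLike.inner_apply, map_mul, RCLike.conj_conj]
  ring

/-- Multiplication by a continuous function of an `L₂`-continuous process preserves Borel
families, as long as the products are square integrable. -/
theorem BorelMap.mul {Z : PosTime → Lp ℝ 2 N.P} (hZ : Continuous Z) {φ : ℝ → ℂ}
    (hφ : Continuous φ) {f g : PosTime → Lp ℂ 2 N.P}
    (hf : N.BorelMap f) (hg : ∀ t, g t =ᵐ[N.P] fun ω => φ (Z t ω) * f t ω) : N.BorelMap g := by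
  -- cut-off functions reduce the claim to bounded `φ`
  let χ : ℕ → ℝ → ℝ := fun k x => max 0 (min 1 (k - |x|))
  have hχ : ∀ k x, ‖((χ k x : ℝ) : ℂ)‖ ≤ 1 := by
    intro k x
    rw [Complex.norm_real, Real.norm_of_nonneg (le_max_left _ _)]
    exact max_le zero_le_one (min_le_left _ _)
  have hχc : ∀ k, Continuous fun x => ((χ k x : ℝ) : ℂ) := fun k => by fun_prop
  have hB : ∀ k : ℕ, ∃ C, ∀ x, ‖(χ k x : ℂ) * φ x‖ ≤ C := by
    intro k
    obtain ⟨C, hC⟩ := (isCompact_Icc (a := -(k : ℝ)) (b := k)).exists_bound_of_continuousOn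
      hφ.continuousOn
    refine ⟨max C 0, fun x => ?_⟩
    by_cases hx : x ∈ Icc (-(k : ℝ)) k
    · rw [norm_mul]
      exact (mul_le_of_le_one_left (norm_nonneg _) (hχ k x)).trans
        ((hC x hx).trans (le_max_left _ _))
    · have : χ k x = 0 := by
        have : (k : ℝ) < |x| := by
          by_contra h
          exact hx (abs_le.1 (not_lt.1 h))
        exact max_eq_left ((min_le_right _ _).trans (by linarith))
      simp [this]
  choose C hC using hB
  have hc : ∀ k, Continuous fun x => (χ k x : ℂ) * φ x := fun k => (hχc k).mul hφ
  have hm := fun k t => memLp_bdd_mul (Lp.aestronglyMeasurable (Z t)) (hc k) (hC k) (f t)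
  have hk : ∀ k, N.BorelMap fun t => (hm k t).toLp _ := fun k =>
    BorelMap.bdd_mul hZ (hc k) (hC k) hf fun t => (hm k t).coeFn_toLp
  have hlim : ∀ t, Tendsto (fun k => (hm k t).toLp _) atTop (𝓝 (g t)) := by
    intro t
    refine tendsto_Lp_of_dominated (G := fun ω => ‖g t ω‖) (Lp.memLp (g t)).norm ?_ ?_
    · intro k
      filter_upwards [(hm k t).coeFn_toLp, hg t] with ω a b
      rw [a, b, mul_assoc, norm_mul]
      exact mul_le_of_le_one_left (norm_nonneg _) (hχ k _)
    · filter_upwards [ae_all_iff.2 fun k => (hm k t).coeFn_toLp, hg t] with ω a b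
      refine tendsto_const_nhds.congr' ?_
      filter_upwards [eventually_ge_atTop (Nat.ceil (|Z t ω| + 1))] with k hk
      have h1 : |Z t ω| + 1 ≤ k := Nat.ceil_le.1 hk
      have : χ k (Z t ω) = 1 := by
        change max 0 (min 1 _) = (1 : ℝ)
        rw [min_eq_left (by linarith), max_eq_right zero_le_one]
      rw [a k, b, this]
      simp
  let _ : MeasurableSpace (Lp ℂ 2 N.P) := borel _
  have : BorelSpace (Lp ℂ 2 N.P) := ⟨rfl⟩
  exact measurable_of_tendsto_metrizable hk (tendsto_pi_nhds.2 hlim)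

end BorelMul

end Noise

/-! ### Measures on path spaces -/

section PathMeasure

variable {ι : Type*}

/-- A finite measure on a product of real lines is determined by its finite-dimensional
characteristic functions. -/
theorem path_measure_ext {ν ν' : Measure (ι → ℝ)} [IsFiniteMeasure ν] [IsFiniteMeasure ν']
    (h : ∀ (J : Finset ι) (a : ι → ℝ),
      ∫ p, Complex.exp (Complex.I * (∑ j ∈ J, a j * p j : ℝ)) ∂ν =
        ∫ p, Complex.exp (Complex.I * (∑ j ∈ J, a j * p j : ℝ)) ∂ν') : ν = ν' := by
  classical
  refine IsProjectiveLimit.unique (P := fun J => ν'.map J.restrict) (fun J => ?_) (fun J => rfl)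
  refine Measure.ext_of_charFunDual ?_
  ext L
  rw [charFunDual_apply, charFunDual_apply,
    integral_map (Finset.measurable_restrict J).aemeasurable (by fun_prop),
    integral_map (Finset.measurable_restrict J).aemeasurable (by fun_prop)]
  have hL : ∀ p : ι → ℝ, L (J.restrict p) =
      ∑ j ∈ J, (if hj : j ∈ J then L (Pi.single ⟨j, hj⟩ 1) else 0) * p j := by
    intro p
    have h1 : J.restrict p = ∑ j : J, p j • (Pi.single j (1 : ℝ) : J → ℝ) := by
      ext i
      simp [Finset.sum_apply, Pi.single_apply]
    rw [h1, map_sum, ← Finset.sum_coe_sort J]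
    refine Finset.sum_congr rfl fun j _ => ?_
    simp [mul_comm]
  simp_rw [hL, mul_comm _ Complex.I]
  exact h J _

variable {Ω : Type*} [MeasurableSpace Ω] {μ : Measure Ω}

/-- An integrable real functional of a path that is orthogonal to all exponentials is non-positive
(hence zero, as its negative is orthogonal too). -/
theorem path_functional_nonpos {Z : Ω → ι → ℝ} (hZ : Measurable Z) {r : (ι → ℝ) → ℝ}
    (hr : Measurable r) (hint : Integrable (fun ω => r (Z ω)) μ)
    (h : ∀ (J : Finset ι) (a : ι → ℝ),
      ∫ ω, Complex.exp (Complex.I * (∑ j ∈ J, a j * Z ω j : ℝ)) * (r (Z ω) : ℂ) ∂μ = 0) :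
    ∀ᵐ ω ∂μ, r (Z ω) ≤ 0 := by
  -- the positive and the negative part of the functional are densities of equal measures
  let ν : Measure (ι → ℝ) := (μ.withDensity fun ω => ENNReal.ofReal (r (Z ω))).map Z
  let ν' : Measure (ι → ℝ) := (μ.withDensity fun ω => ENNReal.ofReal (-r (Z ω))).map Z
  have f1 : IsFiniteMeasure (μ.withDensity fun ω => ENNReal.ofReal (r (Z ω))) :=
    isFiniteMeasure_withDensity_ofReal hint.2
  have f2 : IsFiniteMeasure (μ.withDensity fun ω => ENNReal.ofReal (-r (Z ω))) :=
    isFiniteMeasure_withDensity_ofReal hint.neg.2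
  have hrZ : Measurable fun ω => r (Z ω) := hr.comp hZ
  have hν : ν = ν' := by
    refine path_measure_ext fun J a => ?_
    have hm : Measurable fun p : ι → ℝ => Complex.exp (Complex.I * (∑ j ∈ J, a j * p j : ℝ)) := by
      fun_prop
    have hb : ∀ ω, ‖Complex.exp (Complex.I * (∑ j ∈ J, a j * Z ω j : ℝ))‖ ≤ 1 := fun ω => by
      rw [mul_comm, Complex.norm_exp_ofReal_mul_I]
    rw [integral_map hZ.aemeasurable hm.aestronglyMeasurable,
      integral_map hZ.aemeasurable hm.aestronglyMeasurable,
      integral_withDensity_eq_integral_toReal_smul (by fun_prop) (by simp),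
      integral_withDensity_eq_integral_toReal_smul (by fun_prop) (by simp), ← sub_eq_zero,
      ← integral_sub, ← h J a]
    · refine integral_congr_ae (ae_of_all _ fun ω => ?_)
      simp only [← sub_smul, ENNReal.toReal_ofReal']
      rw [Complex.real_smul, mul_comm]
      congr 2
      rcases le_total (r (Z ω)) 0 with h0 | h0
      · rw [max_eq_right h0, max_eq_left (by linarith)]; ring
      · rw [max_eq_left h0, max_eq_right (by linarith)]; ring
    · simp only [ENNReal.toReal_ofReal']
      exact hint.pos_part.smul_bdd 1 (hm.comp hZ).aestronglyMeasurable (ae_of_all _ hb)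
    · simp only [ENNReal.toReal_ofReal']
      exact hint.neg_part.smul_bdd 1 (hm.comp hZ).aestronglyMeasurable (ae_of_all _ hb)
  have hS : MeasurableSet {p | 0 < r p} := measurableSet_lt measurable_const hr
  have e := congrArg (fun κ : Measure (ι → ℝ) => κ {p | 0 < r p}) hν
  simp only [ν, ν', Measure.map_apply hZ hS, withDensity_apply _ (hZ hS)] at e
  have e2 : ∫⁻ ω in Z ⁻¹' {p | 0 < r p}, ENNReal.ofReal (-r (Z ω)) ∂μ = 0 := by
    rw [setLIntegral_congr_fun (hZ hS) (g := fun _ => 0)]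
    · simp
    · intro ω hω
      have : 0 < r (Z ω) := hω
      simp [this.le]
  rw [e2, lintegral_eq_zero_iff (by fun_prop)] at e
  have e3 := (ae_restrict_iff' (hZ hS)).1 e
  filter_upwards [e3] with ω hω
  by_contra hn
  have hn' : 0 < r (Z ω) := not_le.1 hn
  have := hω hn'
  simp at this
  linarith

/-- An integrable functional of a path that is orthogonal to all exponentials vanishes. -/
theorem path_functional_eq_zero {Z : Ω → ι → ℝ} (hZ : Measurable Z) {X : (ι → ℝ) → ℂ}
    (hX : Measurable X) (hint : Integrable (fun ω => X (Z ω)) μ)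
    (h : ∀ (J : Finset ι) (a : ι → ℝ),
      ∫ ω, Complex.exp (Complex.I * (∑ j ∈ J, a j * Z ω j : ℝ)) * X (Z ω) ∂μ = 0) :
    ∀ᵐ ω ∂μ, X (Z ω) = 0 := by
  have hb : ∀ (J : Finset ι) (a : ι → ℝ) ω,
      ‖Complex.exp (Complex.I * (∑ j ∈ J, a j * Z ω j : ℝ))‖ ≤ 1 := fun J a ω => by
    rw [mul_comm, Complex.norm_exp_ofReal_mul_I]
  have hm : ∀ (J : Finset ι) (a : ι → ℝ),
      Measurable fun ω => Complex.exp (Complex.I * (∑ j ∈ J, a j * Z ω j : ℝ)) := by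
    intro J a
    have : ∀ j, Measurable fun ω => Z ω j := fun j => (measurable_pi_apply j).comp hZ
    fun_prop
  have hc : ∀ (J : Finset ι) (a : ι → ℝ),
      ∫ ω, Complex.exp (Complex.I * (∑ j ∈ J, a j * Z ω j : ℝ)) * starRingEnd ℂ (X (Z ω)) ∂μ
        = 0 := by
    intro J a
    have h1 := congrArg (starRingEnd ℂ) (h J (-a))
    rw [← integral_conj, map_zero] at h1
    rw [← h1]
    refine integral_congr_ae (ae_of_all _ fun ω => ?_)
    simp only [map_mul, ← Complex.exp_conj, Complex.conj_I, Complex.conj_ofReal]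
    congr 2
    simp [Finset.sum_neg_distrib]
  have hint' : Integrable (fun ω => starRingEnd ℂ (X (Z ω))) μ :=
    (RCLike.conjCLE (K := ℂ)).toContinuousLinearMap.integrable_comp hint
  have i1 : ∀ (J : Finset ι) (a : ι → ℝ), Integrable (fun ω =>
      Complex.exp (Complex.I * (∑ j ∈ J, a j * Z ω j : ℝ)) * X (Z ω)) μ := fun J a =>
    hint.bdd_mul (c := 1) (hm J a).aestronglyMeasurable (ae_of_all _ (hb J a))
  have i2 : ∀ (J : Finset ι) (a : ι → ℝ), Integrable (fun ω =>
      Complex.exp (Complex.I * (∑ j ∈ J, a j * Z ω j : ℝ)) * starRingEnd ℂ (X (Z ω))) μ :=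
    fun J a => hint'.bdd_mul (c := 1) (hm J a).aestronglyMeasurable (ae_of_all _ (hb J a))
  have key : ∀ w : ℂ, ∀ᵐ ω ∂μ, (w * X (Z ω)).re ≤ 0 := by
    intro w
    refine path_functional_nonpos (r := fun p => (w * X p).re) hZ
      (Complex.measurable_re.comp (hX.const_mul w)) (hint.const_mul w).re fun J a => ?_
    have e : ∀ ω, Complex.exp (Complex.I * (∑ j ∈ J, a j * Z ω j : ℝ)) * ((w * X (Z ω)).re : ℂ) =
        w / 2 * (Complex.exp (Complex.I * (∑ j ∈ J, a j * Z ω j : ℝ)) * X (Z ω)) +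
        starRingEnd ℂ w / 2 * (Complex.exp (Complex.I * (∑ j ∈ J, a j * Z ω j : ℝ)) *
          starRingEnd ℂ (X (Z ω))) := by
      intro ω
      rw [Complex.re_eq_add_conj, map_mul]
      ring
    simp_rw [e]
    rw [integral_add ((i1 J a).const_mul _) ((i2 J a).const_mul _), integral_const_mul,
      integral_const_mul, h J a, hc J a]
    simp
  filter_upwards [key 1, key (-1), key Complex.I, key (-Complex.I)] with ω a b c d
  simp at a b c d
  exact Complex.ext (le_antisymm a b) (le_antisymm d c)

end PathMeasure

/-- A functional of a path, possibly with uncountable index set, is measurable modulo null sets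
if each coordinate is. -/
theorem aesm_comp_path {Ω ι : Type*} {m : MeasurableSpace Ω} {μ : Measure[m] Ω}
    {G : MeasurableSpace Ω} {Z : Ω → ι → ℝ}
    (hZ : ∀ i, AEStronglyMeasurable[G] (fun ω => Z ω i) μ) {X : (ι → ℝ) → ℂ}
    (hX : Measurable X) : AEStronglyMeasurable[G] (fun ω => X (Z ω)) μ := by
  refine aesm_of_measurable_nullExtension (Measurable.comp hX ?_)
  exact @measurable_pi_iff _ _ _ (nullExtension G μ) _ _ |>.2
    fun i => measurable_nullExtension_of_aesm (hZ i)

namespace Noise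

/-! ### Brownian motion -/

section BM

variable {Ω : Type*} [m : MeasurableSpace Ω] [StandardBorelSpace Ω] {N : Noise Ω}
  {B : ℝ → Ω → ℝ}

namespace IsAdaptedBM

theorem map_ae (hB : N.IsAdaptedBM B) {t : ℝ} (ht : 0 < t) :
    N.P.map (B t) = gaussianReal 0 t.toNNReal := by
  have h := hB.law 0 t ht
  rw [sub_zero] at h
  rw [← h]
  refine Measure.map_congr ?_
  filter_upwards [hB.zero] with ω h0
  rw [h0, sub_zero]

theorem aesm (hB : N.IsAdaptedBM B) {s t : ℝ} (hs : 0 ≤ s) (hst : s ≤ t) :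
    AEStronglyMeasurable[N.F 0 t] (B s) N.P := by
  rcases hs.eq_or_lt with rfl | hs
  · exact aestronglyMeasurable_const.congr (f := fun _ => 0)
      (by filter_upwards [hB.zero] with ω h; exact h.symm)
  · refine ((hB.adapted 0 s hs).of_le_nullExtension (N.F_le_nullExtension_left hs hst)).congr ?_
    filter_upwards [hB.zero] with ω h0
    rw [h0, sub_zero]

theorem comp_T (hB : N.IsAdaptedBM B) {u : ℝ} (hu : 0 ≤ u) (s : ℝ) :
    (fun ω => B u (N.T s ω)) =ᵐ[N.P] fun ω => B (u + s) ω - B s ω := by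
  have h0 := (N.quasi_T s).ae hB.zero
  rcases hu.eq_or_lt with rfl | hu
  · filter_upwards [h0] with ω h
    rw [h, zero_add, sub_self]
  · filter_upwards [h0, hB.stationary 0 u s hu] with ω h h'
    rw [h, sub_zero, zero_add] at h'
    exact h'

theorem memLp_sub (hB : N.IsAdaptedBM B) (s t : ℝ) : MemLp (fun ω => B t ω - B s ω) 2 N.P := by
  have key : ∀ s t, s < t → MemLp (fun ω => B t ω - B s ω) 2 N.P := by
    intro s t h
    have hm : Measurable fun ω => B t ω - B s ω := (hB.measurable t).sub (hB.measurable s)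
    have := memLp_id_gaussianReal' (μ := 0) (v := (t - s).toNNReal) 2 (by simp)
    rw [← hB.law s t h] at this
    exact (memLp_map_measure_iff aestronglyMeasurable_id hm.aemeasurable).1 this
  rcases lt_trichotomy s t with h | rfl | h
  · exact key s t h
  · simp
  · convert (key t s h).neg using 1
    funext ω
    simp

theorem memLp (hB : N.IsAdaptedBM B) (t : ℝ) : MemLp (B t) 2 N.P := by
  refine (hB.memLp_sub 0 t).ae_eq ?_
  filter_upwards [hB.zero] with ω h0
  rw [h0, sub_zero]

theorem integral_sq (hB : N.IsAdaptedBM B) {s t : ℝ} (h : s < t) :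
    ∫ ω, (B t ω - B s ω) ^ 2 ∂N.P = t - s := by
  have hm : Measurable fun ω => B t ω - B s ω := (hB.measurable t).sub (hB.measurable s)
  have h1 := variance_fun_id_gaussianReal (μ := 0) (v := (t - s).toNNReal)
  rw [variance_of_integral_eq_zero (X := fun x : ℝ => x) aemeasurable_id (by simp),
    ← hB.law s t h, integral_map hm.aemeasurable (by fun_prop)] at h1
  rw [h1, Real.coe_toNNReal _ (by linarith)]

/-- The random variable `B_t` as an element of the real `L₂` space. -/
noncomputable def lp (hB : N.IsAdaptedBM B) (t : ℝ) : Lp ℝ 2 N.P := (hB.memLp t).toLp (B t)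

theorem lp_coeFn (hB : N.IsAdaptedBM B) (t : ℝ) : hB.lp t =ᵐ[N.P] B t := (hB.memLp t).coeFn_toLp

theorem norm_lp_sub_sq (hB : N.IsAdaptedBM B) {s t : ℝ} (h : s < t) :
    ‖hB.lp t - hB.lp s‖ ^ 2 = t - s := by
  rw [← real_inner_self_eq_norm_sq, L2.inner_def, ← hB.integral_sq h]
  refine integral_congr_ae ?_
  filter_upwards [Lp.coeFn_sub (hB.lp t) (hB.lp s), hB.lp_coeFn t, hB.lp_coeFn s] with ω a b c
  rw [a, Pi.sub_apply, b, c, real_inner_self_eq_norm_sq, Real.norm_eq_abs, sq_abs]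

theorem continuous_lp (hB : N.IsAdaptedBM B) : Continuous hB.lp := by
  have h : ∀ s t, dist (hB.lp t) (hB.lp s) = √|t - s| := by
    intro s t
    rcases lt_trichotomy s t with h | rfl | h
    · rw [dist_eq_norm, abs_of_pos (by linarith), ← hB.norm_lp_sub_sq h,
        Real.sqrt_sq (norm_nonneg _)]
    · simp
    · rw [dist_comm, dist_eq_norm, abs_sub_comm, abs_of_pos (by linarith), ← hB.norm_lp_sub_sq h,
        Real.sqrt_sq (norm_nonneg _)]
  refine continuous_iff_continuousAt.2 fun s => ?_
  rw [ContinuousAt, tendsto_iff_dist_tendsto_zero]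
  simp_rw [h]
  have : Continuous fun t : ℝ => √|t - s| := by fun_prop
  simpa using this.tendsto s

theorem integral_exp_sub (hB : N.IsAdaptedBM B) {s t : ℝ} (h : s < t) (z : ℂ) :
    ∫ ω, Complex.exp (z * (B t ω - B s ω : ℝ)) ∂N.P = Complex.exp (z ^ 2 / 2 * (t - s : ℝ)) := by
  have h1 := complexMGF_gaussianReal (hB.law s t h) z
  rw [complexMGF] at h1
  rw [h1, Real.coe_toNNReal _ (by linarith)]
  congr 1
  push_cast
  ring

theorem integral_exp (hB : N.IsAdaptedBM B) {t : ℝ} (ht : 0 < t) (z : ℂ) :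
    ∫ ω, Complex.exp (z * B t ω) ∂N.P = Complex.exp (z ^ 2 / 2 * t) := by
  have h1 := complexMGF_gaussianReal (hB.map_ae ht) z
  rw [complexMGF] at h1
  rw [h1, Real.coe_toNNReal _ ht.le]
  congr 1
  push_cast
  ring

theorem memLp_exp (hB : N.IsAdaptedBM B) {t : ℝ} (ht : 0 < t) (z : ℂ) :
    MemLp (fun ω => Complex.exp (z * B t ω)) 2 N.P := by
  have hm := hB.measurable t
  refine (memLp_two_iff_integrable_sq_norm
    (Measurable.aestronglyMeasurable (by fun_prop))).2 ?_
  have h1 := integrable_exp_mul_gaussianReal (μ := 0) (v := t.toNNReal) (2 * z.re)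
  rw [← hB.map_ae ht] at h1
  convert h1.comp_measurable hm using 1
  funext ω
  rw [Complex.norm_exp, ← Real.exp_nat_mul]
  simp
  ring

end IsAdaptedBM

/-! ### The white noise part -/

theorem whiteField_le (hB : N.IsAdaptedBM B) (s t : ℝ) : whiteField B s t ≤ m :=
  iSup₂_le fun u _ => ((hB.measurable u).sub (hB.measurable s)).comap_le

theorem monotone_Hwhite : Monotone (N.Hwhite B) := by
  intro s t hst X hX
  refine mem_lpMeas_iff_aestronglyMeasurable.2
    ((mem_lpMeas_iff_aestronglyMeasurable.1 hX).mono ?_)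
  exact iSup₂_le fun u hu => le_iSup₂_of_le u ⟨hu.1, hu.2.trans_le hst⟩ le_rfl

/-- The field `whiteField B 0 t` is generated by times in the open interval; by `L₂`-continuity
of Brownian motion it contains the endpoint `t` as well, modulo null sets. -/
theorem aesm_whiteField (hB : N.IsAdaptedBM B) {t : ℝ} (ht : 0 < t) {s : ℝ} (hs : s ∈ Icc 0 t) :
    AEStronglyMeasurable[whiteField B 0 t] (B s) N.P := by
  have h1 : ∀ s ∈ Ioo 0 t, AEStronglyMeasurable[whiteField B 0 t] (B s) N.P := by
    intro s hs
    have : Measurable[whiteField B 0 t] fun ω => B s ω - B 0 ω :=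
      (comap_measurable _).mono (le_iSup₂_of_le s hs le_rfl) le_rfl
    refine this.stronglyMeasurable.aestronglyMeasurable.congr ?_
    filter_upwards [hB.zero] with ω h0
    rw [h0, sub_zero]
  have hcl := (isClosed_aestronglyMeasurable (F := ℝ) (p := 2) (μ := N.P)
    (whiteField_le hB 0 t)).preimage hB.continuous_lp
  have hsub : Ioo 0 t ⊆ hB.lp ⁻¹' {f | AEStronglyMeasurable[whiteField B 0 t] f N.P} :=
    fun u hu => (h1 u hu).congr (hB.lp_coeFn u).symm
  have := hcl.closure_subset_iff.2 hsub (by rwa [closure_Ioo ht.ne] : s ∈ closure (Ioo 0 t))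
  exact AEStronglyMeasurable.congr this (hB.lp_coeFn s)

theorem measurable_path (hB : N.IsAdaptedBM B) (t : PosTime) : Measurable (path B t) :=
  measurable_pi_iff.2 fun s => hB.measurable s

/-- The elements of `H_t^white` are the square integrable functionals of the path on `[0,t]`. -/
theorem mem_Hwhite_iff (hB : N.IsAdaptedBM B) {t : PosTime} {ψ : Lp ℂ 2 N.P} :
    ψ ∈ N.Hwhite B t ↔
      ∃ X : (Icc (0 : ℝ) t → ℝ) → ℂ, Measurable X ∧ ψ =ᵐ[N.P] fun ω => X (path B t ω) := by
  rw [Hwhite, mem_lpMeas_iff_aestronglyMeasurable]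
  constructor
  · intro h
    have hle : whiteField B 0 t ≤ MeasurableSpace.comap (path B t) MeasurableSpace.pi := by
      refine iSup₂_le fun u hu => ?_
      rintro _ ⟨S, hS, rfl⟩
      have hd : Measurable fun p : Icc (0 : ℝ) t → ℝ =>
        p ⟨u, hu.1.le, hu.2.le⟩ - p ⟨0, le_rfl, t.2.le⟩ := by fun_prop
      have hS' : MeasurableSet S := hS
      exact ⟨_, hd hS', rfl⟩
    have h2 := h.mono hle
    obtain ⟨X, hX, e⟩ := h2.stronglyMeasurable_mk.measurable.exists_eq_measurable_comp
    refine ⟨X, hX, h2.ae_eq_mk.trans ?_⟩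
    rw [e]
    rfl
  · rintro ⟨X, hX, e⟩
    exact (aesm_comp_path (Z := path B t) (fun i => aesm_whiteField hB t.2 i.2) hX).congr e.symm

theorem Hwhite_le (hB : N.IsAdaptedBM B) (t : PosTime) : N.Hwhite B t ≤ N.H t := by
  intro ψ hψ
  obtain ⟨X, hX, e⟩ := (mem_Hwhite_iff hB).1 hψ
  exact mem_H_congr e (aesm_comp_path (Z := path B t)
    (fun i => hB.aesm i.2.1 i.2.2) hX)

/-- The path of `B` on `[0,∞)`. -/
def fullPath {Ω : Type*} (B : ℝ → Ω → ℝ) (ω : Ω) : Ici (0 : ℝ) → ℝ := fun s => B s ω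

theorem measurable_fullPath (hB : N.IsAdaptedBM B) : Measurable (fullPath B) :=
  measurable_pi_iff.2 fun s => hB.measurable s

/-- The restriction of a path to `[0,t]`. -/
def restrictPath (t : PosTime) (p : Ici (0 : ℝ) → ℝ) : Icc (0 : ℝ) t → ℝ := fun s => p ⟨s, s.2.1⟩

theorem measurable_restrictPath (t : PosTime) : Measurable (restrictPath t) :=
  measurable_pi_iff.2 fun _ => measurable_pi_apply _

/-- The increments after time `s` of a path, on an interval of length `t`. -/
def shiftPath (s t : PosTime) (p : Ici (0 : ℝ) → ℝ) : Icc (0 : ℝ) t → ℝ :=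
  fun u => p ⟨u + s, add_nonneg u.2.1 s.2.le⟩ - p ⟨s, s.2.le⟩

theorem measurable_shiftPath (s t : PosTime) : Measurable (shiftPath s t) :=
  measurable_pi_iff.2 fun _ => (measurable_pi_apply _).sub (measurable_pi_apply _)

/-- A functional of the path on `[0,t]`, moved by `T_s`, is the functional of the increments after
time `s`. -/
theorem path_comp_T (hB : N.IsAdaptedBM B) (s t : PosTime) {X : (Icc (0 : ℝ) t → ℝ) → ℂ}
    (hX : Measurable X) :
    (fun ω => X (path B t (N.T s ω))) =ᵐ[N.P] fun ω => X (shiftPath s t (fullPath B ω)) :=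
  ae_eq_comp_of_coord (fun i => hB.comp_T i.2.1 s) hX

/-! ### Step exponentials -/

/-- The sum of the increments of `B` over the first `n` intervals of length `δ`, with
coefficients `y k`. -/
def stepSum {Ω : Type*} (B : ℝ → Ω → ℝ) (δ : ℝ) (y : ℕ → ℝ) (n : ℕ) (ω : Ω) : ℝ :=
  ∑ k ∈ Finset.range n, y k * (B ((k + 1) * δ) ω - B (k * δ) ω)

theorem measurable_stepSum (hB : N.IsAdaptedBM B) (δ : ℝ) (y : ℕ → ℝ) (n : ℕ) :
    Measurable (stepSum B δ y n) :=
  Finset.measurable_sum _ fun _ _ => ((hB.measurable _).sub (hB.measurable _)).const_mul _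

/-- The coefficients with which the increments over intervals of length `δ` add up to
`∑ a j * B (δ * ⌊j / δ⌋)`. -/
noncomputable def stepCoeff (J : Finset ℝ) (a : ℝ → ℝ) (δ : ℝ) (k : ℕ) : ℝ :=
  ∑ j ∈ J, if k < ⌊j / δ⌋₊ then a j else 0

theorem stepSum_stepCoeff {Ω : Type*} (B : ℝ → Ω → ℝ) (J : Finset ℝ) (a : ℝ → ℝ) (δ : ℝ) {n : ℕ}
    (hn : ∀ j ∈ J, ⌊j / δ⌋₊ ≤ n) (ω : Ω) :
    stepSum B δ (stepCoeff J a δ) n ω =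
      ∑ j ∈ J, a j * (B (⌊j / δ⌋₊ * δ) ω - B 0 ω) := by
  simp only [stepSum, stepCoeff, Finset.sum_mul]
  rw [Finset.sum_comm]
  refine Finset.sum_congr rfl fun j hj => ?_
  have h1 := Finset.sum_range_sub (fun k : ℕ => B (k * δ) ω) ⌊j / δ⌋₊
  simp only [Nat.cast_zero, zero_mul] at h1
  rw [← h1, Finset.mul_sum, ← Finset.sum_subset (Finset.range_mono (hn j hj))]
  · refine Finset.sum_congr rfl fun k hk => ?_
    rw [if_pos (Finset.mem_range.1 hk)]
    push_cast
    ring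
  · intro k _ hk
    rw [if_neg (by simpa using hk), zero_mul]

theorem tendsto_floor_mul {t s : ℝ} (ht : 0 < t) (hs : 0 ≤ s) :
    Tendsto (fun n : ℕ => (⌊s / (t / (n + 1))⌋₊ : ℝ) * (t / (n + 1))) atTop (𝓝 s) := by
  have hδ : Tendsto (fun n : ℕ => s - t / ((n : ℝ) + 1)) atTop (𝓝 s) := by
    have := tendsto_one_div_add_atTop_nhds_zero_nat (𝕜 := ℝ) |>.const_mul t |>.const_sub s
    simpa [div_eq_mul_inv] using this
  refine tendsto_of_tendsto_of_tendsto_of_le_of_le hδ tendsto_const_nhds ?_ ?_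
  · intro n
    have h : 0 < t / ((n : ℝ) + 1) := by positivity
    have := Nat.lt_floor_add_one (s / (t / ((n : ℝ) + 1)))
    rw [div_lt_iff₀ h] at this
    change s - t / ((n : ℝ) + 1) ≤ _
    linarith
  · intro n
    have h : 0 < t / ((n : ℝ) + 1) := by positivity
    have := Nat.floor_le (div_nonneg hs h.le)
    rwa [le_div_iff₀ h] at this

/-- Every exponential of a linear combination of values of `B` on `[0,t]` is approximated by step
exponentials along equidistant partitions of `[0,t]`, with coefficients that do not depend on
the noise. -/
theorem tendsto_stepSum (hB : N.IsAdaptedBM B) {t : ℝ} (ht : 0 < t) {J : Finset ℝ}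
    (hJ : ∀ j ∈ J, j ∈ Icc 0 t) (a : ℝ → ℝ) {Y : Ω → ℝ} (hY : Measurable Y)
    (hYe : ∀ ω, Y ω = ∑ j ∈ J, a j * B j ω) (ξ : Lp ℂ 2 N.P) :
    Tendsto (fun n : ℕ => mulPhase N.P (measurable_stepSum hB (t / (n + 1))
      (stepCoeff J a (t / (n + 1))) (n + 1)) ξ) atTop (𝓝 (mulPhase N.P hY ξ)) := by
  have h1 : Tendsto (fun n : ℕ => ∑ j ∈ J, a j • hB.lp (⌊j / (t / (n + 1))⌋₊ * (t / (n + 1))))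
      atTop (𝓝 (∑ j ∈ J, a j • hB.lp j)) :=
    tendsto_finsetSum _ fun j hj =>
      (((hB.continuous_lp.tendsto j).comp (tendsto_floor_mul ht (hJ j hj).1)).const_smul (a j))
  have hsum : ∀ u : ℝ → ℝ, ∀ᵐ ω ∂N.P, (∑ j ∈ J, a j • hB.lp (u j) : Lp ℝ 2 N.P) ω =
      ∑ j ∈ J, a j * B (u j) ω := by
    intro u
    have h2 : ∀ j, ∀ᵐ ω ∂N.P, (a j • hB.lp (u j) : Lp ℝ 2 N.P) ω = a j * B (u j) ω := by
      intro j
      filter_upwards [Lp.coeFn_smul (a j) (hB.lp (u j)), hB.lp_coeFn (u j)] with ω b c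
      rw [b, Pi.smul_apply, c, smul_eq_mul]
    filter_upwards [Lp.coeFn_finsetSum J fun j => a j • hB.lp (u j),
      (Finset.eventually_all J).2 fun j _ => h2 j] with ω b c
    rw [b, Finset.sum_apply]
    exact Finset.sum_congr rfl fun j hj => c j hj
  refine tendsto_Lp_comp_mul (φ := fun x : ℝ => Complex.exp (Complex.I * x)) (C := 1) (ξ := ξ)
    h1 (by fun_prop) (fun x => by rw [mul_comm, Complex.norm_exp_ofReal_mul_I]) ?_ ?_
  · intro n
    have hn : ∀ j ∈ J, ⌊j / (t / ((n : ℝ) + 1))⌋₊ ≤ n + 1 := by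
      intro j hj
      refine Nat.floor_le_of_le ?_
      push_cast
      rw [div_le_iff₀ (by positivity), mul_div_cancel₀ _ (by positivity)]
      exact (hJ j hj).2
    filter_upwards [mulPhase_coeFn N.P (measurable_stepSum hB (t / (n + 1))
      (stepCoeff J a (t / (n + 1))) (n + 1)) ξ, hsum fun j => ⌊j / (t / (n + 1))⌋₊ * (t / (n + 1)),
      hB.zero] with ω b c d
    rw [b, c, stepSum_stepCoeff B J a _ hn, d]
    simp
  · filter_upwards [mulPhase_coeFn N.P hY ξ, hsum fun j => j] with ω b c
    rw [b, c, hYe]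

end BM

section

variable {Ω : Type*} [m : MeasurableSpace Ω] [StandardBorelSpace Ω] {N : Noise Ω}
  {B : ℝ → Ω → ℝ}

/-- The constant function `1` as an element of `L₂`. -/
noncomputable def one (N : Noise Ω) : Lp ℂ 2 N.P := (memLp_const (1 : ℂ)).toLp _

theorem one_coeFn (N : Noise Ω) : N.one =ᵐ[N.P] fun _ => 1 := (memLp_const (1 : ℂ)).coeFn_toLp

theorem inner_one (F : Lp ℂ 2 N.P) : inner ℂ N.one F = ∫ ω, F ω ∂N.P := by
  rw [L2.inner_def]
  refine integral_congr_ae ?_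
  filter_upwards [N.one_coeFn] with ω h
  simp [h]

theorem inner_one_mulPhase {f : Ω → ℝ} (hf : Measurable f) (ξ : Lp ℂ 2 N.P) :
    inner ℂ N.one (mulPhase N.P hf ξ) = ∫ ω, Complex.exp (Complex.I * f ω) * ξ ω ∂N.P := by
  rw [inner_one]
  exact integral_congr_ae (mulPhase_coeFn N.P hf ξ)

theorem tendsto_integral_stepSum (hB : N.IsAdaptedBM B) {t : ℝ} (ht : 0 < t) {J : Finset ℝ}
    (hJ : ∀ j ∈ J, j ∈ Icc 0 t) (a : ℝ → ℝ) {Y : Ω → ℝ} (hY : Measurable Y)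
    (hYe : ∀ ω, Y ω = ∑ j ∈ J, a j * B j ω) (ξ : Lp ℂ 2 N.P) :
    Tendsto (fun n : ℕ => ∫ ω, Complex.exp (Complex.I *
      stepSum B (t / (n + 1)) (stepCoeff J a (t / (n + 1))) (n + 1) ω) * ξ ω ∂N.P) atTop
      (𝓝 (∫ ω, Complex.exp (Complex.I * Y ω) * ξ ω ∂N.P)) := by
  have h := (tendsto_stepSum hB ht hJ a hY hYe ξ)
  have h2 := (tendsto_const_nhds (x := N.one)).inner (𝕜 := ℂ) h
  simpa only [inner_one_mulPhase] using h2

/-- Step exponentials are total in `H_t^white`. -/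
theorem eq_zero_of_stepSum (hB : N.IsAdaptedBM B) {t : PosTime} {ψ : Lp ℂ 2 N.P}
    (hψ : ψ ∈ N.Hwhite B t)
    (h : ∀ (n : ℕ) (y : ℕ → ℝ),
      ∫ ω, Complex.exp (Complex.I * stepSum B (t / (n + 1)) y (n + 1) ω) * ψ ω ∂N.P = 0) :
    ψ = 0 := by
  classical
  obtain ⟨X, hX, e⟩ := (mem_Hwhite_iff hB).1 hψ
  have hint : Integrable (fun ω => X (path B t ω)) N.P :=
    ((Lp.memLp ψ).integrable one_le_two).congr e
  refine Lp.ext ?_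
  have := path_functional_eq_zero (measurable_path hB t) hX hint ?_
  · filter_upwards [e, this, Lp.coeFn_zero ℂ 2 N.P] with ω a b c
    rw [a, b, c, Pi.zero_apply]
  intro J a
  have hY : Measurable fun ω => ∑ j ∈ J, a j * path B t ω j :=
    Finset.measurable_sum _ fun j _ => (hB.measurable j).const_mul _
  have h1 := tendsto_integral_stepSum hB t.2 (J := J.map (Function.Embedding.subtype _))
    (fun j hj => by
      obtain ⟨i, -, rfl⟩ := Finset.mem_map.1 hj
      exact i.2)
    (fun s => if hs : s ∈ Icc (0 : ℝ) t then a ⟨s, hs⟩ else 0) hY (fun ω => by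
      rw [Finset.sum_map]
      refine Finset.sum_congr rfl fun j _ => ?_
      simp only [Function.Embedding.subtype_apply, Subtype.coe_eta, dif_pos j.2]
      rfl) ψ
  simp only [h] at h1
  rw [← tendsto_nhds_unique h1 tendsto_const_nhds]
  refine integral_congr_ae ?_
  filter_upwards [e] with ω h
  rw [h]

/-- The increments are independent Gaussian variables. -/
theorem integral_exp_stepSum (hB : N.IsAdaptedBM B) {δ : ℝ} (hδ : 0 < δ) (y : ℕ → ℝ) (n : ℕ) :
    ∫ ω, Complex.exp (Complex.I * stepSum B δ y n ω) ∂N.P =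
      ∏ k ∈ Finset.range n, Complex.exp (-(y k : ℂ) ^ 2 / 2 * δ) := by
  induction n with
  | zero => simp [stepSum]
  | succ n ih =>
    have hlt : ∀ k : ℕ, (k : ℝ) * δ < (k + 1) * δ := fun k => by nlinarith
    have h0 : ∀ k : ℕ, (-1 : ℝ) < k * δ := fun k => by
      have : 0 ≤ (k : ℝ) * δ := by positivity
      linarith
    have h1 : AEStronglyMeasurable[N.F (-1) (n * δ)] (stepSum B δ y n) N.P := by
      have hk : ∀ k ∈ Finset.range n, AEStronglyMeasurable[N.F (-1) (n * δ)]
          (fun ω => y k * (B ((k + 1) * δ) ω - B (k * δ) ω)) N.P := ?_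
      · have h : ∀ u : Finset ℕ, u ⊆ Finset.range n → AEStronglyMeasurable[N.F (-1) (n * δ)]
            (fun ω => ∑ k ∈ u, y k * (B ((k + 1) * δ) ω - B (k * δ) ω)) N.P := by
          intro u
          induction u using Finset.induction_on with
          | empty => intro _; simpa using aestronglyMeasurable_const
          | insert k u hku ih =>
            intro hu
            simp only [Finset.sum_insert hku]
            exact (hk k (hu (Finset.mem_insert_self k u))).add
              (ih ((Finset.subset_insert k u).trans hu))
        exact h _ subset_rfl
      intro k hk
      have hkn : ((k : ℝ) + 1) * δ ≤ n * δ := by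
        have : ((k + 1 : ℕ) : ℝ) ≤ n := by exact_mod_cast Finset.mem_range.1 hk
        push_cast at this
        nlinarith
      refine AEStronglyMeasurable.const_mul ?_ _
      exact ((hB.adapted _ _ (hlt k)).of_le_nullExtension
        (N.F_le_nullExtension_right (h0 k).le (hlt k))).of_le_nullExtension
        (N.F_le_nullExtension_left ((h0 k).trans (hlt k)) hkn)
    have hi := N.indepFun (h0 n) (hlt n) h1 (hB.adapted _ _ (hlt n))
    have hm : Measurable fun x : ℝ => Complex.exp (Complex.I * x) := by fun_prop
    have hm' : Measurable fun x : ℝ => Complex.exp (Complex.I * (y n * x : ℝ)) := by fun_prop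
    have hms := measurable_stepSum hB δ y n
    have hmi := (hB.measurable ((n + 1) * δ)).sub (hB.measurable (n * δ))
    have h2 := (hi.comp hm hm').integral_mul_eq_mul_integral
      (hm.comp hms).aestronglyMeasurable (hm'.comp hmi).aestronglyMeasurable
    rw [Finset.prod_range_succ, ← ih]
    have h3 := hB.integral_exp_sub (hlt n) (Complex.I * y n)
    have h4 : Complex.exp (-(y n : ℂ) ^ 2 / 2 * δ) =
        ∫ ω, Complex.exp (Complex.I * (y n * (B ((n + 1) * δ) ω - B (n * δ) ω) : ℝ)) ∂N.P := by
      rw [show (-(y n : ℂ) ^ 2 / 2 * δ) = (Complex.I * y n) ^ 2 / 2 * ((n + 1) * δ - n * δ : ℝ) by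
        rw [mul_pow, Complex.I_sq]; push_cast; ring, ← h3]
      congr 1
      funext ω
      congr 1
      push_cast
      ring
    rw [h4]
    refine Eq.trans ?_ h2
    congr 1
    funext ω
    simp only [Pi.mul_apply, Function.comp, ← Complex.exp_add]
    congr 1
    rw [stepSum, Finset.sum_range_succ]
    simp only [stepSum]
    push_cast
    ring

/-- The finite-dimensional characteristic functions of Brownian motion are limits of expressions
that do not depend on the noise. -/
theorem tendsto_charFun_fullPath (hB : N.IsAdaptedBM B) {t : ℝ} (ht : 0 < t)
    {J : Finset (Ici (0 : ℝ))}
    (hJ : ∀ j ∈ J.map (Function.Embedding.subtype _), j ∈ Icc 0 t) (a : Ici (0 : ℝ) → ℝ)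
    {b : ℝ → ℝ} (hb : ∀ j : Ici (0 : ℝ), b j = a j) :
    Tendsto (fun n : ℕ => ∏ k ∈ Finset.range (n + 1), Complex.exp
        (-(stepCoeff (J.map (Function.Embedding.subtype _)) b (t / (n + 1)) k : ℂ) ^ 2 / 2 *
          (t / (n + 1) : ℝ))) atTop
      (𝓝 (∫ ω, Complex.exp (Complex.I * (∑ j ∈ J, a j * fullPath B ω j : ℝ)) ∂N.P)) := by
  have hY : Measurable fun ω => ∑ j ∈ J, a j * fullPath B ω j :=
    Finset.measurable_sum _ fun j _ => (hB.measurable j).const_mul _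
  have h1 := tendsto_integral_stepSum hB ht hJ b hY (fun ω => by
    rw [Finset.sum_map]
    refine Finset.sum_congr rfl fun j _ => ?_
    simp only [Function.Embedding.subtype_apply, hb]
    rfl) N.one
  have h2 : ∀ f : Ω → ℂ, ∫ ω, f ω * N.one ω ∂N.P = ∫ ω, f ω ∂N.P := fun f => by
    refine integral_congr_ae ?_
    filter_upwards [N.one_coeFn] with ω h
    rw [h, mul_one]
  simp only [h2] at h1
  refine h1.congr fun n => ?_
  rw [integral_exp_stepSum hB (by positivity)]

end

section TwoNoises

variable {Ω Ω' : Type*} [MeasurableSpace Ω] [StandardBorelSpace Ω] [MeasurableSpace Ω']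
  [StandardBorelSpace Ω'] {N : Noise Ω} {B : ℝ → Ω → ℝ} {N' : Noise Ω'} {B' : ℝ → Ω' → ℝ}

/-- All Brownian motions have the same law on path space. -/
theorem map_fullPath_eq (hB : N.IsAdaptedBM B) (hB' : N'.IsAdaptedBM B') :
    N.P.map (fullPath B) = N'.P.map (fullPath B') := by
  classical
  have := Measure.isProbabilityMeasure_map (μ := N.P) (measurable_fullPath hB).aemeasurable
  have := Measure.isProbabilityMeasure_map (μ := N'.P) (measurable_fullPath hB').aemeasurable
  refine path_measure_ext fun J a => ?_
  rw [integral_map (measurable_fullPath hB).aemeasurable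
      (Measurable.aestronglyMeasurable (by fun_prop)),
    integral_map (measurable_fullPath hB').aemeasurable
      (Measurable.aestronglyMeasurable (by fun_prop))]
  let t : ℝ := 1 + ∑ j ∈ J, (j : ℝ)
  have ht : 0 < t := add_pos_of_pos_of_nonneg one_pos (Finset.sum_nonneg fun j _ => j.2)
  have hJ : ∀ j ∈ J.map (Function.Embedding.subtype _), j ∈ Icc 0 t := by
    intro j hj
    obtain ⟨i, hi, rfl⟩ := Finset.mem_map.1 hj
    refine ⟨i.2, ?_⟩
    have := Finset.single_le_sum (f := fun j : Ici (0 : ℝ) => (j : ℝ)) (fun j _ => j.2) hi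
    change (i : ℝ) ≤ 1 + _
    linarith
  let b : ℝ → ℝ := fun s => if hs : s ∈ Ici (0 : ℝ) then a ⟨s, hs⟩ else 0
  have hb : ∀ j : Ici (0 : ℝ), b j = a j :=
    fun j => dif_pos j.2
  exact tendsto_nhds_unique (tendsto_charFun_fullPath hB ht hJ a hb)
    (tendsto_charFun_fullPath hB' ht hJ a hb)

/-- An almost sure property of the path of one Brownian motion holds for all of them. -/
theorem ae_fullPath_iff (hB : N.IsAdaptedBM B) (hB' : N'.IsAdaptedBM B')
    {p : (Ici (0 : ℝ) → ℝ) → Prop} (hp : MeasurableSet {x | p x}) :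
    (∀ᵐ ω ∂N.P, p (fullPath B ω)) ↔ ∀ᵐ ω ∂N'.P, p (fullPath B' ω) := by
  rw [← ae_map_iff (measurable_fullPath hB).aemeasurable hp, map_fullPath_eq hB hB',
    ae_map_iff (measurable_fullPath hB').aemeasurable hp]

end TwoNoises

section PathEquiv

variable {Ω : Type*} [m : MeasurableSpace Ω] [StandardBorelSpace Ω] {N : Noise Ω}
  {B : ℝ → Ω → ℝ}

/-- The unitary operator `X ↦ X(B|[0,t])` from the `L₂` space over the law `μ` of the path
onto `H_t^white`. -/
noncomputable def pathEquiv (hB : N.IsAdaptedBM B) (t : PosTime)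
    {μ : Measure (Icc (0 : ℝ) t → ℝ)} (hμ : MeasurePreserving (path B t) N.P μ) :
    Lp ℂ 2 μ ≃ₗᵢ[ℂ] N.Hwhite B t :=
  LinearIsometryEquiv.ofSurjective
    { toLinearMap := (Lp.compMeasurePreservingₗᵢ ℂ (path B t) hμ).toLinearMap.codRestrict
        (N.Hwhite B t) fun x => by
          obtain ⟨y, hy, e⟩ := Lp.aestronglyMeasurable x
          exact (mem_Hwhite_iff hB).2 ⟨y, hy.measurable, (Lp.coeFn_compMeasurePreserving x hμ).trans
            (hμ.quasiMeasurePreserving.ae_eq_comp e)⟩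
      norm_map' := fun x => (Lp.compMeasurePreservingₗᵢ ℂ (path B t) hμ).norm_map x }
    (by
      rintro ⟨ψ, hψ⟩
      obtain ⟨X, hX, e⟩ := (mem_Hwhite_iff hB).1 hψ
      have hm : MemLp X 2 μ := by
        have h := (Lp.memLp ψ).ae_eq e
        rw [← hμ.map_eq]
        exact (memLp_map_measure_iff hX.aestronglyMeasurable hμ.measurable.aemeasurable).2 h
      refine ⟨hm.toLp X, Subtype.ext (Lp.ext ?_)⟩
      refine (Lp.coeFn_compMeasurePreserving (hm.toLp X) hμ).trans ?_
      exact (hμ.quasiMeasurePreserving.ae_eq_comp hm.coeFn_toLp).trans e.symm)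

theorem pathEquiv_coeFn (hB : N.IsAdaptedBM B) (t : PosTime)
    {μ : Measure (Icc (0 : ℝ) t → ℝ)} (hμ : MeasurePreserving (path B t) N.P μ) (x : Lp ℂ 2 μ) :
    (pathEquiv hB t hμ x : Lp ℂ 2 N.P) =ᵐ[N.P] fun ω => x (path B t ω) :=
  Lp.coeFn_compMeasurePreserving x hμ

end PathEquiv

section WhiteIso

variable {Ω Ω' : Type*} [MeasurableSpace Ω] [StandardBorelSpace Ω] [MeasurableSpace Ω']
  [StandardBorelSpace Ω'] {N : Noise Ω} {B : ℝ → Ω → ℝ} {N' : Noise Ω'} {B' : ℝ → Ω' → ℝ}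

theorem measurePreserving_path (hB : N.IsAdaptedBM B) (t : PosTime) :
    MeasurePreserving (path B t) N.P (N.P.map (path B t)) :=
  (measurable_path hB t).measurePreserving _

theorem measurePreserving_path' (hB : N.IsAdaptedBM B) (hB' : N'.IsAdaptedBM B') (t : PosTime) :
    MeasurePreserving (path B' t) N'.P (N.P.map (path B t)) := by
  refine ⟨measurable_path hB' t, ?_⟩
  have h1 : N.P.map (path B t) = (N.P.map (fullPath B)).map (restrictPath t) := by
    rw [Measure.map_map (measurable_restrictPath t) (measurable_fullPath hB)]
    rfl
  rw [h1, map_fullPath_eq hB hB',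
    Measure.map_map (measurable_restrictPath t) (measurable_fullPath hB')]
  rfl

/-- The unitary operator `X(B|[0,t]) ↦ X(B'|[0,t])`. -/
noncomputable def whiteOp (hB : N.IsAdaptedBM B) (hB' : N'.IsAdaptedBM B') (t : PosTime) :
    N.Hwhite B t ≃ₗᵢ[ℂ] N'.Hwhite B' t :=
  (pathEquiv hB t (measurePreserving_path hB t)).symm.trans
    (pathEquiv hB' t (measurePreserving_path' hB hB' t))

theorem whiteOp_coeFn (hB : N.IsAdaptedBM B) (hB' : N'.IsAdaptedBM B') {t : PosTime}
    {X : (Icc (0 : ℝ) t → ℝ) → ℂ} (hX : Measurable X) {ψ : N.Hwhite B t}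
    (h : (ψ : Lp ℂ 2 N.P) =ᵐ[N.P] fun ω => X (path B t ω)) :
    (whiteOp hB hB' t ψ : Lp ℂ 2 N'.P) =ᵐ[N'.P] fun ω => X (path B' t ω) := by
  set x := (pathEquiv hB t (measurePreserving_path hB t)).symm ψ with hx
  have h1 := pathEquiv_coeFn hB t (measurePreserving_path hB t) x
  rw [hx, LinearIsometryEquiv.apply_symm_apply] at h1
  have h2 : x =ᵐ[N.P.map (path B t)] X := by
    obtain ⟨x₁, hx₁, e₁⟩ := Lp.aestronglyMeasurable x
    refine e₁.trans ((ae_map_iff (measurable_path hB t).aemeasurable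
      (measurableSet_eq_fun hx₁.measurable hX)).2 ?_)
    filter_upwards [(measurePreserving_path hB t).quasiMeasurePreserving.ae_eq_comp e₁, h1, h]
      with ω a b c
    have a' : x (path B t ω) = x₁ (path B t ω) := a
    rw [← a', ← b, c]
  refine (pathEquiv_coeFn hB' t (measurePreserving_path' hB hB' t) x).trans ?_
  exact (measurePreserving_path' hB hB' t).quasiMeasurePreserving.ae_eq_comp h2

/-- All the operators `X(B|[0,t]) ↦ X(B'|[0,t])` are restrictions of a single operator, the
composition of the embedding of `L₂` over the path space into `L₂(N'.P)` with the adjoint of the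
embedding into `L₂(N.P)`. -/
theorem borelMap_whiteOp (hB : N.IsAdaptedBM B) (hB' : N'.IsAdaptedBM B')
    {X : ∀ t, N.Hwhite B t} (hX : N.BorelMap fun t => (X t : Lp ℂ 2 N.P)) :
    N'.BorelMap fun t => (whiteOp hB hB' t (X t) : Lp ℂ 2 N'.P) := by
  have hμ : MeasurePreserving (fullPath B) N.P (N.P.map (fullPath B)) :=
    (measurable_fullPath hB).measurePreserving _
  have hμ' : MeasurePreserving (fullPath B') N'.P (N.P.map (fullPath B)) :=
    ⟨measurable_fullPath hB', (map_fullPath_eq hB hB').symm⟩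
  let J := (Lp.compMeasurePreservingₗᵢ ℂ (E := ℂ) (p := 2) (fullPath B) hμ)
  let J' := (Lp.compMeasurePreservingₗᵢ ℂ (E := ℂ) (p := 2) (fullPath B') hμ')
  have key : ∀ t, (whiteOp hB hB' t (X t) : Lp ℂ 2 N'.P) =
      J' (ContinuousLinearMap.adjoint J.toContinuousLinearMap (X t : Lp ℂ 2 N.P)) := by
    intro t
    obtain ⟨x, hx, e⟩ := (mem_Hwhite_iff hB).1 (X t).2
    have hx' : Measurable fun p => x (restrictPath t p) := hx.comp (measurable_restrictPath t)
    have hm : MemLp (fun p => x (restrictPath t p)) 2 (N.P.map (fullPath B)) :=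
      (memLp_map_measure_iff hx'.aestronglyMeasurable hμ.measurable.aemeasurable).2
        ((Lp.memLp (X t : Lp ℂ 2 N.P)).ae_eq e)
    have h1 : (X t : Lp ℂ 2 N.P) = J (hm.toLp _) := by
      refine Lp.ext (e.trans ?_)
      exact ((Lp.coeFn_compMeasurePreserving (hm.toLp _) hμ).trans
        (hμ.quasiMeasurePreserving.ae_eq_comp hm.coeFn_toLp)).symm
    have h2 : ContinuousLinearMap.adjoint J.toContinuousLinearMap (J (hm.toLp _)) = hm.toLp _ := by
      refine ext_inner_right ℂ fun y => ?_
      rw [ContinuousLinearMap.adjoint_inner_left]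
      exact J.inner_map_map _ _
    rw [h1, h2]
    refine Lp.ext ((whiteOp_coeFn hB hB' hx e).trans ?_)
    exact ((Lp.coeFn_compMeasurePreserving (hm.toLp _) hμ').trans
      (hμ'.quasiMeasurePreserving.ae_eq_comp hm.coeFn_toLp)).symm
  simp_rw [key]
  let _ : MeasurableSpace (Lp ℂ 2 N.P) := borel _
  have : BorelSpace (Lp ℂ 2 N.P) := ⟨rfl⟩
  let _ : MeasurableSpace (Lp ℂ 2 N'.P) := borel _
  have : BorelSpace (Lp ℂ 2 N'.P) := ⟨rfl⟩
  exact (J'.continuous.comp (ContinuousLinearMap.continuous _)).measurable.comp hX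

/-- The natural isomorphism between the white noise parts of two extensions. -/
noncomputable def whiteIso (hB : N.IsAdaptedBM B) (hB' : N'.IsAdaptedBM B') :
    SystemIso N (N.Hwhite B) N' (N'.Hwhite B') where
  op := whiteOp hB hB'
  map_mul s t X Y Z h := by
    obtain ⟨x, hx, ex⟩ := (mem_Hwhite_iff hB).1 X.2
    obtain ⟨y, hy, ey⟩ := (mem_Hwhite_iff hB).1 Y.2
    obtain ⟨z, hz, ez⟩ := (mem_Hwhite_iff hB).1 Z.2
    have ey1 : (fun ω => (Y : Lp ℂ 2 N.P) (N.T s ω)) =ᵐ[N.P]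
        fun ω => y (shiftPath s t (fullPath B ω)) :=
      ((N.quasi_T s).ae_eq_comp ey).trans (path_comp_T hB s t hy)
    have ey2 : (fun ω => (whiteOp hB hB' t Y : Lp ℂ 2 N'.P) (N'.T s ω)) =ᵐ[N'.P]
        fun ω => y (shiftPath s t (fullPath B' ω)) :=
      ((N'.quasi_T s).ae_eq_comp (whiteOp_coeFn hB hB' hy ey)).trans (path_comp_T hB' s t hy)
    have h1 : ∀ᵐ ω ∂N.P, z (restrictPath (s + t) (fullPath B ω)) =
        x (restrictPath s (fullPath B ω)) * y (shiftPath s t (fullPath B ω)) := by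
      filter_upwards [h, ex, ey1, ez] with ω a b c d
      have d' : (Z : Lp ℂ 2 N.P) ω = z (restrictPath (s + t) (fullPath B ω)) := d
      have b' : (X : Lp ℂ 2 N.P) ω = x (restrictPath s (fullPath B ω)) := b
      rw [← d', a, b', c]
    have h2 := (ae_fullPath_iff hB hB' (p := fun q => z (restrictPath (s + t) q) =
        x (restrictPath s q) * y (shiftPath s t q))
        (measurableSet_eq_fun (hz.comp (measurable_restrictPath _))
          ((hx.comp (measurable_restrictPath _)).mul (hy.comp (measurable_shiftPath _ _))))).1 h1
    change _ =ᵐ[N'.P] _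
    filter_upwards [h2, whiteOp_coeFn hB hB' hx ex, ey2, whiteOp_coeFn hB hB' hz ez] with ω a b c d
    rw [b, c, d]
    exact a
  measurable _ _ hX hY := (borelMap_whiteOp hB hB' hX).inner hY

end WhiteIso

end Noise

/-! ### Change of measure as a unitary operator -/

section Density

variable {Ω : Type*} {G G' : MeasurableSpace Ω} {m : MeasurableSpace Ω}

/-- On the sub-σ-field `G`, the measure `P'` has the density `D²` with respect to `P`. Functions
are measurable with respect to `G` modulo sets that are null for both `P` and `P'`. -/
structure HasSqDensity (P P' : Measure[m] Ω) (G : MeasurableSpace Ω) (D : Ω → ℝ) : Prop where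
  le : G ≤ m
  pos : ∀ ω, 0 < D ω
  aesm : AEStronglyMeasurable[G] D (P + P')
  density : ∀ A, MeasurableSet[G] A → P' A = ∫⁻ ω in A, ENNReal.ofReal (D ω ^ 2) ∂P

namespace HasSqDensity

variable {P P' : Measure[m] Ω} {D : Ω → ℝ}

theorem aesm_left {β : Type*} [TopologicalSpace β] {f : Ω → β}
    (hf : AEStronglyMeasurable[G] f (P + P')) : AEStronglyMeasurable[G] f P :=
  hf.mono_measure (Measure.le_add_right le_rfl)

theorem aesm_right {β : Type*} [TopologicalSpace β] {f : Ω → β}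
    (hf : AEStronglyMeasurable[G] f (P + P')) : AEStronglyMeasurable[G] f P' :=
  hf.mono_measure (Measure.le_add_left le_rfl)

theorem aemeasurable_sq (h : HasSqDensity P P' G D) :
    AEMeasurable (fun ω => ENNReal.ofReal (D ω ^ 2)) P :=
  (((aesm_left h.aesm).mono h.le).aemeasurable.pow_const 2).ennreal_ofReal

theorem measure_eq_zero_iff (h : HasSqDensity P P' G D) {A : Set Ω} (hA : MeasurableSet[G] A) :
    P' A = 0 ↔ P A = 0 := by
  rw [h.density A hA, setLIntegral_eq_zero_iff' (h.le A hA) h.aemeasurable_sq.restrict]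
  constructor
  · intro h0
    refine measure_mono_null (fun ω hω => ?_) h0
    have := h.pos ω
    simp only [mem_compl_iff, mem_ofPred_eq]
    intro hc
    have := hc hω
    simp at this
    nlinarith
  · intro h0
    refine ae_iff.2 (measure_mono_null (fun ω hω => ?_) h0)
    simp only [mem_ofPred_eq] at hω
    by_contra hn
    exact hω fun hω' => absurd hω' hn

theorem ae_eq_iff (h : HasSqDensity P P' G D) {f g : Ω → ℂ}
    (hf : AEStronglyMeasurable[G] f (P + P')) (hg : AEStronglyMeasurable[G] g (P + P')) :
    f =ᵐ[P'] g ↔ f =ᵐ[P] g := by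
  have e1 := ae_add_measure_iff.1 hf.ae_eq_mk
  have e2 := ae_add_measure_iff.1 hg.ae_eq_mk
  have hs : MeasurableSet[G] {ω | ¬ hf.mk f ω = hg.mk g ω} :=
    (measurableSet_eq_fun hf.stronglyMeasurable_mk.measurable
      hg.stronglyMeasurable_mk.measurable).compl
  have key : hf.mk f =ᵐ[P'] hg.mk g ↔ hf.mk f =ᵐ[P] hg.mk g := by
    simp only [Filter.EventuallyEq, ae_iff]
    exact h.measure_eq_zero_iff hs
  constructor
  · intro he
    exact EventuallyEq.trans e1.1
      ((key.1 (EventuallyEq.trans (.symm e1.2) (he.trans e2.2))).trans (.symm e2.1))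
  · intro he
    exact EventuallyEq.trans e1.2
      ((key.2 (EventuallyEq.trans (.symm e1.1) (he.trans e2.1))).trans (.symm e2.2))

theorem lintegral_eq (h : HasSqDensity P P' G D) {f : Ω → ℂ}
    (hf : AEStronglyMeasurable[G] f (P + P')) :
    ∫⁻ ω, ‖f ω‖ₑ ^ 2 ∂P' = ∫⁻ ω, ‖(D ω : ℂ) * f ω‖ₑ ^ 2 ∂P := by
  have e1 := ae_add_measure_iff.1 hf.ae_eq_mk
  have hm : Measurable[G] fun ω => ‖hf.mk f ω‖ₑ ^ 2 :=
    Measurable.comp (g := fun z : ℂ => ‖z‖ₑ ^ 2) (by fun_prop) hf.stronglyMeasurable_mk.measurable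
  have ht : P'.trim h.le = (P.withDensity fun ω => ENNReal.ofReal (D ω ^ 2)).trim h.le := by
    refine @Measure.ext _ G _ _ fun A hA => ?_
    rw [trim_measurableSet_eq h.le hA, trim_measurableSet_eq h.le hA,
      withDensity_apply _ (h.le A hA), h.density A hA]
  calc ∫⁻ ω, ‖f ω‖ₑ ^ 2 ∂P' = ∫⁻ ω, ‖hf.mk f ω‖ₑ ^ 2 ∂P' := by
        refine lintegral_congr_ae ?_
        filter_upwards [e1.2] with ω hω
        rw [hω]
    _ = ∫⁻ ω, ‖hf.mk f ω‖ₑ ^ 2 ∂(P.withDensity fun ω => ENNReal.ofReal (D ω ^ 2)) := by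
        rw [← lintegral_trim h.le hm, ht, lintegral_trim h.le hm]
    _ = ∫⁻ ω, ENNReal.ofReal (D ω ^ 2) * ‖hf.mk f ω‖ₑ ^ 2 ∂P := by
        rw [lintegral_withDensity_eq_lintegral_mul₀ h.aemeasurable_sq
          (hm.mono h.le le_rfl).aemeasurable]
        rfl
    _ = _ := by
        refine lintegral_congr_ae ?_
        filter_upwards [e1.1] with ω hω
        rw [enorm_mul, mul_pow, hω]
        congr 1
        rw [← ofReal_norm, Complex.norm_real, Real.norm_of_nonneg (h.pos ω).le,
          ENNReal.ofReal_pow (h.pos ω).le]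

theorem eLpNorm_eq (h : HasSqDensity P P' G D) {f : Ω → ℂ}
    (hf : AEStronglyMeasurable[G] f (P + P')) :
    eLpNorm f 2 P' = eLpNorm (fun ω => (D ω : ℂ) * f ω) 2 P := by
  have := h.lintegral_eq hf
  rw [eLpNorm_eq_lintegral_rpow_enorm_toReal two_ne_zero ENNReal.ofNat_ne_top,
    eLpNorm_eq_lintegral_rpow_enorm_toReal two_ne_zero ENNReal.ofNat_ne_top]
  simp only [ENNReal.toReal_ofNat, ENNReal.rpow_ofNat, this]

theorem aesm_mul (h : HasSqDensity P P' G D) {f : Ω → ℂ}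
    (hf : AEStronglyMeasurable[G] f (P + P')) :
    AEStronglyMeasurable[G] (fun ω => (D ω : ℂ) * f ω) (P + P') :=
  (Complex.continuous_ofReal.comp_aestronglyMeasurable h.aesm).mul hf

theorem memLp_mul (h : HasSqDensity P P' G D) {f : Ω → ℂ}
    (hf : AEStronglyMeasurable[G] f (P + P')) (hf2 : MemLp f 2 P') :
    MemLp (fun ω => (D ω : ℂ) * f ω) 2 P :=
  ⟨(aesm_left (h.aesm_mul hf)).mono h.le, by rw [← h.eLpNorm_eq hf]; exact hf2.2⟩

/-- A representative that is `G`-measurable, hence makes sense modulo `P` as well. -/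
theorem exists_rep (hG : G' = G) {f : Lp ℂ 2 P'}
    (hf : f ∈ lpMeas ℂ ℂ G' 2 P') :
    ∃ g : Ω → ℂ, StronglyMeasurable[G] g ∧ f =ᵐ[P'] g := by
  subst hG
  exact mem_lpMeas_iff_aestronglyMeasurable.1 hf

/-- The product of the density root with a representative of `f`. On `G`-measurable
representatives the two measures have the same null sets, so the choice is immaterial. -/
theorem exists_image (h : HasSqDensity P P' G D) (hG : G' = G)
    (f : lpMeas ℂ ℂ G' 2 P') : ∃ k : lpMeas ℂ ℂ G 2 P, ∀ g : Ω → ℂ,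
      AEStronglyMeasurable[G] g (P + P') → (f : Lp ℂ 2 P') =ᵐ[P'] g →
        (k : Lp ℂ 2 P) =ᵐ[P] fun ω => (D ω : ℂ) * g ω := by
  obtain ⟨g₀, hg₀', e₀⟩ := exists_rep hG f.2
  have hg₀ : AEStronglyMeasurable[G] g₀ (P + P') := hg₀'.aestronglyMeasurable
  have hm := h.memLp_mul hg₀ ((Lp.memLp (f : Lp ℂ 2 P')).ae_eq e₀)
  refine ⟨⟨hm.toLp _, mem_lpMeas_iff_aestronglyMeasurable.2
    ((aesm_left (h.aesm_mul hg₀)).congr hm.coeFn_toLp.symm)⟩, fun g hg e => ?_⟩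
  filter_upwards [hm.coeFn_toLp, (h.ae_eq_iff hg₀ hg).1 (e₀.symm.trans e)] with ω a b
  rw [a, b]

/-- Multiplication by the square root of the density, acting on representatives that are
`G`-measurable modulo null sets of both measures. -/
noncomputable def isometry (h : HasSqDensity P P' G D) (hG : G' = G) :
    lpMeas ℂ ℂ G' 2 P' →ₗᵢ[ℂ] lpMeas ℂ ℂ G 2 P where
  toFun := fun f => (h.exists_image hG f).choose
  map_add' := fun f f' => by
    obtain ⟨g, hg₁, e⟩ := exists_rep hG f.2
    have hg : AEStronglyMeasurable[G] g (P + P') := hg₁.aestronglyMeasurable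
    obtain ⟨g', hg₁', e'⟩ := exists_rep hG f'.2
    have hg' : AEStronglyMeasurable[G] g' (P + P') := hg₁'.aestronglyMeasurable
    refine Subtype.ext (Lp.ext ?_)
    have e1 : ((f + f' : lpMeas ℂ ℂ G' 2 P') : Lp ℂ 2 P') =ᵐ[P'] fun ω => g ω + g' ω := by
      filter_upwards [Lp.coeFn_add (f : Lp ℂ 2 P') f', e, e'] with ω a b c
      rw [Submodule.coe_add, a, Pi.add_apply, b, c]
    have := (h.exists_image hG (f + f')).choose_spec _ (hg.add hg') e1
    filter_upwards [this, (h.exists_image hG f).choose_spec _ hg e,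
      (h.exists_image hG f').choose_spec _ hg' e',
      Lp.coeFn_add ((h.exists_image hG f).choose : Lp ℂ 2 P) (h.exists_image hG f').choose]
      with ω a b c d
    rw [a, Submodule.coe_add, d, Pi.add_apply, Pi.add_apply, b, c, mul_add]
  map_smul' := fun k f => by
    obtain ⟨g, hg₁, e⟩ := exists_rep hG f.2
    have hg : AEStronglyMeasurable[G] g (P + P') := hg₁.aestronglyMeasurable
    refine Subtype.ext (Lp.ext ?_)
    have e1 : ((k • f : lpMeas ℂ ℂ G' 2 P') : Lp ℂ 2 P') =ᵐ[P'] fun ω => k * g ω := by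
      filter_upwards [Lp.coeFn_smul k (f : Lp ℂ 2 P'), e] with ω a b
      rw [Submodule.coe_smul, a, Pi.smul_apply, b, smul_eq_mul]
    have := (h.exists_image hG (k • f)).choose_spec _ (hg.const_mul k) e1
    filter_upwards [this, (h.exists_image hG f).choose_spec _ hg e,
      Lp.coeFn_smul k ((h.exists_image hG f).choose : Lp ℂ 2 P)] with ω a b d
    rw [a, RingHom.id_apply, Submodule.coe_smul, d, Pi.smul_apply, b, smul_eq_mul]
    ring
  norm_map' := fun f => by
    obtain ⟨g, hg₁, e⟩ := exists_rep hG f.2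
    have hg : AEStronglyMeasurable[G] g (P + P') := hg₁.aestronglyMeasurable
    have := (h.exists_image hG f).choose_spec _ hg e
    change ‖((h.exists_image hG f).choose : Lp ℂ 2 P)‖ = ‖(f : Lp ℂ 2 P')‖
    rw [Lp.norm_def, Lp.norm_def, eLpNorm_congr_ae this, eLpNorm_congr_ae e, h.eLpNorm_eq hg]

theorem isometry_coeFn (h : HasSqDensity P P' G D) (hG : G' = G)
    (f : lpMeas ℂ ℂ G' 2 P') {g : Ω → ℂ} (hg : AEStronglyMeasurable[G] g (P + P'))
    (e : (f : Lp ℂ 2 P') =ᵐ[P'] g) :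
    (h.isometry hG f : Lp ℂ 2 P) =ᵐ[P] fun ω => (D ω : ℂ) * g ω :=
  (h.exists_image hG f).choose_spec g hg e

theorem isometry_surjective (h : HasSqDensity P P' G D) (hG : G' = G) :
    Function.Surjective (h.isometry hG) := by
  intro k
  obtain ⟨k₀, hk₀, ek⟩ := mem_lpMeas_iff_aestronglyMeasurable.1 k.2
  have hD0 : ∀ ω, (D ω : ℂ) ≠ 0 := fun ω => Complex.ofReal_ne_zero.2 (h.pos ω).ne'
  have hg : AEStronglyMeasurable[G] (fun ω => (D ω : ℂ)⁻¹ * k₀ ω) (P + P') :=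
    (Complex.continuous_ofReal.comp_aestronglyMeasurable h.aesm).inv₀.mul
      hk₀.aestronglyMeasurable
  have e : ∀ ω, (D ω : ℂ) * ((D ω : ℂ)⁻¹ * k₀ ω) = k₀ ω := fun ω =>
    mul_inv_cancel_left₀ (hD0 ω) _
  have hm : MemLp (fun ω => (D ω : ℂ)⁻¹ * k₀ ω) 2 P' := by
    refine ⟨(aesm_right hg).mono h.le, ?_⟩
    rw [h.eLpNorm_eq hg]
    simp only [e]
    exact ((Lp.memLp (k : Lp ℂ 2 P)).ae_eq ek).2
  have hmem : hm.toLp _ ∈ lpMeas ℂ ℂ G' 2 P' := by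
    rw [hG]
    exact mem_lpMeas_iff_aestronglyMeasurable.2 ((aesm_right hg).congr hm.coeFn_toLp.symm)
  refine ⟨⟨hm.toLp _, hmem⟩, Subtype.ext (Lp.ext ?_)⟩
  refine (h.isometry_coeFn hG ⟨hm.toLp _, hmem⟩ hg hm.coeFn_toLp).trans ?_
  simp only [e]
  exact ek.symm

/-- Multiplication by the square root of the density, as a unitary operator. -/
noncomputable def iso (h : HasSqDensity P P' G D) (hG : G' = G) :
    lpMeas ℂ ℂ G' 2 P' ≃ₗᵢ[ℂ] lpMeas ℂ ℂ G 2 P :=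
  LinearIsometryEquiv.ofSurjective (h.isometry hG) (h.isometry_surjective hG)

theorem iso_coeFn (h : HasSqDensity P P' G D) (hG : G' = G)
    (f : lpMeas ℂ ℂ G' 2 P') {g : Ω → ℂ} (hg : AEStronglyMeasurable[G] g (P + P'))
    (e : (f : Lp ℂ 2 P') =ᵐ[P'] g) : (h.iso hG f : Lp ℂ 2 P) =ᵐ[P] fun ω => (D ω : ℂ) * g ω :=
  h.isometry_coeFn hG f hg e

end HasSqDensity

end Density

namespace Noise

/-! ### Drift -/

/-- The square root of the density of the drifted measure with drift `2 * lam` on `F 0 t`. -/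
noncomputable def driftDensity {Ω : Type*} (B : ℝ → Ω → ℝ) (lam t : ℝ) (ω : Ω) : ℝ :=
  Real.exp (lam * B t ω - lam ^ 2 * t)

namespace IsDriftOf

variable {Ω : Type*} [m : MeasurableSpace Ω] [StandardBorelSpace Ω] {N N' : Noise Ω}
  {B : ℝ → Ω → ℝ} {lam : ℝ}

theorem aesm {c : ℝ} (hd : N'.IsDriftOf N B c) {s t : ℝ} (hs : 0 ≤ s) (hst : s ≤ t) :
    AEStronglyMeasurable[N.F 0 t] (B s) (N.P + N'.P) := by
  rcases hs.eq_or_lt with rfl | hs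
  · exact aestronglyMeasurable_const.congr (f := fun _ => 0)
      (by filter_upwards [hd.zero] with ω h; exact h.symm)
  · have h1 : AEStronglyMeasurable[N.F 0 s] (B s) (N.P + N'.P) := by
      refine (hd.adapted 0 s hs).congr ?_
      filter_upwards [hd.zero] with ω h0
      rw [h0, sub_zero]
    rcases hst.eq_or_lt with rfl | hst
    · exact h1
    · exact h1.of_le_nullExtension (le_sup_left.trans (hd.sup_eq 0 s t hs hst).le_nullExtension)

theorem hasSqDensity (hd : N'.IsDriftOf N B (2 * lam)) (t : PosTime) :
    HasSqDensity N.P N'.P (N.F 0 t) (driftDensity B lam t) where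
  le := N.F_le 0 t t.2
  pos _ := Real.exp_pos _
  aesm := by
    have hc : Continuous fun x : ℝ => Real.exp (lam * x - lam ^ 2 * t) := by fun_prop
    exact hc.comp_aestronglyMeasurable (hd.aesm t.2.le le_rfl)
  density A hA := by
    rw [hd.density t t.2 A hA]
    refine lintegral_congr fun ω => ?_
    rw [driftDensity, ← Real.exp_nat_mul]
    congr 2
    push_cast
    ring

theorem F_eq_apply {c : ℝ} (hd : N'.IsDriftOf N B c) (s t : ℝ) : N'.F s t = N.F s t := by
  rw [hd.F_eq]

/-- Multiplication by the square root of the density maps `H'_t` onto `H_t`. -/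
noncomputable def op (hd : N'.IsDriftOf N B (2 * lam)) (t : PosTime) : N'.H t ≃ₗᵢ[ℂ] N.H t :=
  (hd.hasSqDensity t).iso (hd.F_eq_apply 0 t)

theorem op_coeFn (hd : N'.IsDriftOf N B (2 * lam)) {t : PosTime} (f : N'.H t) {g : Ω → ℂ}
    (hg : AEStronglyMeasurable[N.F 0 t] g (N.P + N'.P)) (e : (f : Lp ℂ 2 N'.P) =ᵐ[N'.P] g) :
    (hd.op t f : Lp ℂ 2 N.P) =ᵐ[N.P] fun ω => (driftDensity B lam t ω : ℂ) * g ω :=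
  (hd.hasSqDensity t).iso_coeFn (hd.F_eq_apply 0 t) f hg e

theorem exists_rep {c : ℝ} (hd : N'.IsDriftOf N B c) {t : PosTime} (f : N'.H t) :
    ∃ g : Ω → ℂ, StronglyMeasurable[N.F 0 t] g ∧ (f : Lp ℂ 2 N'.P) =ᵐ[N'.P] g :=
  HasSqDensity.exists_rep (hd.F_eq_apply 0 t) f.2

theorem le_nullExtension {c : ℝ} (hd : N'.IsDriftOf N B c) {s t : ℝ} (hs : 0 < s)
    (hst : s ≤ t) : N.F 0 s ≤ nullExtension (N.F 0 t) (N.P + N'.P) := by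
  rcases hst.eq_or_lt with rfl | hst
  · exact le_eventuallyMeasurableSpace
  · exact le_sup_left.trans (hd.sup_eq 0 s t hs hst).le_nullExtension

/-- The density roots form a multiplicative cocycle, by stationarity of the increments of `B`. -/
theorem op_mul (hd : N'.IsDriftOf N B (2 * lam)) (hB : N.IsAdaptedBM B) (s t : PosTime)
    (X : N'.H s) (Y : N'.H t) (Z : N'.H (s + t)) (h : N'.IsProd s X Y Z) :
    N.IsProd s (hd.op s X) (hd.op t Y) (hd.op (s + t) Z) := by
  obtain ⟨x, hx, ex⟩ := hd.exists_rep X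
  obtain ⟨y, hy, ey⟩ := hd.exists_rep Y
  obtain ⟨z, hz, ez⟩ := hd.exists_rep Z
  have hlt : (s : ℝ) < (s + t : PosTime) := lt_add_posTime s t
  have hyT : AEStronglyMeasurable[N.F 0 (s + t : PosTime)] (fun ω => y (N.T s ω))
      (N.P + N'.P) := by
    have h1 : AEStronglyMeasurable[(N.F 0 t).comap (N.T s)] (fun ω => y (N.T s ω))
        (N.P + N'.P) := (hy.comp_measurable (comap_measurable _)).aestronglyMeasurable
    have h2 := h1.of_le_nullExtension (hd.shift 0 t s t.2).le_nullExtension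
    rw [zero_add, add_comm (t : ℝ)] at h2
    exact h2.of_le_nullExtension
      (le_sup_right.trans (hd.sup_eq 0 s (s + t : PosTime) s.2 hlt).le_nullExtension)
  have hxF : AEStronglyMeasurable[N.F 0 (s + t : PosTime)] x (N.P + N'.P) :=
    (hx.aestronglyMeasurable (μ := N.P + N'.P)).of_le_nullExtension
      (hd.le_nullExtension s.2 hlt.le)
  have hzP' : z =ᵐ[N'.P] fun ω => x ω * y (N.T s ω) := by
    have q : Measure.QuasiMeasurePreserving (N.T s) N'.P N'.P := hd.T_eq ▸ N'.quasi_T s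
    filter_upwards [h, ex, ez, q.ae_eq_comp ey] with ω a b c d
    have d' : (Y : Lp ℂ 2 N'.P) (N.T s ω) = y (N.T s ω) := d
    rw [← c, a, b, hd.T_eq, d']
  have hzP : z =ᵐ[N.P] fun ω => x ω * y (N.T s ω) :=
    ((hd.hasSqDensity (s + t)).ae_eq_iff hz.aestronglyMeasurable (hxF.mul hyT)).1 hzP'
  change _ =ᵐ[N.P] _
  filter_upwards [hd.op_coeFn X hx.aestronglyMeasurable ex,
    (N.quasi_T s).ae_eq_comp (hd.op_coeFn Y hy.aestronglyMeasurable ey),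
    hd.op_coeFn Z hz.aestronglyMeasurable ez, hzP, hB.comp_T t.2.le s] with ω a b c d e
  have b' : (hd.op t Y : Lp ℂ 2 N.P) (N.T s ω) =
      (driftDensity B lam t (N.T s ω) : ℂ) * y (N.T s ω) := b
  have e' : driftDensity B lam (s + t : PosTime) ω =
      driftDensity B lam s ω * driftDensity B lam t (N.T s ω) := by
    rw [driftDensity, driftDensity, driftDensity, ← Real.exp_add, e]
    congr 1
    rw [Positive.coe_add, add_comm (t : ℝ)]
    ring
  rw [a, b', c, d, e']
  push_cast
  ring

/-- For `t ≤ τ`, the operator at time `t` is the operator at time `τ` followed by multiplication by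
`exp (lam (B_t - B_τ) - lam² (t - τ))`, and the latter preserves Borel families. -/
theorem borelMap_op (hd : N'.IsDriftOf N B (2 * lam)) (hB : N.IsAdaptedBM B)
    {Y : ∀ t, N'.H t} (hY : N'.BorelMap fun t => (Y t : Lp ℂ 2 N'.P)) :
    N.BorelMap fun t => (hd.op t (Y t) : Lp ℂ 2 N.P) := by
  classical
  let _ : MeasurableSpace (Lp ℂ 2 N.P) := borel _
  have : BorelSpace (Lp ℂ 2 N.P) := ⟨rfl⟩
  let _ : MeasurableSpace (Lp ℂ 2 N'.P) := borel _
  have : BorelSpace (Lp ℂ 2 N'.P) := ⟨rfl⟩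
  let τ : ℕ → PosTime := fun n => ⟨n + 1, by positivity⟩
  let L : ℕ → Lp ℂ 2 N'.P → Lp ℂ 2 N.P := fun n y =>
    (hd.op (τ n) ((N'.H (τ n)).orthogonalProjectionOnto y) : Lp ℂ 2 N.P)
  have hL : ∀ n, Continuous (L n) := fun n =>
    continuous_subtype_val.comp ((hd.op (τ n)).continuous.comp (ContinuousLinearMap.continuous _))
  have hset : ∀ n, MeasurableSet {t : PosTime | t ≤ τ n} := fun n =>
    (measurableSet_le (measurable_subtype_coe : Measurable fun t : PosTime => (t : ℝ))
      measurable_const : MeasurableSet {t : PosTime | (t : ℝ) ≤ τ n})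
  let f : ℕ → PosTime → Lp ℂ 2 N.P := fun n t =>
    if t ≤ τ n then (Real.exp (-(lam ^ 2 * (t - τ n))) : ℂ) • L n (Y t) else 0
  have hf : ∀ n, N.BorelMap (f n) := by
    intro n
    have hs : Measurable fun t : PosTime => ((Real.exp (-(lam ^ 2 * (t - τ n))) : ℝ) : ℂ) := by
      fun_prop
    have hc : Measurable fun t => L n (Y t : Lp ℂ 2 N'.P) :=
      (hL n).measurable.comp (f := fun t => (Y t : Lp ℂ 2 N'.P)) hY
    exact Measurable.ite (hset n) (hs.smul hc) measurable_const
  let g : ℕ → PosTime → Lp ℂ 2 N.P := fun n t =>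
    if t ≤ τ n then (hd.op t (Y t) : Lp ℂ 2 N.P) else 0
  have hg : ∀ n, N.BorelMap (g n) := by
    intro n
    refine BorelMap.mul (Z := fun t => hB.lp t - hB.lp (τ n))
      ((hB.continuous_lp.comp continuous_subtype_val).sub continuous_const)
      (φ := fun x => Complex.exp (lam * x)) (by fun_prop) (hf n) fun t => ?_
    by_cases ht : t ≤ τ n
    · simp only [f, g, if_pos ht]
      obtain ⟨y, hy, ey⟩ := hd.exists_rep (Y t)
      have hy' : AEStronglyMeasurable[N.F 0 (τ n)] y (N.P + N'.P) :=
        (hy.aestronglyMeasurable (μ := N.P + N'.P)).of_le_nullExtension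
          (hd.le_nullExtension t.2 ht)
      have hp : (N'.H (τ n)).orthogonalProjectionOnto (Y t : Lp ℂ 2 N'.P) =
          ⟨Y t, N'.monotone_H ht (Y t).2⟩ :=
        (N'.H (τ n)).orthogonalProjectionOnto_mem_subspace_eq_self
          ⟨Y t, N'.monotone_H ht (Y t).2⟩
      have h1 := hd.op_coeFn ⟨Y t, N'.monotone_H ht (Y t).2⟩ hy' ey
      rw [← hp] at h1
      filter_upwards [h1, hd.op_coeFn (Y t) hy.aestronglyMeasurable ey,
        Lp.coeFn_smul (Real.exp (-(lam ^ 2 * (t - τ n))) : ℂ) (L n (Y t)),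
        Lp.coeFn_sub (hB.lp t) (hB.lp (τ n)), hB.lp_coeFn t, hB.lp_coeFn (τ n)] with ω a b c d e e'
      rw [b, c, Pi.smul_apply, d, Pi.sub_apply, e, e', smul_eq_mul]
      change _ = _ * (_ * (hd.op (τ n) _ : Lp ℂ 2 N.P) ω)
      rw [a, ← mul_assoc, ← mul_assoc]
      congr 1
      simp only [driftDensity, Complex.ofReal_exp, ← Complex.exp_add]
      congr 1
      push_cast
      ring
    · simp only [f, g, if_neg ht]
      filter_upwards [Lp.coeFn_zero ℂ 2 N.P] with ω a
      rw [a]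
      simp
  refine measurable_of_tendsto_metrizable hg (tendsto_pi_nhds.2 fun t => ?_)
  refine tendsto_const_nhds.congr' ?_
  filter_upwards [eventually_ge_atTop (Nat.ceil (t : ℝ))] with n hn
  have ht : t ≤ τ n := by
    have h1 : (t : ℝ) ≤ n := Nat.ceil_le.1 hn
    change (t : ℝ) ≤ n + 1
    linarith
  simp only [g, if_pos ht]

/-- Multiplication by the square roots of the densities is an isomorphism of the systems of the
drifted and the original noise. -/
noncomputable def iso (hd : N'.IsDriftOf N B (2 * lam)) (hB : N.IsAdaptedBM B) :
    SystemIso N' N'.H N N.H where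
  op := hd.op
  map_mul := hd.op_mul hB
  measurable _ _ hX hY := (hd.borelMap_op hB hX).inner hY

end IsDriftOf

namespace IsDriftOf

variable {Ω : Type*} [m : MeasurableSpace Ω] [StandardBorelSpace Ω] {N N' : Noise Ω}
  {B : ℝ → Ω → ℝ} {lam : ℝ}

/-- The characteristic function of `B_u - 2 lam u` under the drifted measure, computed as an inner
product that the unitary operator of multiplication by the density root preserves. -/
theorem integral_exp_subDrift (hd : N'.IsDriftOf N B (2 * lam)) (hB : N.IsAdaptedBM B)
    {u : ℝ} (hu : 0 < u) (y : ℝ) :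
    ∫ ω, Complex.exp (Complex.I * y * (B u ω - 2 * lam * u : ℝ)) ∂N'.P =
      Complex.exp (-(y : ℂ) ^ 2 / 2 * u) := by
  let t : PosTime := ⟨u, hu⟩
  have hc : Continuous fun x : ℝ => Complex.exp (Complex.I * y * (x - 2 * lam * u : ℝ)) := by
    fun_prop
  have ha : AEStronglyMeasurable[N.F 0 t]
      (fun ω => Complex.exp (Complex.I * y * (B u ω - 2 * lam * u : ℝ))) (N.P + N'.P) :=
    hc.comp_aestronglyMeasurable (hd.aesm hu.le le_rfl)
  have hm : MemLp (fun ω => Complex.exp (Complex.I * y * (B u ω - 2 * lam * u : ℝ))) 2 N'.P := by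
    refine MemLp.of_bound ((HasSqDensity.aesm_right ha).mono (N.F_le 0 t t.2)) 1
      (ae_of_all _ fun ω => ?_)
    rw [Complex.norm_exp]
    simp
  let f : N'.H t := ⟨hm.toLp _, mem_H_congr hm.coeFn_toLp
    (by rw [hd.F_eq]; exact HasSqDensity.aesm_right ha)⟩
  let e : N'.H t := ⟨N'.one, mem_H_congr N'.one_coeFn aestronglyMeasurable_const⟩
  have h1 := (hd.op t).inner_map_map e f
  change inner ℂ (hd.op t e : Lp ℂ 2 N.P) (hd.op t f : Lp ℂ 2 N.P) =
    inner ℂ N'.one (hm.toLp _) at h1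
  rw [inner_one, integral_congr_ae hm.coeFn_toLp] at h1
  rw [← h1, L2.inner_def]
  have h2 : ∀ᵐ ω ∂N.P, inner ℂ ((hd.op t e : Lp ℂ 2 N.P) ω) ((hd.op t f : Lp ℂ 2 N.P) ω) =
      Complex.exp (-(2 * lam ^ 2 * u + 2 * Complex.I * y * lam * u)) *
        Complex.exp ((2 * lam + Complex.I * y) * B u ω) := by
    filter_upwards [hd.op_coeFn e (g := fun _ => 1) aestronglyMeasurable_const N'.one_coeFn,
      hd.op_coeFn f ha hm.coeFn_toLp] with ω a b
    rw [a, b, driftDensity, RCLike.inner_apply, mul_one, Complex.conj_ofReal, Complex.ofReal_exp,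
      mul_right_comm, ← Complex.exp_add, ← Complex.exp_add, ← Complex.exp_add]
    congr 1
    push_cast
    ring
  rw [integral_congr_ae h2, integral_const_mul, hB.integral_exp hu, ← Complex.exp_add]
  congr 1
  rw [add_sq, mul_pow, mul_pow, Complex.I_sq]
  ring

/-- With its drift subtracted, `B` is a Brownian motion under the drifted measure. -/
theorem isAdaptedBM (hd : N'.IsDriftOf N B (2 * lam)) (hB : N.IsAdaptedBM B) :
    N'.IsAdaptedBM (subDrift B (2 * lam)) where
  measurable t := (hB.measurable t).sub_const _
  adapted s t hst := by
    rw [hd.F_eq]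
    have h := (HasSqDensity.aesm_right (hd.adapted s t hst)).sub
      (aestronglyMeasurable_const (b := 2 * lam * (t - s)))
    refine h.congr (ae_of_all _ fun ω => ?_)
    simp only [subDrift, Pi.sub_apply]
    ring
  law s t hst := by
    have hu : 0 < t - s := by linarith
    have hm1 : Measurable fun ω => B (t - s) ω - 2 * lam * (t - s) :=
      (hB.measurable _).sub_const _
    have h1 : N'.P.map (fun ω => B (t - s) ω - 2 * lam * (t - s)) =
        gaussianReal 0 (t - s).toNNReal := by
      have := Measure.isProbabilityMeasure_map (μ := N'.P) hm1.aemeasurable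
      refine Measure.ext_of_charFun (funext fun y => ?_)
      rw [charFun_gaussianReal, charFun_apply_real, integral_map hm1.aemeasurable
        (Measurable.aestronglyMeasurable (by fun_prop)), Real.coe_toNNReal _ hu.le]
      have := hd.integral_exp_subDrift hB hu y
      convert this using 1
      · congr 1
        funext ω
        congr 1
        ring
      · congr 1
        push_cast
        ring
    rw [← h1]
    have h2 : N'.P.map (N.T s) = N'.P := by
      have := (N'.T_preserving s).map_eq
      rwa [hd.T_eq] at this
    have hT : Measurable (N.T s) := (N.T_preserving s).measurable
    conv_rhs => rw [← h2]
    rw [Measure.map_map hm1 hT]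
    refine Measure.map_congr ?_
    have h0 : ∀ᵐ ω ∂N'.P, B 0 (N.T s ω) = 0 := by
      have q : Measure.QuasiMeasurePreserving (N.T s) N'.P N'.P := hd.T_eq ▸ N'.quasi_T s
      exact q.ae (ae_add_measure_iff.1 hd.zero).2
    filter_upwards [(ae_add_measure_iff.1 (hd.stationary 0 (t - s) s hu)).2, h0] with ω a b
    rw [b, sub_zero, zero_add, sub_add_cancel] at a
    simp only [subDrift, Function.comp, a]
    ring
  zero := by
    filter_upwards [(ae_add_measure_iff.1 hd.zero).2] with ω h
    simp [subDrift, h]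
  stationary s t h hst := by
    rw [hd.T_eq]
    filter_upwards [(ae_add_measure_iff.1 (hd.stationary s t h hst)).2] with ω a
    simp only [subDrift]
    linarith

theorem aesm_path (hd : N'.IsDriftOf N B (2 * lam)) {t : PosTime}
    {X : (Icc (0 : ℝ) t → ℝ) → ℂ} (hX : Measurable X) :
    AEStronglyMeasurable[N.F 0 t] (fun ω => X (path (subDrift B (2 * lam)) t ω))
      (N.P + N'.P) :=
  aesm_comp_path (Z := path (subDrift B (2 * lam)) t)
    (fun i => (hd.aesm i.2.1 i.2.2).sub aestronglyMeasurable_const) hX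

theorem op_path (hd : N'.IsDriftOf N B (2 * lam)) {t : PosTime} (f : N'.H t)
    {X : (Icc (0 : ℝ) t → ℝ) → ℂ} (hX : Measurable X)
    (e : (f : Lp ℂ 2 N'.P) =ᵐ[N'.P] fun ω => X (path (subDrift B (2 * lam)) t ω)) :
    (hd.op t f : Lp ℂ 2 N.P) =ᵐ[N.P] fun ω =>
      (Real.exp (lam * B t ω - lam ^ 2 * t) : ℂ) * X (fun s => path B t ω s - 2 * lam * s) :=
  hd.op_coeFn f (hd.aesm_path hX) e

/-- The density root is a functional of `B`, and invertible. -/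
theorem op_mem_Hwhite_iff (hd : N'.IsDriftOf N B (2 * lam)) (hB : N.IsAdaptedBM B) (t : PosTime)
    (f : N'.H t) : (f : Lp ℂ 2 N'.P) ∈ N'.Hwhite (subDrift B (2 * lam)) t ↔
      (hd.op t f : Lp ℂ 2 N.P) ∈ N.Hwhite B t := by
  rw [mem_Hwhite_iff (hd.isAdaptedBM hB), mem_Hwhite_iff hB]
  let T : Icc (0 : ℝ) t := ⟨t, t.2.le, le_rfl⟩
  constructor
  · rintro ⟨X, hX, e⟩
    refine ⟨fun p => (Real.exp (lam * p T - lam ^ 2 * t) : ℂ) *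
      X (fun s => p s - 2 * lam * s), ?_, hd.op_path f hX e⟩
    refine Measurable.mul (by fun_prop) (hX.comp ?_)
    exact measurable_pi_iff.2 fun s => (measurable_pi_apply s).sub_const _
  · rintro ⟨Y, hY, e⟩
    have hX : Measurable fun p : Icc (0 : ℝ) t → ℝ =>
        (Real.exp (-(lam * (p T + 2 * lam * t) - lam ^ 2 * t)) : ℂ) *
          Y (fun s => p s + 2 * lam * s) := by
      refine Measurable.mul (by fun_prop) (hY.comp ?_)
      exact measurable_pi_iff.2 fun s => (measurable_pi_apply s).add_const _
    refine ⟨_, hX, ?_⟩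
    obtain ⟨g, hg, eg⟩ := hd.exists_rep f
    refine eg.trans (((hd.hasSqDensity t).ae_eq_iff hg.aestronglyMeasurable (hd.aesm_path hX)).2 ?_)
    filter_upwards [hd.op_coeFn f hg.aestronglyMeasurable eg, e] with ω a b
    rw [b] at a
    have h1 : (fun s : Icc (0 : ℝ) t => path (subDrift B (2 * lam)) t ω s + 2 * lam * s) =
        path B t ω := by
      funext s
      simp [path, subDrift]
    have h2 : path (subDrift B (2 * lam)) t ω T + 2 * lam * t = B t ω := congrFun h1 T
    rw [h1, h2, a, driftDensity, ← mul_assoc, ← Complex.ofReal_mul, ← Real.exp_add]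
    simp

/-- The real shift: the natural isomorphism of the white noise parts of the original and the
drifted noise, followed by multiplication by the square roots of the densities. -/
noncomputable def realShift (hd : N'.IsDriftOf N B (2 * lam)) (hB : N.IsAdaptedBM B) :
    N.WhiteAut B :=
  have : ∀ t, (N'.Hwhite (subDrift B (2 * lam)) t).HasOrthogonalProjection := fun t =>
    hasOrthogonalProjection_lpMeas N'.P (whiteField_le (hd.isAdaptedBM hB) 0 t)
  (whiteIso hB (hd.isAdaptedBM hB)).trans
    ((hd.iso hB).restrict (Hwhite_le (hd.isAdaptedBM hB)) (Hwhite_le hB)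
      (hd.op_mem_Hwhite_iff hB)) monotone_Hwhite

theorem isRealShift (hd : N'.IsDriftOf N B (2 * lam)) (hB : N.IsAdaptedBM B) :
    N.IsRealShift B lam (hd.realShift hB) := fun t _ ψ hX e =>
  hd.op_path ⟨whiteOp hB (hd.isAdaptedBM hB) t ψ, _⟩ hX
    (whiteOp_coeFn hB (hd.isAdaptedBM hB) hX e)

end IsDriftOf

/-! ### The units of the white noise part -/

section PhaseMem

variable {Ω : Type*} {G : MeasurableSpace Ω} {m : MeasurableSpace Ω} {μ : Measure[m] Ω}

theorem mulPhase_mem {f : Ω → ℝ} (hf : Measurable f)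
    (hfG : AEStronglyMeasurable[G] f μ) {X : Lp ℂ 2 μ} (hX : X ∈ lpMeas ℂ ℂ G 2 μ) :
    mulPhase μ hf X ∈ lpMeas ℂ ℂ G 2 μ := by
  rw [mem_lpMeas_iff_aestronglyMeasurable] at hX ⊢
  have hc : Continuous fun x : ℝ => Complex.exp (Complex.I * x) := by fun_prop
  exact ((hc.comp_aestronglyMeasurable hfG).mul hX).congr (mulPhase_coeFn μ hf X).symm

theorem aesm_phase {f : Ω → ℝ} (h : AEStronglyMeasurable[G] f μ)
    (lam c : ℝ) : AEStronglyMeasurable[G] (fun ω => lam * f ω + c) μ :=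
  have hc : Continuous fun x : ℝ => lam * x + c := by fun_prop
  hc.comp_aestronglyMeasurable h

end PhaseMem

/-- A complex exponential function on `(0,∞)` determines its exponent. -/
theorem eq_of_exp_mul_eq {α β : ℂ}
    (h : ∀ t : PosTime, Complex.exp (α * (t : ℝ)) = Complex.exp (β * (t : ℝ))) : α = β := by
  have hp : 0 < 1 / (1 + ‖α - β‖) := by positivity
  have h1 := h ⟨_, hp⟩
  rw [Complex.exp_eq_exp_iff_exists_int] at h1
  obtain ⟨n, hn⟩ := h1
  rw [← sub_eq_iff_eq_add', ← sub_mul] at hn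
  have h2 := congrArg norm hn
  simp only [norm_mul, Complex.norm_real, Complex.norm_I, Complex.norm_intCast, mul_one,
    Real.norm_of_nonneg hp.le, Real.norm_of_nonneg Real.pi_pos.le, RCLike.norm_ofNat] at h2
  have h3 : ‖α - β‖ * (1 / (1 + ‖α - β‖)) < 1 := by
    rw [mul_one_div, div_lt_one (by positivity)]
    linarith
  rw [h2] at h3
  have h4 : |(n : ℝ)| < 1 := by nlinarith [Real.pi_gt_three, abs_nonneg (n : ℝ)]
  have h5 : n = 0 := Int.abs_lt_one_iff.1 (by exact_mod_cast h4)
  rw [h5, Int.cast_zero, zero_mul] at hn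
  have h6 : ((1 / (1 + ‖α - β‖) : ℝ) : ℂ) ≠ 0 := Complex.ofReal_ne_zero.2 hp.ne'
  exact sub_eq_zero.1 ((mul_eq_zero.1 hn).resolve_right h6)

theorem exists_isProd_H {Ω : Type*} [MeasurableSpace Ω] [StandardBorelSpace Ω] (N : Noise Ω)
    (s t : PosTime) (X : N.H s) (Y : N.H t) : ∃ Z : N.H (s + t), N.IsProd s X Y Z := by
  obtain ⟨Z, hZ, h⟩ := exists_isProd X.2 Y.2
  exact ⟨⟨Z, hZ⟩, h⟩

theorem stdUnit_add_I_mul {Ω : Type*} (B : ℝ → Ω → ℝ) (z : ℂ) (lam : ℝ) (t : PosTime) (ω : Ω) :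
    Complex.exp (Complex.I * lam * B t ω) * stdUnit B z t ω =
      stdUnit B (Complex.I * lam + z) t ω := by
  rw [stdUnit, stdUnit, ← Complex.exp_add]
  congr 1
  simp
  ring

section Units

variable {Ω : Type*} [m : MeasurableSpace Ω] [StandardBorelSpace Ω] {N : Noise Ω}
  {B : ℝ → Ω → ℝ}

namespace IsAdaptedBM

theorem memLp_stdUnit (hB : N.IsAdaptedBM B) (z : ℂ) (t : PosTime) :
    MemLp (stdUnit B z t) 2 N.P := by
  convert (hB.memLp_exp t.2 z).mul_const (Complex.exp (-((z.re : ℂ) ^ 2 * (t : ℝ)))) using 1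
  funext ω
  rw [stdUnit, sub_eq_add_neg, Complex.exp_add]

/-- The normalized unit `exp (z B_t - (Re z)² t)` as an element of `L₂`. -/
noncomputable def unit (hB : N.IsAdaptedBM B) (z : ℂ) (t : PosTime) : Lp ℂ 2 N.P :=
  (hB.memLp_stdUnit z t).toLp _

theorem unit_coeFn (hB : N.IsAdaptedBM B) (z : ℂ) (t : PosTime) :
    hB.unit z t =ᵐ[N.P] stdUnit B z t := (hB.memLp_stdUnit z t).coeFn_toLp

theorem unit_mem_Hwhite (hB : N.IsAdaptedBM B) (z : ℂ) (t : PosTime) :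
    hB.unit z t ∈ N.Hwhite B t :=
  (mem_Hwhite_iff hB).2 ⟨fun p => Complex.exp (z * p ⟨t, t.2.le, le_rfl⟩ -
    (z.re : ℂ) ^ 2 * (t : ℝ)), by fun_prop, hB.unit_coeFn z t⟩

theorem unit_mem_H (hB : N.IsAdaptedBM B) (z : ℂ) (t : PosTime) : hB.unit z t ∈ N.H t :=
  Hwhite_le hB t (hB.unit_mem_Hwhite z t)

theorem isProd_unit (hB : N.IsAdaptedBM B) (z : ℂ) (s t : PosTime) :
    N.IsProd s (hB.unit z s) (hB.unit z t) (hB.unit z (s + t)) := by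
  change _ =ᵐ[N.P] _
  filter_upwards [hB.unit_coeFn z s, hB.unit_coeFn z (s + t),
    (N.quasi_T s).ae_eq_comp (hB.unit_coeFn z t), hB.comp_T t.2.le s] with ω a b c d
  have c' : hB.unit z t (N.T s ω) = stdUnit B z t (N.T s ω) := c
  rw [a, b, c', stdUnit, stdUnit, stdUnit, d, ← Complex.exp_add, Positive.coe_add,
    add_comm (t : ℝ)]
  congr 1
  push_cast
  ring

theorem inner_unit (hB : N.IsAdaptedBM B) (z w : ℂ) (t : PosTime) :
    inner ℂ (hB.unit z t) (hB.unit w t) =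
      Complex.exp (((starRingEnd ℂ z + w) ^ 2 / 2 - (z.re : ℂ) ^ 2 - (w.re : ℂ) ^ 2) *
        (t : ℝ)) := by
  rw [L2.inner_def]
  have h : ∀ᵐ ω ∂N.P, inner ℂ (hB.unit z t ω) (hB.unit w t ω) =
      Complex.exp (-((z.re : ℂ) ^ 2 + (w.re : ℂ) ^ 2) * (t : ℝ)) *
        Complex.exp ((starRingEnd ℂ z + w) * B t ω) := by
    filter_upwards [hB.unit_coeFn z t, hB.unit_coeFn w t] with ω a b
    rw [a, b, stdUnit, stdUnit, RCLike.inner_apply, ← Complex.exp_conj, ← Complex.exp_add,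
      ← Complex.exp_add]
    congr 1
    simp only [map_sub, map_mul, map_pow, Complex.conj_ofReal]
    ring
  rw [integral_congr_ae h, integral_const_mul, hB.integral_exp t.2, ← Complex.exp_add]
  congr 1
  ring

theorem norm_unit (hB : N.IsAdaptedBM B) (z : ℂ) (t : PosTime) : ‖hB.unit z t‖ = 1 := by
  have h := hB.inner_unit z z t
  rw [inner_self_eq_norm_sq_to_K] at h
  have h1 : (starRingEnd ℂ z + z) ^ 2 / 2 - (z.re : ℂ) ^ 2 - (z.re : ℂ) ^ 2 = 0 := by
    rw [add_comm, Complex.add_conj]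
    push_cast
    ring
  rw [h1, zero_mul, Complex.exp_zero] at h
  have h2 : ‖hB.unit z t‖ ^ 2 = 1 := Complex.ofReal_injective (by simpa using h)
  exact (pow_eq_one_iff_of_nonneg (norm_nonneg _) two_ne_zero).1 h2

theorem borelMap_unit (hB : N.IsAdaptedBM B) (z : ℂ) : N.BorelMap (hB.unit z) := by
  have hf : N.BorelMap fun t => Complex.exp (-((z.re : ℂ) ^ 2 * (t : ℝ))) • N.one := by
    let _ : MeasurableSpace (Lp ℂ 2 N.P) := borel _
    have : BorelSpace (Lp ℂ 2 N.P) := ⟨rfl⟩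
    have hs : Measurable fun t : PosTime => Complex.exp (-((z.re : ℂ) ^ 2 * (t : ℝ))) := by
      fun_prop
    exact hs.smul_const N.one
  refine BorelMap.mul (Z := fun t => hB.lp t) (hB.continuous_lp.comp continuous_subtype_val)
    (φ := fun x => Complex.exp (z * x)) (by fun_prop) hf fun t => ?_
  filter_upwards [hB.unit_coeFn z t, hB.lp_coeFn t, N.one_coeFn,
    Lp.coeFn_smul (Complex.exp (-((z.re : ℂ) ^ 2 * (t : ℝ)))) N.one] with ω a b c d
  rw [a, b, d, Pi.smul_apply, c, smul_eq_mul, mul_one, ← Complex.exp_add, stdUnit, sub_eq_add_neg]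

theorem isNormalizedUnit_unit (hB : N.IsAdaptedBM B) (z : ℂ) :
    N.IsNormalizedUnit (hB.unit z) where
  left :=
    { mem := hB.unit_mem_H z
      ne_zero := fun t h => by
        have := hB.norm_unit z t
        rw [h, norm_zero] at this
        exact zero_ne_one this
      borel := hB.borelMap_unit z
      mul := hB.isProd_unit z }
  right := hB.norm_unit z

/-- The unit `exp (z B_t - (Re z)² t)` as an element of `H_t`. -/
noncomputable def unitH (hB : N.IsAdaptedBM B) (z : ℂ) (t : PosTime) : N.H t :=
  ⟨hB.unit z t, hB.unit_mem_H z t⟩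

theorem unitH_coeFn (hB : N.IsAdaptedBM B) (z : ℂ) (t : PosTime) :
    (hB.unitH z t : Lp ℂ 2 N.P) =ᵐ[N.P] stdUnit B z t := hB.unit_coeFn z t

/-! ### Imaginary shifts -/

theorem measurable_phase (hB : N.IsAdaptedBM B) (lam c : ℝ) (t : PosTime) :
    Measurable fun ω => lam * B t ω + c * t :=
  ((hB.measurable t).const_mul _).add_const _

/-- The automorphism of `(H_t)` that multiplies by `exp (i (lam * B_t + c * t))`. -/
noncomputable def imagShift (hB : N.IsAdaptedBM B) (lam c : ℝ) : N.Aut :=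
  SystemIso.phase N N.H (fun t ω => lam * B t ω + c * t) (hB.measurable_phase lam c)
    (fun t _ h => mulPhase_mem _ (aesm_phase (hB.aesm t.2.le le_rfl) lam (c * t)) h)
    (fun t _ h => mulPhase_mem _ (aesm_phase (hB.aesm t.2.le le_rfl) lam (c * t)).neg h)
    (fun s t => by
      filter_upwards [hB.comp_T t.2.le s] with ω d
      rw [d, Positive.coe_add, add_comm (t : ℝ)]
      ring)
    (fun X hX => by
      have hf : N.BorelMap fun t => Complex.exp (Complex.I * (c * t : ℝ)) • X t := by
        let _ : MeasurableSpace (Lp ℂ 2 N.P) := borel _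
        have : BorelSpace (Lp ℂ 2 N.P) := ⟨rfl⟩
        have hs : Measurable fun t : PosTime => Complex.exp (Complex.I * (c * t : ℝ)) := by
          fun_prop
        exact hs.smul hX
      refine BorelMap.mul (Z := fun t => hB.lp t) (hB.continuous_lp.comp continuous_subtype_val)
        (φ := fun x => Complex.exp (Complex.I * (lam * x : ℝ))) (by fun_prop) hf fun t => ?_
      filter_upwards [mulPhase_coeFn N.P (hB.measurable_phase lam c t) (X t), hB.lp_coeFn t,
        Lp.coeFn_smul (Complex.exp (Complex.I * (c * t : ℝ))) (X t)] with ω a b d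
      rw [a, b, d, Pi.smul_apply, smul_eq_mul, ← mul_assoc, ← Complex.exp_add, Complex.ofReal_add,
        mul_add])

theorem imagShift_coeFn (hB : N.IsAdaptedBM B) (lam c : ℝ) {t : PosTime} (x : N.H t) :
    ((hB.imagShift lam c).op t x : Lp ℂ 2 N.P) =ᵐ[N.P] fun ω =>
      Complex.exp (Complex.I * (lam * B t ω + c * t : ℝ)) * (x : Lp ℂ 2 N.P) ω :=
  mulPhase_coeFn N.P (hB.measurable_phase lam c t) (x : Lp ℂ 2 N.P)

theorem imagShift_mem_Hwhite_iff (hB : N.IsAdaptedBM B) (lam c : ℝ) (t : PosTime) (x : N.H t) :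
    (x : Lp ℂ 2 N.P) ∈ N.Hwhite B t ↔
      ((hB.imagShift lam c).op t x : Lp ℂ 2 N.P) ∈ N.Hwhite B t := by
  have ha := aesm_whiteField hB t.2 ⟨t.2.le, le_rfl⟩
  refine ⟨mulPhase_mem (hB.measurable_phase lam c t) (aesm_phase ha lam (c * t)), fun h => ?_⟩
  have h1 := mulPhase_mem (hB.measurable_phase lam c t).neg (aesm_phase ha lam (c * t)).neg h
  have h2 : mulPhase N.P (hB.measurable_phase lam c t).neg
      ((hB.imagShift lam c).op t x : Lp ℂ 2 N.P) = x :=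
    (mulPhase N.P (hB.measurable_phase lam c t)).symm_apply_apply (x : Lp ℂ 2 N.P)
  rw [h2] at h1
  exact h1

/-- The imaginary shift of the white noise part. -/
noncomputable def whiteImagShift (hB : N.IsAdaptedBM B) (lam : ℝ) : N.WhiteAut B :=
  (hB.imagShift lam 0).restrict (Hwhite_le hB) (Hwhite_le hB) (hB.imagShift_mem_Hwhite_iff lam 0)

theorem isImagShift_whiteImagShift (hB : N.IsAdaptedBM B) (lam : ℝ) :
    N.IsImagShift B lam (hB.whiteImagShift lam) := fun t ψ => by
  refine (hB.imagShift_coeFn lam 0 ⟨ψ, Hwhite_le hB t ψ.2⟩).trans (ae_of_all _ fun ω => ?_)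
  simp [mul_assoc]

theorem extendable_whiteImagShift (hB : N.IsAdaptedBM B) (lam : ℝ) :
    N.Extendable B (hB.whiteImagShift lam) := by
  refine ⟨hB.imagShift lam 0, fun t ψ x h => ?_⟩
  obtain rfl : x = ⟨ψ, Hwhite_le hB t ψ.2⟩ := Subtype.ext h
  rfl

end IsAdaptedBM

theorem IsImagShift.induces {lam : ℝ} {Θw : N.WhiteAut B} (h : N.IsImagShift B lam Θw) :
    N.Induces B Θw (AffineIsometryEquiv.constVAdd ℂ ℂ (Complex.I * lam)) := by
  intro z
  refine ⟨0, fun t ψ e => ?_⟩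
  filter_upwards [h t ψ, e] with ω a b
  rw [a, b, stdUnit_add_I_mul]
  simp

/-! ### The action on units -/

/-- `Θ` maps the unit with parameter `z` to a multiple of the unit with parameter `g z`, the
factor being of the form `exp (i c t)`. -/
def Acts (hB : N.IsAdaptedBM B) (Θ : N.Aut) (g : ℂ → ℂ) : Prop :=
  ∀ z, ∃ c : ℝ, ∀ t : PosTime, Θ.op t (hB.unitH z t) =
    Complex.exp (Complex.I * c * (t : ℝ)) • hB.unitH (g z) t

namespace Acts

variable {hB : N.IsAdaptedBM B} {Θ Θ' : N.Aut} {g g' : ℂ → ℂ}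

theorem trans (h : Acts hB Θ g) (h' : Acts hB Θ' g') :
    Acts hB (Θ.trans Θ' monotone_H) (g' ∘ g) := by
  intro z
  obtain ⟨c, hc⟩ := h z
  obtain ⟨c', hc'⟩ := h' (g z)
  refine ⟨c + c', fun t => ?_⟩
  change Θ'.op t (Θ.op t _) = _
  rw [hc, map_smul, hc', smul_smul, ← Complex.exp_add, Function.comp]
  congr 2
  push_cast
  ring

theorem symm (h : Acts hB Θ g) (hg : ∀ z, g (g' z) = z) :
    Acts hB (Θ.symm N.exists_isProd_H) g' := by
  intro z
  obtain ⟨c, hc⟩ := h (g' z)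
  refine ⟨-c, fun t => ?_⟩
  have h1 := hc t
  rw [hg] at h1
  change (Θ.op t).symm (hB.unitH z t) = _
  rw [LinearIsometryEquiv.symm_apply_eq, map_smul, h1, smul_smul, ← Complex.exp_add]
  simp

theorem imagShift (hB : N.IsAdaptedBM B) (lam c : ℝ) :
    Acts hB (hB.imagShift lam c) fun z => Complex.I * lam + z := by
  intro z
  refine ⟨c, fun t => Subtype.ext (Lp.ext ?_)⟩
  filter_upwards [hB.imagShift_coeFn lam c (hB.unitH z t), hB.unitH_coeFn z t,
    hB.unitH_coeFn (Complex.I * lam + z) t, Lp.coeFn_smul (Complex.exp (Complex.I * c * (t : ℝ)))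
      (hB.unitH (Complex.I * lam + z) t : Lp ℂ 2 N.P)] with ω a b d e
  rw [a, b, Submodule.coe_smul, e, Pi.smul_apply, d, ← stdUnit_add_I_mul, smul_eq_mul, ← mul_assoc,
    ← Complex.exp_add]
  congr 2
  push_cast
  ring

/-- If `Θ` extends an automorphism of the white noise part that induces the motion `g`, then it
acts on the units by `g`. -/
theorem of_induces {Θw : N.WhiteAut B} {g : ℂ ≃ᵃⁱ[ℂ] ℂ} (h : N.Induces B Θw g)
    (hΘ : ∀ (t : PosTime) (ψ : N.Hwhite B t) (x : N.H t), (x : Lp ℂ 2 N.P) = ψ →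
      ((Θ.op t x : N.H t) : Lp ℂ 2 N.P) = Θw.op t ψ) : Acts hB Θ g := by
  intro z
  obtain ⟨c, hc⟩ := h z
  refine ⟨c, fun t => Subtype.ext (Lp.ext ?_)⟩
  rw [hΘ t ⟨hB.unit z t, hB.unit_mem_Hwhite z t⟩ _ rfl]
  filter_upwards [hc t ⟨hB.unit z t, hB.unit_mem_Hwhite z t⟩ (hB.unit_coeFn z t),
    hB.unitH_coeFn (g z) t, Lp.coeFn_smul (Complex.exp (Complex.I * c * (t : ℝ)))
      (hB.unitH (g z) t : Lp ℂ 2 N.P)] with ω a b d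
  rw [a, Submodule.coe_smul, d, Pi.smul_apply, b, smul_eq_mul]

/-- An automorphism preserves inner products of units. Comparing exponents relates the phases to
the transformation of the parameters. -/
theorem exists_phase (h : Acts hB Θ g) : ∃ c : ℂ → ℝ,
    (∀ z (t : PosTime), Θ.op t (hB.unitH z t) =
      Complex.exp (Complex.I * c z * (t : ℝ)) • hB.unitH (g z) t) ∧
    ∀ z w, (starRingEnd ℂ (g z) + g w) ^ 2 / 2 - ((g z).re : ℂ) ^ 2 - ((g w).re : ℂ) ^ 2 +
      Complex.I * (c w - c z) =
      (starRingEnd ℂ z + w) ^ 2 / 2 - (z.re : ℂ) ^ 2 - (w.re : ℂ) ^ 2 := by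
  choose c hc using h
  refine ⟨c, hc, fun z w => eq_of_exp_mul_eq fun t => ?_⟩
  have h1 := (Θ.op t).inner_map_map (hB.unitH z t) (hB.unitH w t)
  rw [hc, hc] at h1
  change inner ℂ (Complex.exp _ • hB.unit _ t) (Complex.exp _ • hB.unit _ t) =
    inner ℂ (hB.unit _ t) (hB.unit _ t) at h1
  rw [inner_smul_left, inner_smul_right, hB.inner_unit, hB.inner_unit] at h1
  rw [← h1, ← Complex.exp_conj, ← Complex.exp_add, ← Complex.exp_add]
  congr 1
  simp only [map_mul, Complex.conj_I, Complex.conj_ofReal]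
  ring

/-- The transformation of the parameters is a motion of the plane: the relation between the
phases and the parameters implies `conj (g z - g 0) * (g w - g 0) = conj z * w`. -/
theorem exists_motion (h : Acts hB Θ g) : ∃ a b : ℂ, ‖a‖ = 1 ∧ ∀ z, g z = a * z + b := by
  obtain ⟨c, -, hc⟩ := h.exists_phase
  have key : ∀ z w, starRingEnd ℂ (g z - g 0) * (g w - g 0) = starRingEnd ℂ z * w := by
    intro z w
    have h1 := hc z w
    have h2 := hc 0 w
    have h3 := hc z 0
    have h4 := hc 0 0
    simp only [map_sub, map_zero] at h1 h2 h3 h4 ⊢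
    linear_combination h1 - h2 - h3 + h4
  have h1 := key 1 1
  simp only [map_one, mul_one, ← Complex.normSq_eq_conj_mul_self] at h1
  have h2 : Complex.normSq (g 1 - g 0) = 1 := by exact_mod_cast h1
  refine ⟨g 1 - g 0, g 0, ?_, fun z => ?_⟩
  · rw [Complex.normSq_eq_norm_sq] at h2
    exact (pow_eq_one_iff_of_nonneg (norm_nonneg _) two_ne_zero).1 h2
  · have h3 := key 1 z
    rw [map_one, one_mul] at h3
    have h4 : (g 1 - g 0) * (starRingEnd ℂ (g 1 - g 0) * (g z - g 0)) = g z - g 0 := by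
      rw [← mul_assoc, Complex.mul_conj, h2, Complex.ofReal_one, one_mul]
    rw [h3] at h4
    rw [h4, sub_add_cancel]

/-- For a real translation, the phases are those of the real shift. -/
theorem exists_phase_of_translation {lam : ℝ} (h : Acts hB Θ fun z => lam + z) :
    ∃ c : ℝ, ∀ z (t : PosTime), Θ.op t (hB.unitH z t) =
      Complex.exp (Complex.I * (c - 2 * lam * z.im : ℝ) * (t : ℝ)) • hB.unitH (lam + z) t := by
  obtain ⟨c, hc, hcc⟩ := h.exists_phase
  refine ⟨c 0, fun z t => ?_⟩
  have h1 := hcc 0 z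
  have h2 : c z = c 0 - 2 * lam * z.im := by
    have h3 := congrArg Complex.im h1
    simp [pow_two] at h3
    linarith
  rw [hc, h2]

end Acts

end Units

/-! ### Step exponentials span the white noise part -/

theorem aesm_stepSum {Ω : Type*} {G : MeasurableSpace Ω} {m : MeasurableSpace Ω} {μ : Measure[m] Ω}
    {B : ℝ → Ω → ℝ} {δ : ℝ} (y : ℕ → ℝ) {n : ℕ}
    (h : ∀ k ≤ n, AEStronglyMeasurable[G] (B (k * δ)) μ) :
    AEStronglyMeasurable[G] (stepSum B δ y n) μ := by
  induction n with
  | zero =>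
    have e : stepSum B δ y 0 = fun _ => 0 := by
      funext ω
      simp [stepSum]
    rw [e]
    exact aestronglyMeasurable_const
  | succ n ih =>
    have e : stepSum B δ y (n + 1) = fun ω =>
        stepSum B δ y n ω + y n * (B ((n + 1 : ℕ) * δ) ω - B (n * δ) ω) := by
      funext ω
      simp [stepSum, Finset.sum_range_succ]
    rw [e]
    exact (ih fun k hk => h k (by omega)).add
      (((h (n + 1) le_rfl).sub (h n (by omega))).const_mul _)

section Total

variable {Ω : Type*} [m : MeasurableSpace Ω] [StandardBorelSpace Ω] {N : Noise Ω}
  {B : ℝ → Ω → ℝ}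

/-- The exponential `exp (i ∑ y_k (B_{(k+1)δ} - B_{kδ}))` as an element of `L₂`. -/
noncomputable def stepExp (hB : N.IsAdaptedBM B) (δ : ℝ) (y : ℕ → ℝ) (n : ℕ) : Lp ℂ 2 N.P :=
  mulPhase N.P (measurable_stepSum hB δ y n) N.one

theorem stepExp_coeFn (hB : N.IsAdaptedBM B) (δ : ℝ) (y : ℕ → ℝ) (n : ℕ) :
    stepExp hB δ y n =ᵐ[N.P] fun ω => Complex.exp (Complex.I * stepSum B δ y n ω) := by
  filter_upwards [mulPhase_coeFn N.P (measurable_stepSum hB δ y n) N.one, N.one_coeFn] with ω a b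
  rw [stepExp, a, b, mul_one]

theorem inner_stepExp_neg (hB : N.IsAdaptedBM B) (δ : ℝ) (y : ℕ → ℝ) (n : ℕ) (φ : Lp ℂ 2 N.P) :
    inner ℂ (stepExp hB δ (-y) n) φ =
      ∫ ω, Complex.exp (Complex.I * stepSum B δ y n ω) * φ ω ∂N.P := by
  rw [L2.inner_def]
  refine integral_congr_ae ?_
  filter_upwards [stepExp_coeFn hB δ (-y) n] with ω a
  rw [a, RCLike.inner_apply, ← Complex.exp_conj, mul_comm]
  congr 2
  simp [stepSum]

theorem natCast_mul_div_mem {t : ℝ} (ht : 0 < t) {n k : ℕ} (hk : k ≤ n + 1) :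
    (k : ℝ) * (t / (n + 1)) ∈ Icc 0 t := by
  refine ⟨by positivity, ?_⟩
  rw [mul_div_assoc', div_le_iff₀ (by positivity), mul_comm]
  have : (k : ℝ) ≤ n + 1 := by exact_mod_cast hk
  gcongr

theorem stepExp_mem_Hwhite (hB : N.IsAdaptedBM B) (t : PosTime) (y : ℕ → ℝ) (n : ℕ) :
    stepExp hB (t / (n + 1)) y (n + 1) ∈ N.Hwhite B t := by
  refine mulPhase_mem _ (aesm_stepSum y fun k hk =>
    aesm_whiteField hB t.2 (natCast_mul_div_mem t.2 hk)) ?_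
  exact mem_lpMeas_iff_aestronglyMeasurable.2 (aestronglyMeasurable_const.congr N.one_coeFn.symm)

theorem isClosed_Hwhite (hB : N.IsAdaptedBM B) (t : PosTime) :
    IsClosed (N.Hwhite B t : Set (Lp ℂ 2 N.P)) := by
  convert isClosed_aestronglyMeasurable (F := ℂ) (p := 2) (μ := N.P) (whiteField_le hB 0 t) using 1
  ext f
  exact mem_lpMeas_iff_aestronglyMeasurable

/-- A closed subspace that contains the step exponentials along all equidistant partitions of
`[0,t]` contains `H_t^white`. -/
theorem Hwhite_le_of_stepExp (hB : N.IsAdaptedBM B) {t : PosTime}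
    {K : Submodule ℂ (Lp ℂ 2 N.P)} (hK : IsClosed (K : Set (Lp ℂ 2 N.P)))
    (h : ∀ (n : ℕ) (y : ℕ → ℝ), stepExp hB (t / (n + 1)) y (n + 1) ∈ K) : N.Hwhite B t ≤ K := by
  intro ψ hψ
  have hc : IsClosed ((K ⊓ N.Hwhite B t : Submodule ℂ (Lp ℂ 2 N.P)) : Set (Lp ℂ 2 N.P)) :=
    hK.inter (isClosed_Hwhite hB t)
  have : CompleteSpace (K ⊓ N.Hwhite B t : Submodule ℂ (Lp ℂ 2 N.P)) := hc.completeSpace_coe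
  set p := (K ⊓ N.Hwhite B t).starProjection ψ with hp
  have hpm : p ∈ K ⊓ N.Hwhite B t := Submodule.starProjection_apply_mem _ _
  have ho : ψ - p ∈ (K ⊓ N.Hwhite B t)ᗮ := Submodule.sub_starProjection_mem_orthogonal ψ
  have h0 : ψ - p = 0 := by
    refine eq_zero_of_stepSum hB (Submodule.sub_mem _ hψ hpm.2) fun n y => ?_
    rw [← inner_stepExp_neg hB]
    exact (Submodule.mem_orthogonal _ _).1 ho _ ⟨h n (-y), stepExp_mem_Hwhite hB t (-y) n⟩
  rw [sub_eq_zero.1 h0]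
  exact hpm.1

/-- A step exponential is the product of a shorter one and a unit. -/
theorem isProd_stepExp (hB : N.IsAdaptedBM B) (δ : PosTime) (y : ℕ → ℝ) (n : ℕ) {τ : PosTime}
    (hτ : (τ : ℝ) = n * δ) :
    N.IsProd τ (stepExp hB δ y n) (hB.unit (Complex.I * y n) δ) (stepExp hB δ y (n + 1)) := by
  change _ =ᵐ[N.P] _
  filter_upwards [stepExp_coeFn hB δ y n, stepExp_coeFn hB δ y (n + 1),
    (N.quasi_T τ).ae_eq_comp (hB.unit_coeFn (Complex.I * y n) δ), hB.comp_T δ.2.le τ] with ω a b c d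
  have c' : hB.unit (Complex.I * y n) δ (N.T τ ω) = stdUnit B (Complex.I * y n) δ (N.T τ ω) := c
  rw [a, b, c', stdUnit, d, ← Complex.exp_add, stepSum, Finset.sum_range_succ, ← stepSum, hτ,
    show (δ : ℝ) + n * δ = (n + 1) * δ by ring]
  congr 1
  simp
  ring

theorem stepExp_one (hB : N.IsAdaptedBM B) (δ : PosTime) (y : ℕ → ℝ) :
    stepExp hB δ y 1 = hB.unit (Complex.I * y 0) δ := by
  refine Lp.ext ?_
  filter_upwards [stepExp_coeFn hB δ y 1, hB.unit_coeFn (Complex.I * y 0) δ, hB.zero] with ω a b c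
  rw [a, b, stdUnit]
  simp [stepSum, c, mul_assoc]

theorem stepExp_mem_H (hB : N.IsAdaptedBM B) (δ : PosTime) (y : ℕ → ℝ) (n : ℕ) {τ : PosTime}
    (hτ : (τ : ℝ) = n * δ) : stepExp hB δ y n ∈ N.H τ := by
  refine mulPhase_mem _ (aesm_stepSum y fun k hk => hB.aesm ?_ ?_) ?_
  · have := δ.2
    positivity
  · rw [hτ]
    have := δ.2
    gcongr
  · exact mem_lpMeas_iff_aestronglyMeasurable.2 (aestronglyMeasurable_const.congr N.one_coeFn.symm)

end Total

section Unique

variable {Ω Ω' : Type*} [MeasurableSpace Ω] [StandardBorelSpace Ω] [MeasurableSpace Ω']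
  [StandardBorelSpace Ω'] {N : Noise Ω} {B : ℝ → Ω → ℝ} {N' : Noise Ω'} {B' : ℝ → Ω' → ℝ}

/-- Step exponentials are products of units `exp (i y B_t)`. -/
theorem SystemIso.op_stepExp (V : SystemIso N N.H N' N'.H) (hB : N.IsAdaptedBM B)
    (hB' : N'.IsAdaptedBM B')
    (h : ∀ (y : ℝ) t, V.op t (hB.unitH (Complex.I * y) t) = hB'.unitH (Complex.I * y) t)
    (δ : PosTime) (y : ℕ → ℝ) (n : ℕ) : ∀ (τ : PosTime) (hτ : (τ : ℝ) = (n + 1 : ℕ) * δ),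
      V.op τ ⟨stepExp hB δ y (n + 1), stepExp_mem_H hB δ y (n + 1) hτ⟩ =
        ⟨stepExp hB' δ y (n + 1), stepExp_mem_H hB' δ y (n + 1) hτ⟩ := by
  induction n with
  | zero =>
    intro τ hτ
    obtain rfl : τ = δ := Subtype.ext (by simpa using hτ)
    have h1 : (⟨stepExp hB τ y (0 + 1), stepExp_mem_H hB τ y (0 + 1) hτ⟩ : N.H τ) =
        hB.unitH (Complex.I * y 0) τ := Subtype.ext (stepExp_one hB τ y)
    rw [h1, h]
    exact Subtype.ext (stepExp_one hB' τ y).symm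
  | succ n ih =>
    intro τ hτ
    have hp : 0 < ((n + 1 : ℕ) : ℝ) * (δ : ℝ) := by
      have := δ.2
      positivity
    let σ : PosTime := ⟨(n + 1 : ℕ) * δ, hp⟩
    obtain rfl : τ = σ + δ := Subtype.ext (by
      rw [hτ, Positive.coe_add]
      change _ = ((n + 1 : ℕ) : ℝ) * (δ : ℝ) + δ
      push_cast
      ring)
    have h1 := V.map_mul σ δ ⟨_, stepExp_mem_H hB δ y (n + 1) rfl⟩
      (hB.unitH (Complex.I * y (n + 1)) δ) ⟨_, stepExp_mem_H hB δ y (n + 1 + 1) hτ⟩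
      (isProd_stepExp hB δ y (n + 1) rfl)
    rw [ih σ rfl, h] at h1
    exact Subtype.ext (h1.unique (isProd_stepExp hB' δ y (n + 1) rfl))

/-- An isomorphism that respects the units `exp (i y B_t)` extends the natural isomorphism of
the white noise parts. -/
theorem SystemIso.op_eq_whiteOp (V : SystemIso N N.H N' N'.H) (hB : N.IsAdaptedBM B)
    (hB' : N'.IsAdaptedBM B')
    (h : ∀ (y : ℝ) t, V.op t (hB.unitH (Complex.I * y) t) = hB'.unitH (Complex.I * y) t)
    (t : PosTime) (ψ : N.Hwhite B t) :
    (V.op t ⟨ψ, Hwhite_le hB t ψ.2⟩ : Lp ℂ 2 N'.P) = whiteOp hB hB' t ψ := by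
  let W := N.Hwhite B t
  -- the subspace on which the two operators coincide is closed and contains step exponentials
  let f : W →ₗ[ℂ] Lp ℂ 2 N'.P :=
    (N'.H t).subtype ∘ₗ (V.op t).toLinearEquiv.toLinearMap ∘ₗ Submodule.inclusion (Hwhite_le hB t)
  let g : W →ₗ[ℂ] Lp ℂ 2 N'.P :=
    (N'.Hwhite B' t).subtype ∘ₗ (whiteOp hB hB' t).toLinearEquiv.toLinearMap
  have hf : Continuous f := continuous_subtype_val.comp
    ((V.op t).continuous.comp (continuous_subtype_val.subtype_mk _))
  have hg : Continuous g := continuous_subtype_val.comp (whiteOp hB hB' t).continuous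
  let K : Submodule ℂ (Lp ℂ 2 N.P) := (LinearMap.eqLocus f g).map W.subtype
  have hK : IsClosed (K : Set (Lp ℂ 2 N.P)) := by
    have h1 : IsClosed {x : W | f x = g x} := isClosed_eq hf hg
    exact (isClosed_Hwhite hB t).isClosedEmbedding_subtypeVal.isClosedMap _ h1
  have hle : N.Hwhite B t ≤ K := by
    refine Hwhite_le_of_stepExp hB hK fun n y => ?_
    refine ⟨⟨_, stepExp_mem_Hwhite hB t y n⟩, ?_, rfl⟩
    have hδ : (t : ℝ) = (n + 1 : ℕ) * (t.part n : ℝ) := by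
      rw [PosTime.part]
      push_cast
      field_simp
    change (V.op t ⟨stepExp hB (t / (n + 1)) y (n + 1), _⟩ : Lp ℂ 2 N'.P) =
      whiteOp hB hB' t ⟨stepExp hB (t / (n + 1)) y (n + 1), _⟩
    have h1 := V.op_stepExp hB hB' h (t.part n) y n t hδ
    refine (congrArg Subtype.val h1).trans (Lp.ext ((stepExp_coeFn hB' _ y (n + 1)).trans ?_))
    symm
    have hlt : ∀ k ∈ Finset.range (n + 1), k + 1 ≤ n + 1 := fun k hk => by
      have := Finset.mem_range.1 hk
      omega
    let X : (Icc (0 : ℝ) t → ℝ) → ℂ := fun p => Complex.exp (Complex.I *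
      (∑ k ∈ (Finset.range (n + 1)).attach,
        y k * (p ⟨(k + 1 : ℕ) * (t / (n + 1)), natCast_mul_div_mem t.2 (hlt k k.2)⟩ -
          p ⟨(k : ℕ) * (t / (n + 1)), natCast_mul_div_mem t.2
            ((Nat.le_succ _).trans (hlt k k.2))⟩) : ℝ))
    have hX : Measurable X := by fun_prop
    have hXB : ∀ b : ℝ → ℝ, X (fun s => b s) = Complex.exp (Complex.I *
        (∑ k ∈ Finset.range (n + 1), y k * (b ((k + 1) * (t / (n + 1))) -
          b (k * (t / (n + 1)))) : ℝ)) := by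
      intro b
      simp only [X]
      rw [← Finset.sum_attach (Finset.range (n + 1))]
      simp only [Nat.cast_add, Nat.cast_one]
    have h2 := whiteOp_coeFn hB hB' hX (ψ := ⟨_, stepExp_mem_Hwhite hB t y n⟩)
      ((stepExp_coeFn hB _ y (n + 1)).trans (ae_of_all _ fun ω => (hXB fun s => B s ω).symm))
    exact h2.trans (ae_of_all _ fun ω => hXB fun s => B' s ω)
  obtain ⟨x, hx, e⟩ := hle ψ.2
  obtain rfl : x = ψ := Subtype.ext e
  exact hx

end Unique

section Key

variable {Ω : Type*} [MeasurableSpace Ω] [StandardBorelSpace Ω] {N : Noise Ω} {B : ℝ → Ω → ℝ}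

/-- An automorphism that acts on the units as a real translation yields an isomorphism between
the extension and its modification by a drift. -/
theorem Acts.extensionsIsomorphic {hB : N.IsAdaptedBM B} {Θ : N.Aut} {lam : ℝ}
    (h : Acts hB Θ fun z => lam + z) {N' : Noise Ω} (hd : N'.IsDriftOf N B (2 * lam)) :
    ExtensionsIsomorphic N B N' (subDrift B (2 * lam)) := by
  obtain ⟨c, hc⟩ := h.exists_phase_of_translation
  -- `Θ`, corrected by the phase `exp (-i c t)`, divided by the square root of the density
  let V : SystemIso N N.H N' N'.H := (Θ.trans (hB.imagShift 0 (-c)) monotone_H).trans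
    ((hd.iso hB).symm N'.exists_isProd_H) monotone_H
  have hV : ∀ (y : ℝ) t, V.op t (hB.unitH (Complex.I * y) t) =
      (hd.isAdaptedBM hB).unitH (Complex.I * y) t := by
    intro y t
    change (hd.op t).symm ((hB.imagShift 0 (-c)).op t (Θ.op t (hB.unitH (Complex.I * y) t))) = _
    rw [LinearIsometryEquiv.symm_apply_eq, hc]
    refine Subtype.ext (Lp.ext ?_)
    have h1 := hd.op_path ((hd.isAdaptedBM hB).unitH (Complex.I * y) t)
      (X := fun p => Complex.exp (Complex.I * y * p ⟨t, t.2.le, le_rfl⟩)) (by fun_prop)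
      (((hd.isAdaptedBM hB).unitH_coeFn (Complex.I * y) t).trans
        (ae_of_all _ fun ω => by simp [stdUnit, path]))
    filter_upwards [h1, hB.imagShift_coeFn 0 (-c) (Complex.exp (Complex.I *
      (c - 2 * lam * (Complex.I * y).im : ℝ) * (t : ℝ)) • hB.unitH (lam + Complex.I * y) t),
      hB.unitH_coeFn (lam + Complex.I * y) t, Lp.coeFn_smul (Complex.exp (Complex.I *
      (c - 2 * lam * (Complex.I * y).im : ℝ) * (t : ℝ)))
        (hB.unitH (lam + Complex.I * y) t : Lp ℂ 2 N.P)] with ω a b d e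
    rw [a, b, Submodule.coe_smul, e, Pi.smul_apply, d, smul_eq_mul, stdUnit, Complex.ofReal_exp,
      ← Complex.exp_add, ← Complex.exp_add, ← Complex.exp_add]
    congr 1
    simp [path]
    ring
  refine ⟨V, fun t X ψ hX e => ?_⟩
  have hψ : (ψ : Lp ℂ 2 N.P) ∈ N.Hwhite B t := (mem_Hwhite_iff hB).2 ⟨X, hX, e⟩
  have h1 := V.op_eq_whiteOp hB (hd.isAdaptedBM hB) hV t ⟨ψ, hψ⟩
  have h2 := whiteOp_coeFn hB (hd.isAdaptedBM hB) hX (ψ := ⟨ψ, hψ⟩) e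
  rw [← h1] at h2
  exact h2

/-- Under drift sensitivity, no automorphism acts on the units as a nonzero real translation. -/
theorem DriftSensitive.not_acts (hN : N.DriftSensitive B) {hB : N.IsAdaptedBM B} {Θ : N.Aut}
    {lam : ℝ} (hlam : lam ≠ 0) : ¬ Acts hB Θ fun z => lam + z := by
  intro h
  obtain ⟨N', hd, hne⟩ := hN (2 * lam) (mul_ne_zero two_ne_zero hlam)
  exact hne (h.extensionsIsomorphic hd)

end Key

/-! ### Motions of the plane of units -/

section Motions

variable {Ω : Type*} [MeasurableSpace Ω] [StandardBorelSpace Ω] {N : Noise Ω} {B : ℝ → Ω → ℝ}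

theorem Acts.congr {hB : N.IsAdaptedBM B} {Θ : N.Aut} {g g' : ℂ → ℂ} (h : Acts hB Θ g)
    (e : ∀ z, g z = g' z) : Acts hB Θ g' := funext e ▸ h

theorem IsRealShift.induces {lam : ℝ} {Θw : N.WhiteAut B} (h : N.IsRealShift B lam Θw) :
    N.Induces B Θw (AffineIsometryEquiv.constVAdd ℂ ℂ (lam : ℂ)) := by
  intro z
  refine ⟨-2 * lam * z.im, fun t ψ e => ?_⟩
  have h1 := h t (fun p => Complex.exp (z * p ⟨t, t.2.le, le_rfl⟩ - (z.re : ℂ) ^ 2 * (t : ℝ))) ψ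
    (by fun_prop) e
  refine h1.trans (ae_of_all _ fun ω => ?_)
  simp only [path, AffineIsometryEquiv.coe_constVAdd, stdUnit, vadd_eq_add, Complex.ofReal_exp,
    ← Complex.exp_add]
  congr 1
  simp
  linear_combination (2 * lam * (t : ℝ) : ℂ) * Complex.re_add_im z

theorem Extendable.exists_acts (hB : N.IsAdaptedBM B) {Θw : N.WhiteAut B} {g : ℂ ≃ᵃⁱ[ℂ] ℂ}
    (h : N.Extendable B Θw) (hg : N.Induces B Θw g) : ∃ Θ : N.Aut, Acts hB Θ g := by
  obtain ⟨Θ, hΘ⟩ := h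
  exact ⟨Θ, .of_induces hg hΘ⟩

theorem DriftSensitive.not_extendable (hN : N.DriftSensitive B) (hB : N.IsAdaptedBM B) {lam : ℝ}
    (hlam : lam ≠ 0) {Θw : N.WhiteAut B}
    (hΘw : N.Induces B Θw (AffineIsometryEquiv.constVAdd ℂ ℂ (lam : ℂ))) :
    ¬ N.Extendable B Θw := by
  intro h
  obtain ⟨Θ, hΘ⟩ := h.exists_acts hB hΘw
  exact hN.not_acts hlam hΘ

/-- Conjugation of the imaginary translations by a motion with linear part `a` yields the
translations by the multiples of `i * a`. They must be imaginary. -/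
theorem DriftSensitive.im_eq_zero (hN : N.DriftSensitive B) {hB : N.IsAdaptedBM B} {Θ : N.Aut}
    {a b : ℂ} (ha : a ≠ 0) (h : Acts hB Θ fun z => a * z + b) : a.im = 0 := by
  by_contra him
  have h1 := h.symm (g' := fun z => a⁻¹ * (z - b)) fun z => by
    rw [mul_inv_cancel_left₀ ha, sub_add_cancel]
  have h2 := ((h1.trans (.imagShift hB 1 0)).trans h).trans (.imagShift hB (-a.re) 0)
  refine hN.not_acts (neg_ne_zero.2 him) (lam := -a.im) (h2.congr fun z => ?_)
  simp only [Function.comp]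
  rw [mul_add, mul_inv_cancel_left₀ ha]
  push_cast
  linear_combination -Complex.I * Complex.re_add_im a + (a.im : ℂ) * Complex.I_sq

/-- A motion that fixes the imaginary direction is a translation or a reflection in a point. The
translation `z ↦ z + r` is excluded. -/
theorem DriftSensitive.eq_neg_one (hN : N.DriftSensitive B) {hB : N.IsAdaptedBM B} {Θ : N.Aut}
    {a : ℂ} {r : ℝ} (ha : ‖a‖ = 1) (hr : r ≠ 0) (h : Acts hB Θ fun z => a * z + r) : a = -1 := by
  have him := hN.im_eq_zero (norm_ne_zero_iff.1 (ha ▸ one_ne_zero)) h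
  have hre : a = (a.re : ℂ) := Complex.ext rfl (by simp [him])
  rw [hre, Complex.norm_real, Real.norm_eq_abs] at ha
  rcases eq_or_eq_neg_of_abs_eq ha with h1 | h1
  · rw [hre, h1] at h
    refine absurd (h.congr fun z => ?_) (hN.not_acts hr)
    push_cast
    ring
  · rw [hre, h1]
    simp

/-- No automorphisms act on the units as motions that send `0` to `1` and to `2`, respectively:
as real translations are excluded, both would be reflections in a point, with a real translation
as their composition. -/
theorem DriftSensitive.not_acts_of_acts (hN : N.DriftSensitive B) {hB : N.IsAdaptedBM B}
    {Θ Θ' : N.Aut} {g g' : ℂ → ℂ} (h : Acts hB Θ g) (h' : Acts hB Θ' g') (h0 : g 0 = 1)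
    (h0' : g' 0 = 2) : False := by
  obtain ⟨a, b, ha, hg⟩ := h.exists_motion
  obtain ⟨a', b', ha', hg'⟩ := h'.exists_motion
  obtain rfl : b = 1 := by rw [← h0, hg]; simp
  obtain rfl : b' = 2 := by rw [← h0', hg']; simp
  obtain rfl : g = fun z => a * z + 1 := funext hg
  obtain rfl : g' = fun z => a' * z + 2 := funext hg'
  have e : a = -1 := hN.eq_neg_one (r := 1) ha one_ne_zero (by simpa using h)
  have e' : a' = -1 := hN.eq_neg_one (r := 2) ha' two_ne_zero (by simpa using h')
  subst e e'
  refine hN.not_acts one_ne_zero (lam := 1) ((h.trans h').congr fun z => ?_)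
  simp only [Function.comp]
  push_cast
  ring

end Motions

/-! ### Multiplicative functions on the half-line -/

section Multiplicative

/-- A bounded measurable multiplicative function `f` on `(0,∞)` is zero or exponential. If the
integral `G` of `f` does not vanish at `a`, then `f(t) G(a) = G(t + a) - G(t)` makes `f`
differentiable, with `f' = γ f`. -/
theorem eq_zero_or_eq_exp_of_mul {F : PosTime → ℂ} (hm : Measurable F)
    (hmul : ∀ s t, F (s + t) = F s * F t) (hb : ∀ t, ‖F t‖ ≤ 1) :
    (∀ t, F t = 0) ∨ ∃ γ : ℂ, ∀ t : PosTime, F t = Complex.exp (γ * (t : ℝ)) := by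
  classical
  let f : ℝ → ℂ := fun t => if h : 0 < t then F ⟨t, h⟩ else 0
  have hfF : ∀ t : PosTime, f t = F t := fun t => dif_pos t.2
  have hfm : Measurable f := Measurable.dite hm measurable_const measurableSet_Ioi
  have hfb : ∀ t, ‖f t‖ ≤ 1 := by
    intro t
    by_cases h : 0 < t
    · simpa only [f, dif_pos h] using hb _
    · simp [f, dif_neg h]
  have hmul' : ∀ s t : ℝ, 0 < s → 0 < t → f (s + t) = f s * f t := by
    intro s t hs ht
    have h := hmul ⟨s, hs⟩ ⟨t, ht⟩
    rw [← hfF, ← hfF, ← hfF] at h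
    exact h
  have hint : ∀ a b, IntervalIntegrable f volume a b := fun a b =>
    (intervalIntegrable_const (c := (1 : ℝ))).mono_fun hfm.aestronglyMeasurable
      (ae_of_all _ fun t => by simpa using hfb t)
  let G : ℝ → ℂ := fun x => ∫ t in (0 : ℝ)..x, f t
  by_cases hG : ∃ a, 0 < a ∧ G a ≠ 0
  · obtain ⟨a, ha, hGa⟩ := hG
    right
    have h1 : ∀ t, 0 < t → f t = (G (t + a) - G t) / G a := by
      intro t ht
      rw [eq_div_iff hGa]
      have e1 : G (t + a) - G t = ∫ s in t..t + a, f s :=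
        intervalIntegral.integral_interval_sub_left (hint _ _) (hint _ _)
      have e2 : ∫ s in t..t + a, f s = ∫ s in (0 : ℝ)..a, f (s + t) := by
        rw [intervalIntegral.integral_comp_add_right, zero_add, add_comm]
      rw [e1, e2, ← intervalIntegral.integral_const_mul]
      refine intervalIntegral.integral_congr_ae (ae_of_all _ fun s hs => ?_)
      rw [uIoc_of_le ha.le] at hs
      rw [add_comm, hmul' _ _ ht hs.1]
    have hGc : Continuous G := intervalIntegral.continuous_primitive hint 0
    have hev : ∀ t, 0 < t → f =ᶠ[𝓝 t] fun t => (G (t + a) - G t) / G a := fun t ht => by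
      filter_upwards [lt_mem_nhds ht] with s hs
      exact h1 s hs
    have hfc : ∀ t, 0 < t → ContinuousAt f t := fun t ht =>
      (Continuous.continuousAt (by fun_prop)).congr (hev t ht).symm
    have hGd : ∀ t, 0 < t → HasDerivAt G (f t) t := fun t ht =>
      intervalIntegral.integral_hasDerivAt_right (hint _ _)
        hfm.stronglyMeasurable.stronglyMeasurableAtFilter (hfc t ht)
    let γ := (f a - 1) / G a
    have hfd : ∀ t, 0 < t → HasDerivAt f (γ * f t) t := by
      intro t ht
      have h2 := (((hGd (t + a) (by linarith)).comp_add_const t a).sub (hGd t ht)).div_const (G a)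
      refine (h2.congr_of_eventuallyEq (hev t ht)).congr_deriv ?_
      rw [hmul' t a ht ha]
      simp only [γ]
      ring
    let k : ℝ → ℂ := fun t => f t * Complex.exp (-(γ * t))
    have hkd : ∀ t, 0 < t → HasDerivAt k 0 t := by
      intro t ht
      have h3 : HasDerivAt (fun t : ℝ => Complex.exp (-(γ * t)))
          (Complex.exp (-(γ * t)) * -(γ * 1)) t :=
        (((Complex.ofRealCLM.hasDerivAt (x := t)).const_mul γ).neg).cexp
      refine ((hfd t ht).mul h3).congr_deriv ?_
      ring
    have hk : ∀ t, 0 < t → k t = k 1 := by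
      intro t ht
      refine isOpen_Ioi.is_const_of_deriv_eq_zero isPreconnected_Ioi
        (fun x hx => (hkd x hx).differentiableAt.differentiableWithinAt)
        (fun x hx => (hkd x hx).deriv) ht (mem_Ioi.2 one_pos)
    have hfk : ∀ t, 0 < t → f t = k 1 * Complex.exp (γ * t) := by
      intro t ht
      rw [← hk t ht, mul_assoc, ← Complex.exp_add]
      simp
    have hk1 : k 1 * k 1 = k 1 := by
      have h4 := hmul' 1 1 one_pos one_pos
      rw [hfk _ one_pos, hfk _ (by norm_num)] at h4
      have h5 : Complex.exp (γ * (1 + 1 : ℝ)) =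
          Complex.exp (γ * (1 : ℝ)) * Complex.exp (γ * (1 : ℝ)) := by
        rw [← Complex.exp_add]
        congr 1
        push_cast
        ring
      rw [h5] at h4
      refine mul_right_cancel₀ (mul_ne_zero (Complex.exp_ne_zero (γ * (1 : ℝ)))
        (Complex.exp_ne_zero (γ * (1 : ℝ)))) ?_
      linear_combination -h4
    rcases eq_or_ne (k 1) 0 with h0 | h0
    · refine absurd ?_ hGa
      refine intervalIntegral.integral_zero_ae (ae_of_all _ fun s hs => ?_)
      rw [uIoc_of_le ha.le] at hs
      rw [hfk s hs.1, h0, zero_mul]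
    · refine ⟨γ, fun t => ?_⟩
      rw [← hfF, hfk t t.2, mul_right_cancel₀ h0 (hk1.trans (one_mul _).symm), one_mul]
  -- if all integrals vanish, then `f` vanishes almost everywhere, hence everywhere
  · push Not at hG
    left
    have hloc : LocallyIntegrable f volume := by
      have h1 : LocallyIntegrable (fun _ : ℝ => (1 : ℝ)) volume := locallyIntegrable_const 1
      exact h1.mono hfm.aestronglyMeasurable (ae_of_all _ fun t => by simpa using hfb t)
    have hae : ∀ᵐ x, 0 < x → f x = 0 := by
      filter_upwards [LocallyIntegrable.ae_hasDerivAt_integral hloc] with x hx h0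
      refine (hx 0).unique ((hasDerivAt_const x (0 : ℂ)).congr_of_eventuallyEq ?_)
      filter_upwards [lt_mem_nhds h0] with s hs
      exact hG s hs
    intro t
    obtain ⟨x, hx, hxt⟩ : ∃ x ∈ Ioo (0 : ℝ) t, f x = 0 := by
      by_contra hne
      push Not at hne
      have h2 : volume (Ioo (0 : ℝ) t) = 0 := by
        refine measure_mono_null (fun x hx => ?_) (ae_iff.1 hae)
        simp only [mem_ofPred_eq, Classical.not_imp]
        exact ⟨hx.1, hne x hx⟩
      rw [Real.volume_Ioo] at h2
      have := t.2
      simp at h2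
      linarith
    have h3 := hmul' x (t - x) hx.1 (by linarith [hx.2])
    rw [add_sub_cancel, hxt, zero_mul, hfF] at h3
    exact h3

theorem nonneg_of_hasDerivAt {f : ℝ → ℝ} {f' : ℝ} (h : HasDerivAt f f' 0) (h0 : f 0 = 0)
    (hp : ∀ t, 0 < t → 0 ≤ f t) : 0 ≤ f' := by
  have h1 := h.hasDerivWithinAt (s := Ioi 0)
  rw [hasDerivWithinAt_iff_tendsto_slope' (by simp)] at h1
  refine ge_of_tendsto h1 ?_
  filter_upwards [self_mem_nhdsWithin] with t ht
  rw [slope_def_field, h0, sub_zero, sub_zero]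
  exact div_nonneg (hp t ht) (le_of_lt ht)

end Multiplicative

/-! ### Infinitesimal covariance of units -/

section Covariance

variable {H : Type*} [NormedAddCommGroup H] [InnerProductSpace ℂ H]

theorem hasDerivAt_exp_mul_zero (γ : ℂ) :
    HasDerivAt (fun t : ℝ => Complex.exp (γ * t)) γ 0 := by
  have := ((Complex.ofRealCLM.hasDerivAt (x := 0)).const_mul γ).cexp
  simpa using this

theorem norm_sub_unit_sq {E : ℝ → PosTime → H} {v : PosTime → H}
    (hE : ∀ x w t, inner ℂ (E x t) (E w t) = Complex.exp (-((x : ℂ) - w) ^ 2 / 2 * (t : ℝ)))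
    (hv : ∀ t, ‖v t‖ = 1) {γ₀ : ℂ}
    (h0 : ∀ t, inner ℂ (E 0 t) (v t) = Complex.exp (γ₀ * (t : ℝ))) (t : PosTime) :
    ‖v t - E 0 t‖ ^ 2 = 2 - 2 * (Complex.exp (γ₀ * (t : ℝ))).re := by
  have h1 : ‖E 0 t‖ ^ 2 = 1 := by
    have h := inner_self_eq_norm_sq (𝕜 := ℂ) (E 0 t)
    rw [hE] at h
    rw [← h]
    simp
  rw [norm_sub_rev, norm_sub_sq (𝕜 := ℂ), h1, hv, h0, RCLike.re_to_complex]
  ring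

/-- The exponents of the inner products of `v` with the units `E x` form a quadratic function.
The derivative at `t = 0` of the squared norm of a linear combination, with coefficients of sum
zero, of units at time `t` is nonnegative. The combination `R` below has vanishing derivative,
hence (by the Cauchy inequality) so has its inner product with `v - E 0`. -/
theorem exponent_eq {E : ℝ → PosTime → H} {v : PosTime → H}
    (hE : ∀ x w t, inner ℂ (E x t) (E w t) = Complex.exp (-((x : ℂ) - w) ^ 2 / 2 * (t : ℝ)))
    (hv : ∀ t, ‖v t‖ = 1) {γ₀ γ₁ γ : ℂ} {x : ℝ}
    (h0 : ∀ t, inner ℂ (E 0 t) (v t) = Complex.exp (γ₀ * (t : ℝ)))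
    (h1 : ∀ t, inner ℂ (E 1 t) (v t) = Complex.exp (γ₁ * (t : ℝ)))
    (hx : ∀ t, inner ℂ (E x t) (v t) = Complex.exp (γ * (t : ℝ))) :
    γ = γ₀ - (x : ℂ) ^ 2 / 2 + x * (γ₁ - γ₀ + 1 / 2) := by
  set A : ℂ := γ - (1 - x) * γ₀ - x * γ₁ + (x : ℂ) ^ 2 / 2 - x / 2 with hA
  suffices hA0 : A = 0 by linear_combination hA.symm.trans hA0
  let RR : ℝ → ℂ := fun t => 1 + (1 - x) ^ 2 + x ^ 2 -
    2 * (1 - x) * Complex.exp (-((x : ℂ) - (0 : ℝ)) ^ 2 / 2 * t) -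
    2 * x * Complex.exp (-((x : ℂ) - (1 : ℝ)) ^ 2 / 2 * t) +
    2 * x * (1 - x) * Complex.exp (-(((0 : ℝ) : ℂ) - (1 : ℝ)) ^ 2 / 2 * t)
  let Rd : ℝ → ℂ := fun t => Complex.exp (γ * t) - (1 - x) * Complex.exp (γ₀ * t) -
    x * Complex.exp (γ₁ * t) - (Complex.exp (-((x : ℂ) - (0 : ℝ)) ^ 2 / 2 * t) - (1 - x) -
      x * Complex.exp (-(((1 : ℝ) : ℂ) - (0 : ℝ)) ^ 2 / 2 * t))
  have hR' : HasDerivAt RR 0 0 := by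
    have := ((((hasDerivAt_const (0 : ℝ) (1 + (1 - (x : ℂ)) ^ 2 + (x : ℂ) ^ 2)).sub
      ((hasDerivAt_exp_mul_zero (-((x : ℂ) - (0 : ℝ)) ^ 2 / 2)).const_mul (2 * (1 - (x : ℂ))))).sub
      ((hasDerivAt_exp_mul_zero (-((x : ℂ) - (1 : ℝ)) ^ 2 / 2)).const_mul (2 * (x : ℂ)))).add
      ((hasDerivAt_exp_mul_zero (-(((0 : ℝ) : ℂ) - (1 : ℝ)) ^ 2 / 2)).const_mul
        (2 * (x : ℂ) * (1 - x))))
    refine this.congr_deriv ?_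
    push_cast
    ring
  have hd' : HasDerivAt Rd A 0 := by
    have := ((((hasDerivAt_exp_mul_zero γ).sub
      ((hasDerivAt_exp_mul_zero γ₀).const_mul (1 - (x : ℂ)))).sub
      ((hasDerivAt_exp_mul_zero γ₁).const_mul (x : ℂ))).sub
      (((hasDerivAt_exp_mul_zero (-((x : ℂ) - (0 : ℝ)) ^ 2 / 2)).sub_const (1 - (x : ℂ))).sub
        ((hasDerivAt_exp_mul_zero (-(((1 : ℝ) : ℂ) - (0 : ℝ)) ^ 2 / 2)).const_mul (x : ℂ))))
    refine this.congr_deriv ?_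
    rw [hA]
    push_cast
    ring
  have key : ∀ s : ℂ, 0 ≤ (2 * starRingEnd ℂ s * A - 2 * γ₀).re := by
    intro s
    let φ : ℝ → ℂ := fun t => (‖s‖ ^ 2 : ℝ) * RR t + 2 * starRingEnd ℂ s * Rd t +
      (2 - 2 * Complex.exp (γ₀ * t))
    have hφ : HasDerivAt φ (2 * starRingEnd ℂ s * A - 2 * γ₀) 0 := by
      refine (((hR'.const_mul ((‖s‖ ^ 2 : ℝ) : ℂ)).add (hd'.const_mul _)).add
        (((hasDerivAt_exp_mul_zero γ₀).const_mul 2).const_sub 2)).congr_deriv ?_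
      ring
    refine nonneg_of_hasDerivAt (f := fun t => (φ t).re)
      (Complex.reCLM.hasFDerivAt.comp_hasDerivAt (0 : ℝ) hφ) ?_ fun t ht => ?_
    · simp only [φ, RR, Rd, Complex.ofReal_zero, mul_zero, Complex.exp_zero]
      ring_nf
      simp
    · let τ : PosTime := ⟨t, ht⟩
      let R : H := E x τ - (1 - x : ℂ) • E 0 τ - (x : ℂ) • E 1 τ
      have hE1 : ∀ y, inner ℂ (E y τ) (E y τ) = 1 := fun y => by rw [hE]; simp
      have hE' : ∀ y w, inner ℂ (E y τ) (E w τ) = Complex.exp (-((w : ℂ) - y) ^ 2 / 2 * t) :=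
        fun y w => by rw [hE, sub_sq_comm]
      have eR : ‖R‖ ^ 2 = (RR t).re := by
        have h : inner ℂ R R = RR t := by
          simp only [R, RR, inner_sub_left, inner_sub_right, inner_smul_left, inner_smul_right,
            hE1, map_sub, map_one, Complex.conj_ofReal]
          rw [hE' 0 x, hE' 1 x, hE' 1 0, hE x 0, hE x 1, hE 0 1]
          simp only [τ]
          ring
        rw [← h, ← RCLike.re_to_complex, inner_self_eq_norm_sq]
      have ed : inner ℂ R (v τ - E 0 τ) = Rd t := by
        simp only [R, Rd, inner_sub_left, inner_sub_right, inner_smul_left,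
          hE1, map_sub, map_one, Complex.conj_ofReal, h0, h1, hx]
        rw [hE x 0, hE 1 0]
        simp only [τ]
        ring
      have e0 : ‖v τ - E 0 τ‖ ^ 2 = 2 - 2 * (Complex.exp (γ₀ * t)).re :=
        norm_sub_unit_sq hE hv h0 τ
      have e : (φ t).re = ‖s • R + (v τ - E 0 τ)‖ ^ 2 := by
        rw [norm_add_sq (𝕜 := ℂ), norm_smul, mul_pow, eR, inner_smul_left, ed, e0]
        simp only [φ, Complex.add_re, Complex.sub_re, Complex.re_ofReal_mul, RCLike.re_to_complex,
          mul_assoc]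
        simp
      rw [e]
      positivity
  by_contra hne
  have hn : 0 < Complex.normSq A := Complex.normSq_pos.2 hne
  -- a multiple of `-A` large enough to make the derivative equal to `-2`
  have h := key (-((1 - γ₀.re) / Complex.normSq A : ℝ) * A)
  have e : 2 * starRingEnd ℂ (-((1 - γ₀.re) / Complex.normSq A : ℝ) * A) * A - 2 * γ₀ =
      ((-2 * (1 - γ₀.re) : ℝ) : ℂ) - 2 * γ₀ := by
    rw [map_mul, map_neg, Complex.conj_ofReal, mul_assoc, mul_assoc,
      ← Complex.normSq_eq_conj_mul_self, ← Complex.ofReal_neg, ← Complex.ofReal_mul, neg_mul,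
      div_mul_cancel₀ _ hn.ne']
    push_cast
    ring
  rw [e] at h
  simp at h
  linarith

/-- None of the inner products vanishes identically as soon as one does not: as `t` tends to `0`,
the unit `E 0` approaches `v`, while its inner product with `E x` tends to `1`. -/
theorem exists_exponent {E : ℝ → PosTime → H} {v : PosTime → H}
    (hE : ∀ x w t, inner ℂ (E x t) (E w t) = Complex.exp (-((x : ℂ) - w) ^ 2 / 2 * (t : ℝ)))
    (hv : ∀ t, ‖v t‖ = 1)
    (hF : ∀ x, (∀ t, inner ℂ (E x t) (v t) = 0) ∨
      ∃ γ : ℂ, ∀ t : PosTime, inner ℂ (E x t) (v t) = Complex.exp (γ * (t : ℝ)))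
    (h0 : ¬ ∀ t, inner ℂ (E 0 t) (v t) = 0) :
    ∃ α ζ : ℂ, ∀ (x : ℝ) (t : PosTime), inner ℂ (E x t) (v t) =
      Complex.exp ((α - (x : ℂ) ^ 2 / 2 + x * ζ) * (t : ℝ)) := by
  obtain ⟨γ₀, hγ₀⟩ := (hF 0).resolve_left h0
  have hne : ∀ x, ¬ ∀ t, inner ℂ (E x t) (v t) = 0 := by
    intro x hx
    have h1 : ∀ t : PosTime, Real.exp (-x ^ 2 * t) ≤ 2 - 2 * (Complex.exp (γ₀ * (t : ℝ))).re := by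
      intro t
      rw [← norm_sub_unit_sq hE hv hγ₀ t]
      have h2 : inner ℂ (E x t) (E 0 t - v t) = (Real.exp (-x ^ 2 / 2 * t) : ℂ) := by
        rw [inner_sub_right, hx, hE]
        simp
      have h3 : ‖E x t‖ = 1 := by
        have h := inner_self_eq_norm_sq (𝕜 := ℂ) (E x t)
        rw [hE] at h
        refine (pow_eq_one_iff_of_nonneg (norm_nonneg _) two_ne_zero).1 ?_
        rw [← h]
        simp
      have h4 := norm_inner_le_norm (𝕜 := ℂ) (E x t) (E 0 t - v t)
      rw [h2, h3, one_mul, norm_sub_rev, Complex.norm_real,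
        Real.norm_of_nonneg (Real.exp_pos _).le] at h4
      have h5 := pow_le_pow_left₀ (Real.exp_pos _).le h4 2
      rw [← Real.exp_nat_mul] at h5
      refine le_trans (le_of_eq ?_) h5
      congr 1
      push_cast
      ring
    have c1 : Tendsto (fun t : ℝ => Real.exp (-x ^ 2 * t)) (𝓝[>] 0) (𝓝 (Real.exp (-x ^ 2 * 0))) :=
      (Continuous.tendsto (by fun_prop) 0).mono_left nhdsWithin_le_nhds
    have c2 : Tendsto (fun t : ℝ => 2 - 2 * (Complex.exp (γ₀ * t)).re) (𝓝[>] 0)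
        (𝓝 (2 - 2 * (Complex.exp (γ₀ * (0 : ℝ))).re)) := by
      refine Tendsto.mono_left (Continuous.tendsto ?_ 0) nhdsWithin_le_nhds
      exact continuous_const.sub (continuous_const.mul (Complex.continuous_re.comp (by fun_prop)))
    have := le_of_tendsto_of_tendsto c1 c2 (by
      filter_upwards [self_mem_nhdsWithin] with t ht
      exact h1 ⟨t, ht⟩)
    simp at this
    linarith
  obtain ⟨γ₁, hγ₁⟩ := (hF 1).resolve_left (hne 1)
  refine ⟨γ₀, γ₁ - γ₀ + 1 / 2, fun x t => ?_⟩
  obtain ⟨γ, hγ⟩ := (hF x).resolve_left (hne x)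
  rw [hγ, exponent_eq hE hv hγ₀ hγ₁ hγ]

end Covariance

/-! ### Classification of the units of the white noise part -/

section Classification

variable {Ω : Type*} [MeasurableSpace Ω] [StandardBorelSpace Ω] {N : Noise Ω} {B : ℝ → Ω → ℝ}
  {u v : PosTime → Lp ℂ 2 N.P}

/-- Inner products of normalized units are zero or exponential functions of time. -/
theorem IsNormalizedUnit.inner_eq_zero_or_exp (hu : N.IsNormalizedUnit u)
    (hv : N.IsNormalizedUnit v) : (∀ t, inner ℂ (u t) (v t) = 0) ∨
      ∃ γ : ℂ, ∀ t : PosTime, inner ℂ (u t) (v t) = Complex.exp (γ * (t : ℝ)) := by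
  refine eq_zero_or_eq_exp_of_mul (hu.1.borel.inner hv.1.borel) (fun s t => ?_) fun t => ?_
  · exact inner_isProd (hu.1.mem s) (hu.1.mem t) (hv.1.mem s) (hv.1.mem t) (hu.1.mul s t)
      (hv.1.mul s t)
  · refine (norm_inner_le_norm _ _).trans ?_
    rw [hu.2, hv.2, one_mul]

/-- A step exponential is a product of units, and inner products are multiplicative. -/
theorem IsUnit.inner_stepExp (hv : N.IsUnit v) (hB : N.IsAdaptedBM B) (δ : PosTime) (y : ℕ → ℝ)
    (n : ℕ) : ∀ τ : PosTime, (τ : ℝ) = (n + 1 : ℕ) * δ →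
      inner ℂ (stepExp hB δ y (n + 1)) (v τ) =
        ∏ k ∈ Finset.range (n + 1), inner ℂ (hB.unit (Complex.I * y k) δ) (v δ) := by
  induction n with
  | zero =>
    intro τ hτ
    obtain rfl : τ = δ := Subtype.ext (by simpa using hτ)
    rw [zero_add, stepExp_one, Finset.prod_range_one]
  | succ n ih =>
    intro τ hτ
    have hp : 0 < ((n + 1 : ℕ) : ℝ) * (δ : ℝ) := by
      have := δ.2
      positivity
    let σ : PosTime := ⟨(n + 1 : ℕ) * δ, hp⟩
    obtain rfl : τ = σ + δ := Subtype.ext (by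
      rw [hτ, Positive.coe_add]
      change _ = ((n + 1 : ℕ) : ℝ) * (δ : ℝ) + δ
      push_cast
      ring)
    rw [Finset.prod_range_succ, ← ih σ rfl]
    exact inner_isProd (stepExp_mem_H hB δ y (n + 1) rfl) (hB.unit_mem_H _ _) (hv.mem σ)
      (hv.mem δ) (isProd_stepExp hB δ y (n + 1) rfl) (hv.mul σ δ)

/-- Every normalized unit of the white noise part is, up to a factor `exp (i c t)`, one of the
units `exp (z B_t - (Re z)² t)`. -/
theorem IsNormalizedUnit.exists_eq (hv : N.IsNormalizedUnit v) (hB : N.IsAdaptedBM B)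
    (hvW : ∀ t, v t ∈ N.Hwhite B t) : ∃ (z : ℂ) (c : ℝ), ∀ t : PosTime,
      v t = Complex.exp (Complex.I * c * (t : ℝ)) • hB.unit z t := by
  have hpart : ∀ (t : PosTime) (n : ℕ), (t : ℝ) = (n + 1 : ℕ) * (t.part n : ℝ) := fun t n => by
    rw [PosTime.part]
    push_cast
    field_simp
  have hF := fun y : ℝ => (hB.isNormalizedUnit_unit (Complex.I * y)).inner_eq_zero_or_exp hv
  -- step exponentials are total, hence `v` is not orthogonal to all the units `exp (i y B_t)`
  obtain ⟨y₀, hy₀⟩ : ∃ y₀ : ℝ, ¬ ∀ t, inner ℂ (hB.unit (Complex.I * y₀) t) (v t) = 0 := by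
    by_contra hne
    push Not at hne
    refine hv.1.ne_zero ⟨1, one_pos⟩ (eq_zero_of_stepSum hB (hvW _) fun n y => ?_)
    rw [← inner_stepExp_neg hB]
    refine (hv.1.inner_stepExp hB (PosTime.part _ n) (-y) n _ (hpart _ n)).trans ?_
    exact Finset.prod_eq_zero (Finset.mem_range.2 n.succ_pos) (hne _ _)
  have hE : ∀ (x w : ℝ) (t : PosTime), inner ℂ (hB.unit (Complex.I * (y₀ + x : ℝ)) t)
      (hB.unit (Complex.I * (y₀ + w : ℝ)) t) =
        Complex.exp (-((x : ℂ) - w) ^ 2 / 2 * (t : ℝ)) := by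
    intro x w t
    rw [hB.inner_unit]
    congr 2
    simp only [map_mul, Complex.conj_I, Complex.conj_ofReal, Complex.mul_re, Complex.I_re,
      Complex.ofReal_re, Complex.I_im, Complex.ofReal_im, zero_mul, mul_zero, sub_zero,
      Complex.ofReal_zero]
    push_cast
    linear_combination (((w : ℂ) - x) ^ 2 / 2) * Complex.I_sq
  obtain ⟨α, ζ, hα⟩ := exists_exponent hE hv.2 (fun x => hF (y₀ + x)) (by simpa using hy₀)
  -- compare the quadratic exponent with that of the unit with parameter `z`
  let z : ℂ := Complex.I * (ζ + y₀)
  let κ : ℂ := α - y₀ ^ 2 / 2 - y₀ * ζ - z ^ 2 / 2 + (z.re : ℂ) ^ 2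
  have hκ : ∀ (y : ℝ) (t : PosTime), inner ℂ (hB.unit (Complex.I * y) t) (v t) =
      Complex.exp (κ * (t : ℝ)) * inner ℂ (hB.unit (Complex.I * y) t) (hB.unit z t) := by
    intro y t
    have h1 := hα (y - y₀) t
    rw [add_sub_cancel] at h1
    rw [h1, hB.inner_unit, ← Complex.exp_add, ← add_mul]
    congr 2
    simp only [κ, map_mul, Complex.conj_I, Complex.conj_ofReal]
    simp only [Complex.mul_re, Complex.I_re, Complex.ofReal_re, Complex.I_im, Complex.ofReal_im,
      z, zero_mul, mul_zero, sub_zero, Complex.ofReal_zero]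
    push_cast
    linear_combination (-(y : ℂ) ^ 2 / 2 + y * (ζ + y₀)) * Complex.I_sq
  have hveq : ∀ t, v t = Complex.exp (κ * (t : ℝ)) • hB.unit z t := by
    intro t
    refine sub_eq_zero.1 (eq_zero_of_stepSum hB (Submodule.sub_mem _ (hvW t)
      (Submodule.smul_mem _ _ (hB.unit_mem_Hwhite z t))) fun n y => ?_)
    rw [← inner_stepExp_neg hB, inner_sub_right, inner_smul_right]
    have h1 := hv.1.inner_stepExp hB (t.part n) (-y) n t (hpart t n)
    have h2 := (hB.isNormalizedUnit_unit z).1.inner_stepExp hB (t.part n) (-y) n t (hpart t n)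
    simp only [hκ, Finset.prod_mul_distrib, Finset.prod_const, Finset.card_range,
      ← Complex.exp_nat_mul] at h1
    rw [← h2] at h1
    have h3 : ((n + 1 : ℕ) : ℂ) * (κ * (t.part n : ℝ)) = κ * (t : ℝ) := by
      rw [hpart t n]
      push_cast
      ring
    rw [h3] at h1
    exact sub_eq_zero.2 h1
  have hre : κ.re = 0 := by
    have h1 := hv.2 ⟨1, one_pos⟩
    rw [hveq, norm_smul, hB.norm_unit, mul_one, Complex.norm_exp] at h1
    simpa using h1
  refine ⟨z, κ.im, fun t => ?_⟩
  rw [hveq t]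
  congr 3
  conv_lhs => rw [← Complex.re_add_im κ, hre]
  simp [mul_comm]

/-- The image of a normalized unit under an automorphism. -/
theorem IsNormalizedUnit.map (hu : N.IsNormalizedUnit u) (Θ : N.Aut) :
    N.IsNormalizedUnit fun t => (Θ.op t ⟨u t, hu.1.mem t⟩ : Lp ℂ 2 N.P) := by
  have hn : ∀ t, ‖(Θ.op t ⟨u t, hu.1.mem t⟩ : Lp ℂ 2 N.P)‖ = 1 := fun t =>
    ((Θ.op t).norm_map _).trans (hu.2 t)
  exact
    ⟨{  mem := fun t => (Θ.op t _).2
        ne_zero := fun t h => by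
          have := hn t
          rw [h, norm_zero] at this
          exact zero_ne_one this
        borel := Θ.borelMap monotone_H (X := fun t => ⟨u t, hu.1.mem t⟩) hu.1.borel
        mul := fun s t => Θ.map_mul s t _ _ ⟨u (s + t), hu.1.mem _⟩ (hu.1.mul s t) }, hn⟩

/-- If there are no other units, every automorphism acts on the plane of units. -/
theorem NoOtherUnits.exists_acts (hU : N.NoOtherUnits B) (hB : N.IsAdaptedBM B) (Θ : N.Aut) :
    ∃ g, Acts hB Θ g := by
  have h : ∀ z, ∃ (w : ℂ) (c : ℝ), ∀ t : PosTime, Θ.op t (hB.unitH z t) =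
      Complex.exp (Complex.I * c * (t : ℝ)) • hB.unitH w t := by
    intro z
    have hv := (hB.isNormalizedUnit_unit z).map Θ
    obtain ⟨w, c, h⟩ := hv.exists_eq hB (hU _ hv.1)
    exact ⟨w, c, fun t => Subtype.ext (h t)⟩
  choose g c hc using h
  exact ⟨g, fun z => ⟨c z, hc z⟩⟩

end Classification

/-! ### The subsystem generated by the units -/

theorem aesm_prod {Ω ι : Type*} {G : MeasurableSpace Ω} {m : MeasurableSpace Ω} {μ : Measure[m] Ω}
    (s : Finset ι) {f : ι → Ω → ℂ} (h : ∀ i, AEStronglyMeasurable[G] (f i) μ) :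
    AEStronglyMeasurable[G] (fun ω => ∏ i ∈ s, f i ω) μ := by
  classical
  induction s using Finset.induction_on with
  | empty =>
    simp only [Finset.prod_empty]
    exact aestronglyMeasurable_const
  | insert i s hi ih =>
    simp only [Finset.prod_insert hi]
    exact (h i).mul ih

section UnitSpan

variable {Ω : Type*} [MeasurableSpace Ω] [StandardBorelSpace Ω] {N : Noise Ω} {B : ℝ → Ω → ℝ}

theorem aesm_whiteField_shifted (hB : N.IsAdaptedBM B) {t δ : PosTime} {s : ℝ} (hs : 0 ≤ s)
    (hst : s + δ ≤ t) {ψ : Lp ℂ 2 N.P} (hψ : ψ ∈ N.Hwhite B δ) :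
    AEStronglyMeasurable[whiteField B 0 t] (fun ω => ψ (N.T s ω)) N.P := by
  obtain ⟨X, hX, e⟩ := (mem_Hwhite_iff hB).1 hψ
  have h1 : (fun ω => ψ (N.T s ω)) =ᵐ[N.P]
      fun ω => X (fun u : Icc (0 : ℝ) δ => B (u + s) ω - B s ω) :=
    ((N.quasi_T s).ae_eq_comp e).trans
      (ae_eq_comp_of_coord (Z := fun ω => path B δ (N.T s ω)) (fun i => hB.comp_T i.2.1 s) hX)
  have hδ := δ.2
  refine (aesm_comp_path (Z := fun ω (u : Icc (0 : ℝ) δ) => B (u + s) ω - B s ω)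
    (fun u => ?_) hX).congr h1.symm
  have hu := u.2
  exact (aesm_whiteField hB t.2 ⟨by linarith [hu.1], by linarith [hu.2]⟩).sub
    (aesm_whiteField hB t.2 ⟨hs, by linarith⟩)

theorem NoOtherUnits.unitSpan_le (hU : N.NoOtherUnits B) (hB : N.IsAdaptedBM B) (t : PosTime) :
    N.unitSpan t ≤ N.Hwhite B t := by
  refine Submodule.topologicalClosure_minimal _ (Submodule.span_le.2 ?_) (isClosed_Hwhite hB t)
  rintro z ⟨n, u, hu, e⟩
  refine mem_lpMeas_iff_aestronglyMeasurable.2 (AEStronglyMeasurable.congr ?_ e.symm)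
  refine aesm_prod Finset.univ fun k => ?_
  have hδ := (t.part n).2
  refine aesm_whiteField_shifted hB (by positivity) ?_ (hU _ (hu k) (t.part n))
  have hk : ((k : ℕ) : ℝ) + 1 ≤ n + 1 := by exact_mod_cast k.2
  have ht : (t : ℝ) = (n + 1) * (t.part n : ℝ) := by
    rw [PosTime.part]
    field_simp
  rw [ht]
  nlinarith

/-- The factors are the units `exp (i y_k B_t)`. -/
theorem isUnitProduct_stepExp (hB : N.IsAdaptedBM B) (t : PosTime) (y : ℕ → ℝ) (n : ℕ) :
    N.IsUnitProduct t (stepExp hB (t / (n + 1)) y (n + 1)) := by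
  refine ⟨n, fun k => hB.unit (Complex.I * y k), fun k => (hB.isNormalizedUnit_unit _).1, ?_⟩
  have h : ∀ k : Fin (n + 1), ∀ᵐ ω ∂N.P,
      hB.unit (Complex.I * y k) (t.part n) (N.T ((k : ℕ) * (t.part n : ℝ)) ω) =
        Complex.exp (Complex.I * (y k * (B ((k + 1) * (t / (n + 1))) ω -
          B (k * (t / (n + 1))) ω) : ℝ)) := by
    intro k
    filter_upwards [(N.quasi_T ((k : ℕ) * (t.part n : ℝ))).ae_eq_comp
      (hB.unit_coeFn (Complex.I * y k) (t.part n)),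
      hB.comp_T (t.part n).2.le ((k : ℕ) * (t.part n : ℝ))] with ω a b
    have a' : hB.unit (Complex.I * y k) (t.part n) (N.T ((k : ℕ) * (t.part n : ℝ)) ω) =
      stdUnit B (Complex.I * y k) (t.part n) (N.T ((k : ℕ) * (t.part n : ℝ)) ω) := a
    have e : (t.part n : ℝ) = t / (n + 1) := rfl
    rw [a', stdUnit, b, e, show (t : ℝ) / (n + 1) + k * (t / (n + 1)) =
      (k + 1) * (t / (n + 1)) by ring]
    congr 1
    simp
    ring
  filter_upwards [stepExp_coeFn hB (t / (n + 1)) y (n + 1), ae_all_iff.2 h] with ω a b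
  rw [a, Finset.prod_congr rfl fun k _ => b k, ← Complex.exp_sum, stepSum, Finset.sum_range,
    Complex.ofReal_sum, Finset.mul_sum]

theorem Hwhite_le_unitSpan (hB : N.IsAdaptedBM B) (t : PosTime) :
    N.Hwhite B t ≤ N.unitSpan t :=
  Hwhite_le_of_stepExp hB (Submodule.isClosed_topologicalClosure _) fun n y =>
    Submodule.le_topologicalClosure _ (Submodule.subset_span (isUnitProduct_stepExp hB t y n))

theorem NoOtherUnits.unitSpan_eq (hU : N.NoOtherUnits B) (hB : N.IsAdaptedBM B) :
    N.unitSpan = N.Hwhite B :=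
  funext fun t => le_antisymm (hU.unitSpan_le hB t) (Hwhite_le_unitSpan hB t)

theorem exists_systemIso_of_eq {E E' : PosTime → Submodule ℂ (Lp ℂ 2 N.P)} (e : E = E')
    (Θ : SystemIso N E N E) : ∃ Θ' : SystemIso N E' N E', ∀ (t : PosTime) (ψ : E t) (x : E' t),
      (x : Lp ℂ 2 N.P) = ψ → (Θ'.op t x : Lp ℂ 2 N.P) = Θ.op t ψ := by
  subst e
  exact ⟨Θ, fun t ψ x h => by rw [Subtype.ext h]⟩

theorem DriftSensitive.exists_isRealShift (hN : N.DriftSensitive B) (hB : N.IsAdaptedBM B)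
    {lam : ℝ} (hlam : lam ≠ 0) :
    ∃ Θw : N.WhiteAut B, N.IsRealShift B lam Θw ∧ ¬ N.Extendable B Θw := by
  obtain ⟨N', hd, -⟩ := hN (2 * lam) (mul_ne_zero two_ne_zero hlam)
  exact ⟨hd.realShift hB, hd.isRealShift hB,
    hN.not_extendable hB hlam (hd.isRealShift hB).induces⟩

/-- If the units generated the whole system, it would coincide with the white noise part, and every
real shift would be extendable. -/
theorem DriftSensitive.isTypeIIOne (hN : N.DriftSensitive B) (hB : N.IsAdaptedBM B)
    (hU : N.NoOtherUnits B) : N.IsTypeIIOne := by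
  have e := hU.unitSpan_eq hB
  refine ⟨fun hI => ?_, Ω, inferInstance, inferInstance, N, B, hB, ?_⟩
  · obtain ⟨Θw, -, hΘw⟩ := hN.exists_isRealShift hB one_ne_zero
    exact hΘw (exists_systemIso_of_eq (e.symm.trans (funext hI)) Θw)
  · rw [e]
    exact ⟨SystemIso.refl N _⟩

/-- The parameter at `0` can be taken equal to `w`, as the constant unit is mapped exactly to the
unit with parameter `w`. -/
theorem NoOtherUnits.exists_acts_of_unitTransitive (hU : N.NoOtherUnits B)
    (hB : N.IsAdaptedBM B) (hT : N.UnitTransitive) (w : ℂ) :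
    ∃ (Θ : N.Aut) (g : ℂ → ℂ), Acts hB Θ g ∧ g 0 = w := by
  classical
  obtain ⟨Θ, hΘ⟩ := hT _ _ (hB.isNormalizedUnit_unit 0) (hB.isNormalizedUnit_unit w)
  obtain ⟨g, hg⟩ := hU.exists_acts hB Θ
  refine ⟨Θ, Function.update g 0 w, fun z => ?_, Function.update_self 0 w g⟩
  rcases eq_or_ne z 0 with rfl | hz
  · refine ⟨0, fun t => Subtype.ext ?_⟩
    rw [hΘ t (hB.unitH 0 t) rfl, Function.update_self]
    simp [IsAdaptedBM.unitH]
  · rw [Function.update_of_ne hz]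
    exact hg z

theorem DriftSensitive.not_unitTransitive (hN : N.DriftSensitive B) (hB : N.IsAdaptedBM B)
    (hU : N.NoOtherUnits B) : ¬ N.UnitTransitive := by
  intro hT
  obtain ⟨Θ, g, hg, h0⟩ := hU.exists_acts_of_unitTransitive hB hT 1
  obtain ⟨Θ', g', hg', h0'⟩ := hU.exists_acts_of_unitTransitive hB hT 2
  exact hN.not_acts_of_acts hg hg' h0 h0'

end UnitSpan

end Noise

theorem corollary2 {Ω : Type*} [MeasurableSpace Ω] [StandardBorelSpace Ω] (N : Noise Ω)
    (B : ℝ → Ω → ℝ) (hB : N.IsAdaptedBM B) (hN : N.DriftSensitive B) :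
    -- no real shift extends to an automorphism of the whole system
    (∀ lam : ℝ, lam ≠ 0 → ∃ Θw : N.WhiteAut B, N.IsRealShift B lam Θw ∧ ¬ N.Extendable B Θw) ∧
    -- every imaginary shift does
    (∀ lam : ℝ, ∃ Θw : N.WhiteAut B, N.IsImagShift B lam Θw ∧ N.Extendable B Θw) ∧
    -- the same in terms of the motions of the plane of units
    (∀ lam : ℝ, lam ≠ 0 →
      AffineIsometryEquiv.constVAdd ℂ ℂ (lam : ℂ) ∉ N.extendableMotions B) ∧
    (∀ lam : ℝ,
      AffineIsometryEquiv.constVAdd ℂ ℂ (Complex.I * lam) ∈ N.extendableMotions B) ∧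
    -- the motions induced by extendable automorphisms are not transitive on the plane
    (¬ ∀ z w : ℂ, ∃ g ∈ N.extendableMotions B, g z = w) ∧
    -- if there are no other units: type II₁, and automorphisms are not transitive on units
    (N.NoOtherUnits B → N.IsTypeIIOne ∧ ¬ N.UnitTransitive) := by
  refine ⟨fun lam hlam => hN.exists_isRealShift hB hlam,
    fun lam => ⟨hB.whiteImagShift lam, hB.isImagShift_whiteImagShift lam,
      hB.extendable_whiteImagShift lam⟩,
    fun lam hlam => ?_,
    fun lam => ⟨hB.whiteImagShift lam, hB.extendable_whiteImagShift lam,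
      (hB.isImagShift_whiteImagShift lam).induces⟩,
    fun h => ?_,
    fun hU => ⟨hN.isTypeIIOne hB hU, hN.not_unitTransitive hB hU⟩⟩
  · rintro ⟨Θw, hΘw, hi⟩
    exact hN.not_extendable hB hlam hi hΘw
  · obtain ⟨g, ⟨Θw, hΘw, hi⟩, hg⟩ := h 0 1
    obtain ⟨g', ⟨Θw', hΘw', hi'⟩, hg'⟩ := h 0 2
    obtain ⟨Θ, hΘ⟩ := hΘw.exists_acts hB hi
    obtain ⟨Θ', hΘ'⟩ := hΘw'.exists_acts hB hi'
    exact hN.not_acts_of_acts hΘ hΘ' hg hg'
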